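/- Consider $\mathrm{PSL}_2(\mathbb{Z})=\langle a,b\mid a^2=b^3=1\rangle$, where $a$ and $b$ are the classes of $\begin{pmatrix}0&-1\\1&0\end{pmatrix}$ and $\begin{pmatrix}0&-1\\1&1\end{pmatrix}$. A word over $\{a,b,b^{-1}\}$ is called normal if it has length at most $1$ or alternates between the letter $a$ and letters in $\{b,b^{-1}\}$; every element of $\mathrm{PSL}_2(\mathbb{Z})$ is represented by exactly one normal word. The Schreier graph of a subgroup $H$ has the right cosets $Hg$ as vertices, and reading a letter $\ell$ leads from $Hg$ to $Hg\ell$. The Stallings graph of $H$ is the subgraph of the Schreier graph spanned by the loops at the vertex $H$ that read the normal representatives of the elements of $H$; it is finite if $H$ is finitely generated. The size of a finitely generated subgroup is the number of vertices of its Stallings graph. A subgroup $H$ is almost malnormal if $H\cap x^{-1}Hx$ is finite for every $x\in\mathrm{PSL}_2(\mathbb{Z})\setminus H$. For every integer $n\ge 1$, the set of finitely generated subgroups of $\mathrm{PSL}_2(\mathbb{Z})$ of size $n$ is finite and non-empty. Let $0<\alpha<\frac16$. The probability that a finitely generated subgroup of $\mathrm{PSL}_2(\mathbb{Z})$, chosen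 uniformly at random among those of size $n$, is almost malnormal is $\mathcal{O}(n^{-\alpha})$ as $n\to\infty$, where the implied constant may depend on $\alpha$. -/

import Mathlib

namespace ModularSubgroup

/-- The modular group `PSL₂(ℤ)`. -/
abbrev PSL2Z : Type := Matrix.ProjectiveSpecialLinearGroup (Fin 2) ℤ

/-- The generator `a` of order `2`: the class of the matrix `[[0, -1], [1, 0]]`. -/
def genA : PSL2Z :=
  QuotientGroup.mk (⟨!![0, -1; 1, 0], by simp [Matrix.det_fin_two]⟩ :
    Matrix.SpecialLinearGroup (Fin 2) ℤ)

/-- The generator `b` of order `3`: the class of the matrix `[[0, -1], [1, 1]]`.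
With these choices `⟨a, b ∣ a² = b³ = 1⟩` is a presentation of `PSL₂(ℤ)`, and `ab` is the class
of `[[1, 1], [0, 1]]` (up to sign). -/
def genB : PSL2Z :=
  QuotientGroup.mk (⟨!![0, -1; 1, 1], by simp [Matrix.det_fin_two]⟩ :
    Matrix.SpecialLinearGroup (Fin 2) ℤ)

/-- The alphabet `{a, b, b⁻¹}` (the letter `a⁻¹` is not needed since `a⁻¹ = a`). -/
inductive Letter : Type
  | a : Letter
  | b : Letter
  | bInv : Letter

/-- The element of `PSL₂(ℤ)` denoted by a letter. -/
def Letter.eval : Letter → PSL2Z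
  | .a => genA
  | .b => genB
  | .bInv => genB⁻¹

/-- The element of `PSL₂(ℤ)` denoted by a word. -/
def evalWord (w : List Letter) : PSL2Z := (w.map Letter.eval).prod

/-- A word is normal (equivalently, geodesic) if it has length at most `1` or alternates between
the letter `a` and letters in `{b, b⁻¹}`: of two consecutive letters exactly one is `a`. -/
def IsNormal (w : List Letter) : Prop :=
  w.IsChain (fun x y => ¬ (x = Letter.a ↔ y = Letter.a))

/-- The set of right cosets `H g` of a subgroup `H`. -/
abbrev RightCosets (H : Subgroup PSL2Z) : Type := Quotient (QuotientGroup.rightRel H)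

/-- The right coset `H g`. -/
def coset (H : Subgroup PSL2Z) (g : PSL2Z) : RightCosets H :=
  Quotient.mk (QuotientGroup.rightRel H) g

/-- A graph with vertices in `V` whose edges carry letters; `edge x ℓ y` means that one can go
from `x` to `y` by reading the letter `ℓ` (a `b`-edge is read as `b⁻¹` when traversed backward). -/
structure LetterGraph (V : Type) where
  verts : Set V
  edge : V → Letter → V → Prop

/-- The Schreier (coset) graph of `H`: the vertices are all the cosets `H g`, and reading the
letter `ℓ` leads from `H g` to `H g ℓ`. -/
def schreierGraph (H : Subgroup PSL2Z) : LetterGraph (RightCosets H) where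
  verts := Set.univ
  edge x ℓ y := ∃ g : PSL2Z, x = coset H g ∧ y = coset H (g * ℓ.eval)

/-- The Stallings graph of `H` (rooted at the coset `H`): the part of the Schreier graph spanned by
the loops at the vertex `H` that read the normal representatives of the elements of `H`.
The path from `H` that reads `w` visits exactly the cosets `H u`, for `u` a prefix of `w`. -/
def stallingsGraph (H : Subgroup PSL2Z) : LetterGraph (RightCosets H) where
  verts := {x | ∃ w : List Letter, IsNormal w ∧ evalWord w ∈ H ∧
    ∃ u : List Letter, u <+: w ∧ x = coset H (evalWord u)}
  edge x ℓ y := (schreierGraph H).edge x ℓ y ∧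
    ∃ w : List Letter, IsNormal w ∧ evalWord w ∈ H ∧
      ∃ u : List Letter, (u ++ [ℓ]) <+: w ∧ x = coset H (evalWord u)

/-- The size of a subgroup: the number of vertices of its Stallings graph (which is finite when the
subgroup is finitely generated). -/
noncomputable def size (H : Subgroup PSL2Z) : ℕ := (stallingsGraph H).verts.ncard

/-- `H` is almost malnormal if `H ∩ x⁻¹ H x` is finite for every `x ∉ H`. -/
def IsAlmostMalnormal (H : Subgroup PSL2Z) : Prop :=
  ∀ x : PSL2Z, x ∉ H → {h : PSL2Z | h ∈ H ∧ x * h * x⁻¹ ∈ H}.Finite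

/-- The set of finitely generated subgroups of `PSL₂(ℤ)` of size `n`. -/
def fgSubgroupsOfSize (n : ℕ) : Set (Subgroup PSL2Z) := {H | H.FG ∧ size H = n}

/-- The probability that a uniformly random finitely generated subgroup of size `n` has the
property `P`. -/
noncomputable def probOfSize (n : ℕ) (P : Subgroup PSL2Z → Prop) : ℝ :=
  ({H | H ∈ fgSubgroupsOfSize n ∧ P H}.ncard : ℝ) / ((fgSubgroupsOfSize n).ncard : ℝ)

end ModularSubgroup

namespace ModularSubgroup

/-! ### Words and their normal forms -/

/-! A subgroup of size `n` is recovered from its Stallings graph. Once the vertices are labelled by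
`Fin n`, with the root at `r`, this graph is encoded by an involution `f` (the `a`-edges), a
permutation `g` whose cycles have length at most three (the `b`-edges, where a transposition stands
for a `b`-edge outside every triangle and its start is marked), and two bits that say which edges
are missing at the root. A rooted graph of this kind has no non-trivial automorphism
(`eq_of_represents`), so each subgroup has as many encodings as there are permutations fixing `r`.
Conversely, every connected pair `(f, g)` comes from a finitely generated subgroup
(`exists_subgroup`). The probability is therefore bounded by comparing numbers of pairs
(`card_almostMalnormal_le`, `card_connected_le`).

If `H` is almost malnormal, two cycles of `g ∘ f` that avoid the root and the marked points cannot
coexist: both read powers of `ab`, so a common power of the parabolic element `ab`, which has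
infinite order, would fix two distinct cosets. At most one further cycle contains the root, so at
most two cycles avoid the marks (`IsAlmostMalnormal.card_cycles_le`).

For fixed `g` with set of marks `E`, a random involution `f` rarely creates so few cycles. When `f`
is revealed pair by pair, each stage with `u > |E| + 1` free points offers a pair that closes a
cycle avoiding `E` (`exists_closing_pair`), chosen with probability about `1/u`. As a transposition
uses two points, the mean of `s ^ (number of cycles)` is at most of order `(|E|/n)^γ` for every `γ <
(1 - s)/2` (`sum_pow_card_cycles_le`, `exists_invol_rpow_le`). The mean of `|E|` is `O(n^(2/3))`
(`sum_card_marks_le`, `sq_mul_tern_le`). With `γ = 3α < 1/2` this yields `(n^(-1/3))^(3α) = n^(-α)`,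
which is where `1/6` comes from.

It remains to see that at least half of all pairs are connected for large `n`. The numbers of
involutions and of maps `g` grow by factors close to `n^(1/2)` and `n^(2/3)` per step, so splitting
off `k` points costs about `(n choose k)^(1 - 7/6)`, and the sum over `k` tends to zero
(`eventually_sum_pairCount_le`). The growth of `tern` follows from its recursion and a
near-monotonicity of its ratios. The latter is a variance inequality, available because the
exponential generating function `exp(x + x² + x³/3) = exp(((1 + x)³ - 1)/3)` exhibits `tern n` as a
factorial moment (`hasSum_tern`, `tern_sq_le`). -/

/-- Whether a letter is `a`. -/
def Letter.isA : Letter → Bool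
  | .a => true
  | .b => false
  | .bInv => false

/-- The formal inverse of a letter. -/
def Letter.inv : Letter → Letter
  | .a => .a
  | .b => .bInv
  | .bInv => .b

/-- The formal inverse of a word. -/
def invWord (w : List Letter) : List Letter := (w.map Letter.inv).reverse

/-- `Alt τ w τ'`: the word `w` alternates, its first letter (if any) is `a` iff `τ`, and a letter
that may follow `w` is `a` iff `τ'`. -/
def Alt : Bool → List Letter → Bool → Prop
  | τ, [], τ' => τ = τ'
  | τ, ℓ :: w, τ' => ℓ.isA = τ ∧ Alt (!τ) w τ'

theorem alt_append {τ τ'' : Bool} {u v : List Letter} :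
    Alt τ (u ++ v) τ'' ↔ ∃ τ', Alt τ u τ' ∧ Alt τ' v τ'' := by
  induction u generalizing τ with
  | nil => simp [Alt]
  | cons ℓ u ih => simp [Alt, ih, and_assoc]

theorem Letter.isA_inv (ℓ : Letter) : ℓ.inv.isA = ℓ.isA := by cases ℓ <;> rfl

theorem Letter.isA_iff {ℓ : Letter} : ℓ = .a ↔ ℓ.isA = true := by cases ℓ <;> simp [isA]

theorem invWord_cons (ℓ : Letter) (w : List Letter) : invWord (ℓ :: w) = invWord w ++ [ℓ.inv] := by
  simp [invWord]

theorem Alt.invWord {τ τ' : Bool} {w : List Letter} (h : Alt τ w τ') :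
    Alt (!τ') (invWord w) (!τ) := by
  induction w generalizing τ with
  | nil => simpa [Alt, ModularSubgroup.invWord] using h.symm
  | cons ℓ w ih =>
    rw [invWord_cons, alt_append]
    refine ⟨τ, by simpa using ih h.2, ?_⟩
    simp [Alt, Letter.isA_inv, h.1]

theorem Alt.isNormal {τ τ' : Bool} {w : List Letter} (h : Alt τ w τ') : IsNormal w := by
  induction w generalizing τ with
  | nil => exact List.isChain_nil
  | cons ℓ w ih =>
    cases w with
    | nil => exact List.isChain_singleton _
    | cons m w =>
      refine List.isChain_cons_cons.2 ⟨?_, ih h.2⟩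
      have h1 := h.1
      have h2 := h.2.1
      rw [Letter.isA_iff, Letter.isA_iff, h1, h2]
      cases τ <;> simp

theorem IsNormal.alt {w : List Letter} (h : IsNormal w) :
    ∃ τ', Alt (w.head?.elim true Letter.isA) w τ' := by
  induction w with
  | nil => exact ⟨true, rfl⟩
  | cons ℓ w ih =>
    cases w with
    | nil => exact ⟨!ℓ.isA, rfl, rfl⟩
    | cons m w =>
      obtain ⟨h1, h2⟩ := List.isChain_cons_cons.1 h
      obtain ⟨τ', h'⟩ := ih h2
      refine ⟨τ', rfl, ?_⟩
      rw [Letter.isA_iff, Letter.isA_iff] at h1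
      have : m.isA = !ℓ.isA := by
        revert h1; cases m.isA <;> cases ℓ.isA <;> simp
      simpa [this] using h'

theorem isNormal_iff {w : List Letter} : IsNormal w ↔ ∃ τ τ', Alt τ w τ' :=
  ⟨fun h => ⟨_, h.alt⟩, fun ⟨_, _, h⟩ => h.isNormal⟩

theorem IsNormal.tail {ℓ : Letter} {w : List Letter} (h : IsNormal (ℓ :: w)) : IsNormal w := by
  obtain ⟨_, _, h⟩ := isNormal_iff.1 h
  exact h.2.isNormal

theorem IsNormal.alt_tail {ℓ : Letter} {w : List Letter} (h : IsNormal (ℓ :: w)) :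
    ∃ τ', Alt (!ℓ.isA) w τ' := by
  obtain ⟨_, τ', h⟩ := isNormal_iff.1 h
  exact ⟨τ', h.1 ▸ h.2⟩

@[simp] theorem evalWord_nil : evalWord [] = 1 := rfl

theorem evalWord_cons (ℓ : Letter) (w : List Letter) : evalWord (ℓ :: w) = ℓ.eval * evalWord w := by
  simp [evalWord]

theorem evalWord_append (u v : List Letter) : evalWord (u ++ v) = evalWord u * evalWord v := by
  simp [evalWord]

theorem evalWord_singleton (ℓ : Letter) : evalWord [ℓ] = ℓ.eval := by simp [evalWord]

/-! ### Relations in the modular group -/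

/-- The centre of `SL₂(ℤ)` consists of the scalars with square `1`, that is of `±1`; this reduces
equalities in `PSL2Z` to integer matrices. -/
theorem mk_eq_mk_iff {M N : Matrix.SpecialLinearGroup (Fin 2) ℤ} :
    (QuotientGroup.mk M : PSL2Z) = QuotientGroup.mk N ↔ M = N ∨ M = -N := by
  rw [QuotientGroup.eq, Matrix.SpecialLinearGroup.mem_center_iff]
  constructor
  · rintro ⟨r, hr, h⟩
    have h' : (N : Matrix (Fin 2) (Fin 2) ℤ) = M * Matrix.scalar (Fin 2) r := by
      rw [h, Matrix.SpecialLinearGroup.coe_mul, ← mul_assoc, ← Matrix.SpecialLinearGroup.coe_mul]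
      simp
    have hr' : r = 1 ∨ r = -1 := by simpa using hr
    rcases hr' with rfl | rfl
    · left; apply Subtype.ext; rw [h']; simp
    · right; apply Subtype.ext; rw [Matrix.SpecialLinearGroup.coe_neg, h']; simp
  · rintro (rfl | rfl)
    · exact ⟨1, by simp, by simp⟩
    · refine ⟨-1, by simp, ?_⟩
      have : (-N)⁻¹ * N = -1 := by
        rw [inv_mul_eq_iff_eq_mul]; simp
      rw [this]; simp

/-- The matrix `[[0, -1], [1, 0]]`. -/
def matA : Matrix.SpecialLinearGroup (Fin 2) ℤ := ⟨!![0, -1; 1, 0], by simp [Matrix.det_fin_two]⟩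

/-- The matrix `[[0, -1], [1, 1]]`. -/
def matB : Matrix.SpecialLinearGroup (Fin 2) ℤ := ⟨!![0, -1; 1, 1], by simp [Matrix.det_fin_two]⟩

/-- The matrix `[[1, 1], [0, 1]]`. -/
def matU : Matrix.SpecialLinearGroup (Fin 2) ℤ := ⟨!![1, 1; 0, 1], by simp [Matrix.det_fin_two]⟩

/-- The matrix `[[1, 0], [1, 1]]`. -/
def matL : Matrix.SpecialLinearGroup (Fin 2) ℤ := ⟨!![1, 0; 1, 1], by simp [Matrix.det_fin_two]⟩

@[simp] theorem coe_matA : (matA : Matrix (Fin 2) (Fin 2) ℤ) = !![0, -1; 1, 0] := rfl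

@[simp] theorem coe_matB : (matB : Matrix (Fin 2) (Fin 2) ℤ) = !![0, -1; 1, 1] := rfl

@[simp] theorem coe_matU : (matU : Matrix (Fin 2) (Fin 2) ℤ) = !![1, 1; 0, 1] := rfl

@[simp] theorem coe_matL : (matL : Matrix (Fin 2) (Fin 2) ℤ) = !![1, 0; 1, 1] := rfl

theorem genA_eq : genA = QuotientGroup.mk matA := rfl

theorem genB_eq : genB = QuotientGroup.mk matB := rfl

theorem genA_mul_genA : genA * genA = 1 := by
  rw [genA_eq, ← QuotientGroup.mk_mul, ← QuotientGroup.mk_one, mk_eq_mk_iff]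
  right
  ext i j
  fin_cases i <;> fin_cases j <;> simp [Matrix.mul_apply, Fin.sum_univ_two]

theorem genB_mul_genB : genB * genB = genB⁻¹ := by
  rw [genB_eq, ← QuotientGroup.mk_mul, ← QuotientGroup.mk_inv, mk_eq_mk_iff]
  right
  ext i j
  fin_cases i <;> fin_cases j <;>
    simp [Matrix.mul_apply, Fin.sum_univ_two, Matrix.adjugate_fin_two]

theorem Letter.eval_inv (ℓ : Letter) : ℓ.inv.eval = ℓ.eval⁻¹ := by
  cases ℓ
  · exact eq_inv_of_mul_eq_one_left genA_mul_genA
  · rfl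
  · exact (inv_inv _).symm

theorem evalWord_invWord (w : List Letter) : evalWord (invWord w) = (evalWord w)⁻¹ := by
  induction w with
  | nil => simp [invWord]
  | cons ℓ w ih =>
    rw [invWord_cons, evalWord_append, ih, evalWord_singleton, Letter.eval_inv, evalWord_cons,
      mul_inv_rev]

theorem genA_mul_genB : genA * genB = QuotientGroup.mk matU := by
  rw [genA_eq, genB_eq, ← QuotientGroup.mk_mul, mk_eq_mk_iff]
  right
  ext i j
  fin_cases i <;> fin_cases j <;> simp [Matrix.mul_apply, Fin.sum_univ_two]

theorem genA_mul_genB_inv : genA * genB⁻¹ = QuotientGroup.mk matL := by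
  rw [genA_eq, genB_eq, ← QuotientGroup.mk_inv, ← QuotientGroup.mk_mul, mk_eq_mk_iff]
  left
  ext i j
  fin_cases i <;> fin_cases j <;>
    simp [Matrix.mul_apply, Fin.sum_univ_two, Matrix.adjugate_fin_two]

/-- An alternating word that starts with `a` and ends with `b` or `b⁻¹` denotes the class of a matrix
with non-negative entries. -/
theorem exists_nonneg_matrix : ∀ w : List Letter, Alt true w true →
    ∃ M : Matrix.SpecialLinearGroup (Fin 2) ℤ, evalWord w = QuotientGroup.mk M ∧
      (∀ i j, 0 ≤ M i j) ∧ (w ≠ [] → 3 ≤ M 0 0 + M 0 1 + M 1 0 + M 1 1)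
  | [], _ => ⟨1, by simp, fun i j => by fin_cases i <;> fin_cases j <;> simp, by simp⟩
  | [ℓ], h => by simp [Alt] at h
  | ℓ :: m :: w, h => by
    obtain ⟨M, hM, h0, -⟩ := exists_nonneg_matrix w h.2.2
    have hℓ : ℓ = .a := Letter.isA_iff.2 h.1
    have hdet := M.2
    rw [Matrix.det_fin_two] at hdet
    have h1 := h0 0 0
    have h2 := h0 0 1
    have h3 := h0 1 0
    have h4 := h0 1 1
    -- A non-negative row cannot vanish when the determinant is `1`. Hence the entries of `M` sum to
    -- at least `2`, and adding one row to the other raises the sum by at least `1`.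
    have r0 : 1 ≤ M 0 0 + M 0 1 := by
      by_contra hc
      have e1 : M 0 0 = 0 := by linarith
      have e2 : M 0 1 = 0 := by linarith
      simp [e1, e2] at hdet
    have r1 : 1 ≤ M 1 0 + M 1 1 := by
      by_contra hc
      have e1 : M 1 0 = 0 := by linarith
      have e2 : M 1 1 = 0 := by linarith
      simp [e1, e2] at hdet
    have hm : m = .b ∨ m = .bInv := by
      have := h.2.1
      cases m <;> simp [Letter.isA] at this ⊢
    rcases hm with rfl | rfl
    · refine ⟨matU * M, ?_, ?_, fun _ => ?_⟩
      · rw [evalWord_cons, evalWord_cons, hM, ← mul_assoc, hℓ, QuotientGroup.mk_mul,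
          ← genA_mul_genB]; rfl
      · intro i j
        fin_cases i <;> fin_cases j <;> simp [Matrix.mul_apply, Fin.sum_univ_two] <;> linarith
      · simp [Matrix.mul_apply, Fin.sum_univ_two]; linarith
    · refine ⟨matL * M, ?_, ?_, fun _ => ?_⟩
      · rw [evalWord_cons, evalWord_cons, hM, ← mul_assoc, hℓ, QuotientGroup.mk_mul,
          ← genA_mul_genB_inv]; rfl
      · intro i j
        fin_cases i <;> fin_cases j <;> simp [Matrix.mul_apply, Fin.sum_univ_two] <;> linarith
      · simp [Matrix.mul_apply, Fin.sum_univ_two]; linarith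

/-- The matrices of `a`, `b` and `b⁻¹` have off-diagonal entries of opposite signs, a property that
survives a change of sign of the matrix. -/
theorem mk_ne_eval {M : Matrix.SpecialLinearGroup (Fin 2) ℤ} (h0 : ∀ i j, 0 ≤ M i j) (ℓ : Letter) :
    (QuotientGroup.mk M : PSL2Z) ≠ ℓ.eval := by
  have key : ∀ N : Matrix.SpecialLinearGroup (Fin 2) ℤ, N 0 1 * N 1 0 < 0 →
      (QuotientGroup.mk M : PSL2Z) ≠ QuotientGroup.mk N := by
    intro N hN h
    rw [mk_eq_mk_iff] at h
    have := mul_nonneg (h0 0 1) (h0 1 0)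
    rcases h with rfl | rfl
    · exact absurd hN (not_lt.2 this)
    · simp at this
      linarith
  cases ℓ
  · exact key _ (by simp)
  · exact key _ (by simp)
  · rw [Letter.eval, genB_eq, ← QuotientGroup.mk_inv]
    exact key _ (by simp [Matrix.adjugate_fin_two])

theorem evalWord_ne_one_aux {w : List Letter} (h : Alt true w true) (hw : w ≠ []) :
    evalWord w ≠ 1 := by
  obtain ⟨M, hM, -, h3⟩ := exists_nonneg_matrix w h
  rw [hM, ← QuotientGroup.mk_one, Ne, mk_eq_mk_iff]
  rintro (rfl | rfl)
  · simpa using h3 hw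
  · simpa using h3 hw

/-- Up to inversion, or after removing an extra first or last letter, `w` is a product of factors
`ab` and `ab⁻¹`, hence non-negative. The entry sum excludes the identity, and `mk_ne_eval` excludes
the inverse of the removed letter. -/
theorem evalWord_ne_one {τ τ' : Bool} {w : List Letter} (h : Alt τ w τ') (hw : w ≠ []) :
    evalWord w ≠ 1 := by
  intro h1
  cases τ <;> cases τ'
  · have h' := h.invWord
    refine evalWord_ne_one_aux h' ?_ (by rw [evalWord_invWord, h1, inv_one])
    simpa [invWord] using hw
  · cases w with
    | nil => exact hw rfl
    | cons ℓ w =>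
      obtain ⟨M, hM, h0, -⟩ := exists_nonneg_matrix w h.2
      rw [evalWord_cons, hM] at h1
      refine mk_ne_eval h0 ℓ.inv ?_
      rw [Letter.eval_inv]
      exact (inv_eq_of_mul_eq_one_right h1).symm
  · obtain ⟨u, ℓ, rfl⟩ : ∃ u ℓ, w = u ++ [ℓ] := ⟨_, _, (List.dropLast_concat_getLast hw).symm⟩
    obtain ⟨τ', hu, hℓ⟩ := alt_append.1 h
    have : τ' = true := by
      have := hℓ.2
      revert this; cases τ' <;> simp [Alt]
    subst this
    obtain ⟨M, hM, h0, -⟩ := exists_nonneg_matrix u hu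
    rw [evalWord_append, hM, evalWord_singleton] at h1
    refine mk_ne_eval h0 ℓ.inv ?_
    rw [Letter.eval_inv]
    exact eq_inv_of_mul_eq_one_left h1
  · exact evalWord_ne_one_aux h hw h1

/-- Every element has at most one normal representative. -/
theorem IsNormal.eq_of_evalWord_eq {w w' : List Letter} (h : IsNormal w) (h' : IsNormal w')
    (he : evalWord w = evalWord w') : w = w' := by
  induction w generalizing w' with
  | nil =>
    by_contra hne
    obtain ⟨_, _, h'⟩ := isNormal_iff.1 h'
    exact evalWord_ne_one h' (Ne.symm hne) he.symm
  | cons ℓ w ih =>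
    cases w' with
    | nil =>
      obtain ⟨_, _, h⟩ := isNormal_iff.1 h
      exact absurd he (evalWord_ne_one h (by simp))
    | cons m w' =>
      rw [evalWord_cons, evalWord_cons] at he
      by_cases hℓ : ℓ = m
      · subst hℓ
        rw [ih h.tail h'.tail (mul_left_cancel he)]
      · exfalso
        obtain ⟨τ, ht⟩ := h.alt_tail
        obtain ⟨τ', ht'⟩ := h'.alt_tail
        have hi := ht.invWord
        rw [Bool.not_not] at hi
        -- If the first letters are `b` and `b⁻¹`, then `ℓ⁻¹m = ℓ`, so `w⁻¹ℓw'` is alternating and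
        -- denotes `1`; otherwise `w⁻¹ℓ⁻¹mw'` is already alternating. Both are non-empty, which is
        -- impossible.
        by_cases ht2 : ℓ.isA = m.isA
        · refine evalWord_ne_one (τ' := τ') (w := invWord w ++ ℓ :: w') (alt_append.2 ⟨_, hi, rfl, ?_⟩)
            (by simp) ?_
          · rw [ht2]; exact ht'
          · rw [evalWord_append, evalWord_cons, evalWord_invWord]
            have : ℓ.eval = ℓ.eval⁻¹ * m.eval := by
              cases ℓ <;> cases m <;> simp_all [Letter.isA, Letter.eval]
              · rw [← mul_inv_rev, genB_mul_genB, inv_inv]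
              · exact genB_mul_genB.symm
            rw [this, mul_assoc, ← he]; group
        · refine evalWord_ne_one (τ' := τ') (w := invWord w ++ ℓ.inv :: m :: w')
            (alt_append.2 ⟨_, hi, ℓ.isA_inv, ?_, ?_⟩) (by simp) ?_
          · revert ht2; cases m.isA <;> cases ℓ.isA <;> simp
          · have : (! !ℓ.isA) = !m.isA := by
              revert ht2; cases m.isA <;> cases ℓ.isA <;> simp
            rw [this]; exact ht'
          · rw [evalWord_append, evalWord_cons, evalWord_cons, evalWord_invWord, ← he,
              Letter.eval_inv]; group

end ModularSubgroup

namespace ModularSubgroup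

/-! ### Reading words in graphs -/

/-- The edge relation of a letter graph in which `a`-edges are undirected, every letter labels at most
one edge leaving a vertex, and two consecutive `b`-edges belong to a `b`-triangle or a `b`-loop. -/
structure IsReduced {V : Type*} (st : V → Letter → V → Prop) : Prop where
  symm : ∀ {x y}, st x .a y → st y .a x
  inv : ∀ {x y}, st x .bInv y ↔ st y .b x
  det : ∀ {x ℓ y z}, st x ℓ y → st x ℓ z → y = z
  tri : ∀ {x y z}, st x .b y → st y .b z → st z .b x

/-- `Read st x w y`: the word `w` labels a path from `x` to `y`. -/
def Read {V : Type*} (st : V → Letter → V → Prop) : V → List Letter → V → Prop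
  | x, [], y => x = y
  | x, ℓ :: w, y => ∃ z, st x ℓ z ∧ Read st z w y

theorem read_append {V : Type*} {st : V → Letter → V → Prop} {x y : V} {u v : List Letter} :
    Read st x (u ++ v) y ↔ ∃ z, Read st x u z ∧ Read st z v y := by
  induction u generalizing x with
  | nil => simp [Read]
  | cons ℓ u ih =>
    simp only [List.cons_append, Read, ih]
    constructor
    · rintro ⟨z, h1, t, h2, h3⟩; exact ⟨t, ⟨z, h1, h2⟩, h3⟩
    · rintro ⟨t, ⟨z, h1, h2⟩, h3⟩; exact ⟨z, h1, t, h2, h3⟩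

theorem read_singleton {V : Type*} {st : V → Letter → V → Prop} {x y : V} {ℓ : Letter} :
    Read st x [ℓ] y ↔ st x ℓ y := by simp [Read]

theorem Read.mono {V : Type*} {st st' : V → Letter → V → Prop} (h : ∀ x ℓ y, st x ℓ y → st' x ℓ y)
    {x y : V} {w : List Letter} (hr : Read st x w y) : Read st' x w y := by
  induction w generalizing x with
  | nil => exact hr
  | cons ℓ w ih =>
    obtain ⟨z, h1, h2⟩ := hr
    exact ⟨z, h _ _ _ h1, ih h2⟩

namespace IsReduced

variable {V : Type*} {st : V → Letter → V → Prop} (hst : IsReduced st)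
include hst

theorem step_inv {x y : V} {ℓ : Letter} (h : st x ℓ y) : st y ℓ.inv x := by
  cases ℓ
  · exact hst.symm h
  · exact hst.inv.2 h
  · exact hst.inv.1 h

theorem read_invWord {x y : V} {w : List Letter} (h : Read st x w y) :
    Read st y (invWord w) x := by
  induction w generalizing x with
  | nil => exact Eq.symm h
  | cons ℓ w ih =>
    obtain ⟨z, h1, h2⟩ := h
    rw [invWord_cons, read_append]
    exact ⟨z, ih h2, read_singleton.2 (hst.step_inv h1)⟩

theorem read_det {x y z : V} {w : List Letter} (h : Read st x w y) (h' : Read st x w z) :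
    y = z := by
  induction w generalizing x with
  | nil => exact Eq.trans (Eq.symm h) h'
  | cons ℓ w ih =>
    obtain ⟨t, h1, h2⟩ := h
    obtain ⟨t', h1', h2'⟩ := h'
    obtain rfl := hst.det h1 h1'
    exact ih h2 h2'

theorem step_square {x y z : V} {ℓ : Letter} (hℓ : ℓ ≠ .a) (h : st x ℓ y) (h' : st y ℓ z) :
    st x ℓ.inv z := by
  cases ℓ
  · exact absurd rfl hℓ
  · exact hst.inv.2 (hst.tri h h')
  · exact hst.tri (hst.inv.1 h') (hst.inv.1 h)

omit hst in
theorem isNormal_cons_of_isA_eq {ℓ m : Letter} {w : List Letter} (h : IsNormal (m :: w))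
    (hℓ : ℓ.isA = m.isA) : IsNormal (ℓ :: w) := by
  obtain ⟨τ, τ', h⟩ := isNormal_iff.1 h
  exact Alt.isNormal (τ := τ) ⟨hℓ.trans h.1, h.2⟩

/-- Free reduction does not change the endpoints of a path. -/
theorem exists_normal {x y : V} {w : List Letter} (h : Read st x w y) :
    ∃ w', IsNormal w' ∧ evalWord w' = evalWord w ∧ Read st x w' y := by
  induction w generalizing x with
  | nil => exact ⟨[], List.isChain_nil, rfl, h⟩
  | cons ℓ w ih =>
    obtain ⟨z, h1, h2⟩ := h
    obtain ⟨t, ht, het, hrt⟩ := ih h2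
    cases t with
    | nil =>
      refine ⟨[ℓ], List.isChain_singleton _, ?_, z, h1, hrt⟩
      rw [evalWord_cons, evalWord_cons, ← het]
    | cons m t =>
      obtain ⟨z', h3, h4⟩ := hrt
      -- Two adjacent letters of the same kind either cancel or are equal and different from `a`. In
      -- the second case `ℓℓ = ℓ⁻¹`, and the third edge of the triangle replaces the two edges read.
      by_cases hA : ℓ.isA = m.isA
      · by_cases hm : m = ℓ.inv
        · refine ⟨t, ht.tail, ?_, ?_⟩
          · rw [evalWord_cons, ← het, evalWord_cons, hm, Letter.eval_inv, mul_inv_cancel_left]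
          · have := hst.step_inv h1
            rw [← hm] at this
            rwa [hst.det this h3]
        · have hl : m = ℓ ∧ ℓ ≠ .a := by
            revert hA hm
            cases ℓ <;> cases m <;> simp [Letter.isA, Letter.inv]
          obtain ⟨rfl, hl⟩ := hl
          refine ⟨m.inv :: t, isNormal_cons_of_isA_eq ht m.isA_inv, ?_, z',
            hst.step_square hl h1 h3, h4⟩
          rw [evalWord_cons, evalWord_cons, ← het, evalWord_cons, ← mul_assoc]
          congr 1
          cases m
          · exact absurd rfl hl
          · exact genB_mul_genB.symm
          · change genB = genB⁻¹ * genB⁻¹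
            rw [← mul_inv_rev, genB_mul_genB, inv_inv]
      · obtain ⟨τ, τ', ht'⟩ := isNormal_iff.1 ht
        refine ⟨ℓ :: m :: t, Alt.isNormal (τ := ℓ.isA) (τ' := τ') ⟨rfl, ?_, ?_⟩, ?_,
          z, h1, z', h3, h4⟩
        · revert hA; cases ℓ.isA <;> cases m.isA <;> simp
        · have : (!ℓ.isA) = τ := by
            rw [← ht'.1]; revert hA; cases ℓ.isA <;> cases m.isA <;> simp
          rw [this]; exact ht'.2
        · rw [evalWord_cons, het, evalWord_cons]

/-- Deterministic reading only depends on the element denoted by the word. -/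
theorem eq_of_read {x y z : V} {w w' : List Letter} (h : Read st x w y) (h' : Read st x w' z)
    (he : evalWord w = evalWord w') : y = z := by
  obtain ⟨u, hu, heu, hr⟩ := hst.exists_normal h
  obtain ⟨u', hu', heu', hr'⟩ := hst.exists_normal h'
  obtain rfl := hu.eq_of_evalWord_eq hu' (by rw [heu, he, heu'])
  exact hst.read_det hr hr'

end IsReduced

/-! ### Generation of the modular group by `a` and `b` -/

theorem exists_word (g : PSL2Z) : ∃ w, evalWord w = g := by
  obtain ⟨M, rfl⟩ := QuotientGroup.mk_surjective g
  have hM : M ∈ Subgroup.closure {ModularGroup.S, ModularGroup.T} := by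
    rw [SpecialLinearGroup.SL2Z_generators]; trivial
  induction hM using Subgroup.closure_induction with
  | mem M hM =>
    rcases hM with rfl | rfl
    · exact ⟨[.a], evalWord_singleton _⟩
    · refine ⟨[.a, .b], ?_⟩
      rw [evalWord_cons, evalWord_singleton]
      exact genA_mul_genB
  | one => exact ⟨[], rfl⟩
  | mul M N _ _ hM hN =>
    obtain ⟨u, hu⟩ := hM
    obtain ⟨v, hv⟩ := hN
    exact ⟨u ++ v, by rw [evalWord_append, hu, hv, QuotientGroup.mk_mul]⟩
  | inv M _ hM =>
    obtain ⟨u, hu⟩ := hM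
    exact ⟨invWord u, by rw [evalWord_invWord, hu, QuotientGroup.mk_inv]⟩

/-! ### The action on right cosets -/

/-- The right action of the group on right cosets. -/
def act {H : Subgroup PSL2Z} (q : RightCosets H) (g : PSL2Z) : RightCosets H :=
  Quotient.map (· * g) (fun x y h => by
    change QuotientGroup.rightRel H _ _
    have h' : QuotientGroup.rightRel H x y := h
    rw [QuotientGroup.rightRel_apply] at h' ⊢
    simpa [mul_assoc] using h') q

theorem act_coset (H : Subgroup PSL2Z) (x g : PSL2Z) : act (coset H x) g = coset H (x * g) := rfl

theorem exists_coset {H : Subgroup PSL2Z} (q : RightCosets H) : ∃ g, q = coset H g :=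
  ⟨q.out, (Quotient.out_eq q).symm⟩

@[simp] theorem act_one {H : Subgroup PSL2Z} (q : RightCosets H) : act q 1 = q := by
  obtain ⟨x, rfl⟩ := exists_coset q
  rw [act_coset, mul_one]

theorem act_mul {H : Subgroup PSL2Z} (q : RightCosets H) (g h : PSL2Z) :
    act q (g * h) = act (act q g) h := by
  obtain ⟨x, rfl⟩ := exists_coset q
  simp only [act_coset, mul_assoc]

theorem coset_eq_iff {H : Subgroup PSL2Z} {x y : PSL2Z} :
    coset H x = coset H y ↔ y * x⁻¹ ∈ H := by
  rw [coset, coset, Quotient.eq]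
  exact QuotientGroup.rightRel_apply

theorem coset_eq_coset_one_iff {H : Subgroup PSL2Z} {x : PSL2Z} :
    coset H x = coset H 1 ↔ x ∈ H := by
  rw [coset_eq_iff, one_mul, inv_mem_iff]

theorem act_eq_iff {H : Subgroup PSL2Z} {q q' : RightCosets H} {g : PSL2Z} :
    q' = act q g ↔ q = act q' g⁻¹ := by
  constructor
  · rintro rfl; rw [← act_mul, mul_inv_cancel, act_one]
  · rintro rfl; rw [← act_mul, inv_mul_cancel, act_one]

/-- The edges of the Schreier graph between the vertices parametrized by `κ`. -/
def inducedStep {V : Type*} {H : Subgroup PSL2Z} (κ : V → RightCosets H) (x : V) (ℓ : Letter)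
    (y : V) : Prop := κ y = act (κ x) ℓ.eval

theorem isReduced_inducedStep {V : Type*} {H : Subgroup PSL2Z} {κ : V → RightCosets H}
    (hκ : Function.Injective κ) : IsReduced (inducedStep κ) where
  symm {x y} h := by
    have := act_eq_iff.1 h
    rwa [← Letter.eval_inv] at this
  inv {x y} := by
    rw [inducedStep, act_eq_iff, ← Letter.eval_inv]; rfl
  det h h' := hκ (Eq.trans h (Eq.symm h'))
  tri {x y z} h h' := by
    rw [inducedStep, act_eq_iff, h', h, ← act_mul]
    congr 1
    exact genB_mul_genB

theorem act_of_read {V : Type*} {H : Subgroup PSL2Z} {κ : V → RightCosets H} {x y : V}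
    {w : List Letter} (h : Read (inducedStep κ) x w y) : κ y = act (κ x) (evalWord w) := by
  induction w generalizing x with
  | nil => cases h; simp
  | cons ℓ w ih =>
    obtain ⟨z, h1, h2⟩ := h
    rw [ih h2, h1, evalWord_cons, act_mul]

theorem read_of_forall_prefix {V : Type*} {H : Subgroup PSL2Z} {κ : V → RightCosets H}
    {w : List Letter} {x : V} (h : ∀ u, u <+: w → act (κ x) (evalWord u) ∈ Set.range κ) :
    ∃ y, Read (inducedStep κ) x w y := by
  induction w generalizing x with
  | nil => exact ⟨x, rfl⟩
  | cons ℓ w ih =>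
    obtain ⟨z, hz⟩ := h [ℓ] (by simp)
    rw [evalWord_singleton] at hz
    obtain ⟨y, hy⟩ := ih (x := z) fun u hu => by
      rw [hz, ← act_mul, ← evalWord_cons]
      exact h _ (List.cons_prefix_cons.2 ⟨rfl, hu⟩)
    exact ⟨y, z, hz, hy⟩

theorem exists_isNormal (g : PSL2Z) : ∃ w, IsNormal w ∧ evalWord w = g := by
  obtain ⟨w, rfl⟩ := exists_word g
  -- In the coset graph of the whole group every word can be read, so reduction of paths there is
  -- reduction of words.
  have h := isReduced_inducedStep (V := RightCosets (⊤ : Subgroup PSL2Z)) (κ := id)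
    Function.injective_id
  obtain ⟨y, hy⟩ := read_of_forall_prefix (κ := (id : RightCosets (⊤ : Subgroup PSL2Z) → _))
    (w := w) (x := coset ⊤ 1) (fun u _ => ⟨_, rfl⟩)
  obtain ⟨w', h1, h2, -⟩ := h.exists_normal hy
  exact ⟨w', h1, h2⟩

/-! ### Labelled graphs -/

/-- `f` is an involution, without marks, around `x`. -/
def IsInvolutive {V : Type*} (f : V → V × Bool) (x : V) : Prop :=
  (f x).2 = false ∧ (f (f x).1).1 = x

/-- Around `x`, `f` is a permutation whose cycles are unmarked of length `1` or `3`, or of length `2`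
with exactly one marked element. -/
def IsTernary {V : Type*} (f : V → V × Bool) (x : V) : Prop :=
  ((f x).2 = false ∧ (f (f (f x).1).1).1 = x) ∨
    ((f (f x).1).1 = x ∧ (f x).1 ≠ x ∧ (f x).2 = !(f (f x).1).2)

/-- An encoding of a graph with edges labelled by `a` and `b`. A marked point of `mapB` is the start of
a `b`-edge that belongs to no `b`-triangle. The flags tell that the loops at the root, labelled `a` and `b`
respectively, are to be ignored. -/
structure LabelledGraph (V : Type*) where
  mapA : V → V × Bool
  mapB : V → V × Bool
  flagA : Bool
  flagB : Bool

namespace LabelledGraph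

variable {V : Type*}

/-- The edges of a labelled graph with root `r`. -/
def step (P : LabelledGraph V) (r : V) : V → Letter → V → Prop
  | x, .a, y => (P.mapA x).1 = y ∧ ¬ (P.flagA = true ∧ x = r)
  | x, .b, y => (P.mapB x).1 = y ∧ (P.mapB y).2 = false ∧ ¬ (P.flagB = true ∧ x = r)
  | x, .bInv, y => (P.mapB y).1 = x ∧ (P.mapB x).2 = false ∧ ¬ (P.flagB = true ∧ y = r)

/-- The composition of `mapA` and `mapB`, which reads `ab` where possible. -/
def mapAB (P : LabelledGraph V) (x : V) : V := (P.mapB (P.mapA x).1).1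

/-- If the intermediate vertex were the root and its `b`-loop were ignored, `hb` would make the
target the root as well. Avoiding the root at both ends thus suffices. -/
theorem step_mapAB {P : LabelledGraph V} {r x : V} (hb : P.flagB = true → (P.mapB r).1 = r)
    (hx : x ≠ r) (h : P.mapAB x ≠ r) (hm : (P.mapB (P.mapAB x)).2 = false) :
    Read (P.step r) x [.a, .b] (P.mapAB x) := by
  refine ⟨(P.mapA x).1, ⟨rfl, fun h => hx h.2⟩, P.mapAB x, ⟨rfl, hm, ?_⟩, rfl⟩
  rintro ⟨h1, h2⟩
  exact h (by rw [mapAB, h2, hb h1])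

/-- `P` encodes the graph induced by the Schreier graph of `H` on the range of `κ`. -/
def Represents (P : LabelledGraph V) (r : V) {H : Subgroup PSL2Z} (κ : V → RightCosets H) : Prop :=
  ∀ x ℓ y, P.step r x ℓ y ↔ inducedStep κ x ℓ y

open Classical in
/-- The encoding of an induced subgraph of a Schreier graph. -/
noncomputable def ofInduced (r : V) {H : Subgroup PSL2Z} (κ : V → RightCosets H) :
    LabelledGraph V where
  mapA x := if h : ∃ y, κ y = act (κ x) genA then (h.choose, false) else (x, false)
  mapB x := if h : ∃ y, κ y = act (κ x) genB then
      (h.choose, decide ¬ ∃ y, κ y = act (κ x) genB⁻¹)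
    else if h : ∃ y, κ y = act (κ x) genB⁻¹ then (h.choose, false) else (x, false)
  -- A missing edge and a loop are both encoded by a fixed point. The flags separate the two cases
  -- at the root, the only vertex of a Stallings graph where edges of one kind may be absent.
  flagA := decide ¬ ∃ y, κ y = act (κ r) genA
  flagB := decide (¬ (∃ y, κ y = act (κ r) genB) ∧ ¬ ∃ y, κ y = act (κ r) genB⁻¹)

variable {H : Subgroup PSL2Z} {κ : V → RightCosets H} {r : V}

theorem mapA_ofInduced (hκ : Function.Injective κ) {x y : V} (h : κ y = act (κ x) genA) :
    (ofInduced r κ).mapA x = (y, false) := by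
  have h' : ∃ y, κ y = act (κ x) genA := ⟨y, h⟩
  simp only [ofInduced, dif_pos h']
  rw [hκ (h'.choose_spec.trans h.symm)]

theorem mapA_ofInduced_of_not {x : V} (h : ¬ ∃ y, κ y = act (κ x) genA) :
    (ofInduced r κ).mapA x = (x, false) := by
  simp only [ofInduced, dif_neg h]

theorem mapB_ofInduced (hκ : Function.Injective κ) {x y z : V} (h : κ y = act (κ x) genB)
    (hz : κ z = act (κ x) genB⁻¹) : (ofInduced r κ).mapB x = (y, false) := by
  have h' : ∃ y, κ y = act (κ x) genB := ⟨y, h⟩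
  have h'' : ∃ y, κ y = act (κ x) genB⁻¹ := ⟨z, hz⟩
  simp only [ofInduced, dif_pos h']
  rw [hκ (h'.choose_spec.trans h.symm)]
  simp [h'']

theorem mapB_ofInduced_start (hκ : Function.Injective κ) {x y : V} (h : κ y = act (κ x) genB)
    (hz : ¬ ∃ z, κ z = act (κ x) genB⁻¹) : (ofInduced r κ).mapB x = (y, true) := by
  have h' : ∃ y, κ y = act (κ x) genB := ⟨y, h⟩
  simp only [ofInduced, dif_pos h']
  rw [hκ (h'.choose_spec.trans h.symm)]
  simp [hz]

theorem mapB_ofInduced_end (hκ : Function.Injective κ) {x z : V}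
    (h : ¬ ∃ y, κ y = act (κ x) genB) (hz : κ z = act (κ x) genB⁻¹) :
    (ofInduced r κ).mapB x = (z, false) := by
  have h' : ∃ y, κ y = act (κ x) genB⁻¹ := ⟨z, hz⟩
  simp only [ofInduced, dif_neg h, dif_pos h']
  rw [hκ (h'.choose_spec.trans hz.symm)]

theorem mapB_ofInduced_of_not {x : V} (h : ¬ ∃ y, κ y = act (κ x) genB)
    (hz : ¬ ∃ z, κ z = act (κ x) genB⁻¹) : (ofInduced r κ).mapB x = (x, false) := by
  simp only [ofInduced, dif_neg h, dif_neg hz]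

theorem isInvolutive_ofInduced (hκ : Function.Injective κ) (x : V) :
    IsInvolutive (ofInduced r κ).mapA x := by
  by_cases h : ∃ y, κ y = act (κ x) genA
  · obtain ⟨y, hy⟩ := h
    have hx := (isReduced_inducedStep hκ).symm hy
    rw [IsInvolutive, mapA_ofInduced hκ hy]
    exact ⟨rfl, by rw [mapA_ofInduced hκ hx]⟩
  · have e := mapA_ofInduced_of_not (r := r) h
    simp [IsInvolutive, e]

theorem act_genB_inv {q : RightCosets H} : act q genB⁻¹ = act (act q genB) genB := by
  rw [← act_mul, genB_mul_genB]

theorem act_genB_of_inv {q : RightCosets H} : act q genB = act (act q genB⁻¹) genB⁻¹ := by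
  rw [← act_mul, ← mul_inv_rev, genB_mul_genB, inv_inv]

theorem isTernary_ofInduced (hκ : Function.Injective κ) (x : V) :
    IsTernary (ofInduced r κ).mapB x := by
  by_cases h : ∃ y, κ y = act (κ x) genB
  · obtain ⟨y, hy⟩ := h
    have hyx : κ x = act (κ y) genB⁻¹ := act_eq_iff.1 hy
    by_cases h' : ∃ z, κ z = act (κ x) genB⁻¹
    · obtain ⟨z, hz⟩ := h'
      have hyz : κ z = act (κ y) genB := by rw [hz, act_genB_inv, hy]
      have hzx : κ x = act (κ z) genB := by
        rw [hz, ← act_mul, inv_mul_cancel, act_one]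
      have hzy : κ y = act (κ z) genB⁻¹ := act_eq_iff.1 hyz
      left
      rw [mapB_ofInduced hκ hy hz, mapB_ofInduced hκ hyz hyx, mapB_ofInduced hκ hzx hzy]
      exact ⟨rfl, rfl⟩
    · have hn : ¬ ∃ z, κ z = act (κ y) genB := by
        rwa [hy, ← act_genB_inv]
      right
      rw [mapB_ofInduced_start hκ hy h', mapB_ofInduced_end hκ hn hyx]
      refine ⟨rfl, ?_, rfl⟩
      rintro rfl
      exact hn ⟨_, hy⟩
  · by_cases h' : ∃ z, κ z = act (κ x) genB⁻¹
    · obtain ⟨z, hz⟩ := h'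
      have hzx : κ x = act (κ z) genB := by
        rw [hz, ← act_mul, inv_mul_cancel, act_one]
      have hn : ¬ ∃ y, κ y = act (κ z) genB⁻¹ := by
        rwa [hz, ← act_genB_of_inv]
      right
      rw [mapB_ofInduced_end hκ h hz, mapB_ofInduced_start hκ hzx hn]
      refine ⟨rfl, ?_, rfl⟩
      rintro rfl
      exact hn ⟨_, hz⟩
    · left
      have e := mapB_ofInduced_of_not (r := r) h h'
      simp [e]

/-- By `hA` and `hB`, only the root can lack an `a`-edge or both `b`-edges, so every spurious loop
created by the encoding sits at the root, where the flags remove it. -/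
theorem represents_ofInduced (hκ : Function.Injective κ)
    (hA : ∀ x, x ≠ r → ∃ y, κ y = act (κ x) genA)
    (hB : ∀ x, x ≠ r → (∃ y, κ y = act (κ x) genB) ∨ ∃ y, κ y = act (κ x) genB⁻¹) :
    (ofInduced r κ).Represents r κ := by
  have hb : ∀ x y, (ofInduced r κ).step r x .b y ↔ inducedStep κ x .b y := by
    intro x y
    constructor
    · rintro ⟨h1, h2, h3⟩
      change κ y = act (κ x) genB
      by_cases h : ∃ y, κ y = act (κ x) genB
      · obtain ⟨z, hz⟩ := h
        by_cases h' : ∃ z, κ z = act (κ x) genB⁻¹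
        · obtain ⟨t, ht⟩ := h'
          rw [mapB_ofInduced hκ hz ht] at h1
          rw [← h1, hz]
        · rw [mapB_ofInduced_start hκ hz h'] at h1
          rw [← h1, hz]
      · exfalso
        by_cases h' : ∃ z, κ z = act (κ x) genB⁻¹
        · obtain ⟨z, hz⟩ := h'
          rw [mapB_ofInduced_end hκ h hz] at h1
          subst h1
          have hzx : κ x = act (κ z) genB := by
            rw [hz, ← act_mul, inv_mul_cancel, act_one]
          rw [mapB_ofInduced_start hκ hzx (by rwa [hz, ← act_genB_of_inv])] at h2
          simp at h2
        · have hx : x = r := by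
            by_contra hx
            exact (hB x hx).elim h h'
          subst hx
          refine h3 ⟨?_, rfl⟩
          simp [ofInduced, h, h']
    · intro hy
      have hy : κ y = act (κ x) genB := hy
      have hyx : κ x = act (κ y) genB⁻¹ := act_eq_iff.1 hy
      refine ⟨?_, ?_, ?_⟩
      · by_cases h' : ∃ z, κ z = act (κ x) genB⁻¹
        · obtain ⟨t, ht⟩ := h'
          rw [mapB_ofInduced hκ hy ht]
        · rw [mapB_ofInduced_start hκ hy h']
      · by_cases h' : ∃ z, κ z = act (κ y) genB
        · obtain ⟨t, ht⟩ := h'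
          rw [mapB_ofInduced hκ ht hyx]
        · rw [mapB_ofInduced_end hκ h' hyx]
      · rintro ⟨h1, rfl⟩
        simp only [ofInduced, decide_eq_true_eq] at h1
        exact h1.1 ⟨y, hy⟩
  intro x ℓ y
  cases ℓ
  · constructor
    · rintro ⟨h1, h2⟩
      by_cases h : ∃ y, κ y = act (κ x) genA
      · obtain ⟨z, hz⟩ := h
        rw [mapA_ofInduced hκ hz] at h1
        rw [← h1]; exact hz
      · exfalso
        have hx : x = r := by
          by_contra hx
          exact h (hA x hx)
        subst hx
        refine h2 ⟨?_, rfl⟩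
        simpa [ofInduced] using h
    · intro hy
      have hy : κ y = act (κ x) genA := hy
      refine ⟨by rw [mapA_ofInduced hκ hy], ?_⟩
      rintro ⟨h1, rfl⟩
      simp only [ofInduced, decide_eq_true_eq] at h1
      exact h1 ⟨y, hy⟩
  · exact hb x y
  · rw [(isReduced_inducedStep hκ).inv, ← hb y x]
    rfl

theorem mapB_root_ofInduced (h : (ofInduced r κ).flagB = true) :
    ((ofInduced r κ).mapB r).1 = r := by
  simp only [ofInduced, decide_eq_true_eq] at h
  rw [mapB_ofInduced_of_not h.1 h.2]

end LabelledGraph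

end ModularSubgroup

namespace ModularSubgroup

/-! ### The Stallings graph of a subgroup -/

section Stallings

variable {H : Subgroup PSL2Z}

theorem root_mem_verts : coset H 1 ∈ (stallingsGraph H).verts :=
  ⟨[], List.isChain_nil, H.one_mem, [], List.prefix_rfl, rfl⟩

/-- A vertex other than the root lies in the interior of a normal loop, and the letters before and
after it are of different kinds. -/
theorem neighbours_mem_verts {q : RightCosets H} (hq : q ∈ (stallingsGraph H).verts)
    (hr : q ≠ coset H 1) : act q genA ∈ (stallingsGraph H).verts ∧
      (act q genB ∈ (stallingsGraph H).verts ∨ act q genB⁻¹ ∈ (stallingsGraph H).verts) := by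
  obtain ⟨w, hw, hwH, u, ⟨t, rfl⟩, rfl⟩ := hq
  have hu : u ≠ [] := by rintro rfl; exact hr rfl
  have ht : t ≠ [] := by
    rintro rfl
    rw [List.append_nil] at hwH
    exact hr (coset_eq_coset_one_iff.2 hwH)
  obtain ⟨u, ℓ, rfl⟩ : ∃ u' ℓ, u = u' ++ [ℓ] := ⟨_, _, (List.dropLast_concat_getLast hu).symm⟩
  cases t with
  | nil => exact absurd rfl ht
  | cons m t =>
    have h1 : act (coset H (evalWord (u ++ [ℓ]))) ℓ.inv.eval ∈ (stallingsGraph H).verts := by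
      refine ⟨_, hw, hwH, u, ⟨ℓ :: m :: t, by simp⟩, ?_⟩
      rw [act_coset, evalWord_append, evalWord_singleton, Letter.eval_inv, mul_inv_cancel_right]
    have h2 : act (coset H (evalWord (u ++ [ℓ]))) m.eval ∈ (stallingsGraph H).verts := by
      refine ⟨_, hw, hwH, u ++ [ℓ] ++ [m], ⟨t, by simp⟩, ?_⟩
      rw [act_coset, evalWord_append _ [m], evalWord_singleton]
    have h3 : ℓ.inv.isA = !m.isA := by
      obtain ⟨τ, τ', h⟩ := isNormal_iff.1 hw
      rw [List.append_assoc, alt_append] at h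
      obtain ⟨σ, -, h⟩ := h
      rw [Letter.isA_inv, h.2.1, h.1, Bool.not_not]
    revert h1 h2 h3
    generalize ℓ.inv = ℓ'
    cases ℓ' <;> cases m <;> simp [Letter.isA, Letter.eval] <;> tauto

theorem exists_read_of_isNormal {V : Type*} {κ : V → RightCosets H} {r : V} (hr : κ r = coset H 1)
    (hv : (stallingsGraph H).verts ⊆ Set.range κ) {w u : List Letter} (hw : IsNormal w)
    (hwH : evalWord w ∈ H) (hu : u <+: w) : ∃ y, Read (inducedStep κ) r u y := by
  refine read_of_forall_prefix fun v hvu => hv ⟨w, hw, hwH, v, hvu.trans hu, ?_⟩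
  rw [hr, act_coset, one_mul]

/-- The normal word of an element of `H` is read as a loop inside the Stallings graph. Its edges are
also edges for `H'`, where the word again closes at the root. -/
theorem le_of_represents {V : Type*} {H' : Subgroup PSL2Z} {κ : V → RightCosets H}
    {κ' : V → RightCosets H'} {r : V} (hκ : Function.Injective κ) (hr : κ r = coset H 1)
    (hr' : κ' r = coset H' 1) (hv : (stallingsGraph H).verts ⊆ Set.range κ)
    (h : ∀ x ℓ y, inducedStep κ x ℓ y → inducedStep κ' x ℓ y) : H ≤ H' := by
  intro g hg
  obtain ⟨w, hw, rfl⟩ := exists_isNormal g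
  obtain ⟨y, hy⟩ := exists_read_of_isNormal hr hv hw hg List.prefix_rfl
  have hyr : y = r := hκ (by
    rw [act_of_read hy, hr, act_coset, one_mul, coset_eq_coset_one_iff]; exact hg)
  subst hyr
  have := act_of_read (hy.mono h)
  rw [hr', act_coset, one_mul] at this
  exact coset_eq_coset_one_iff.1 this.symm

/-- Each vertex is the end of a path from the root, and a path is determined by its word. This
rigidity makes different labellings of one graph give different encodings. -/
theorem eq_of_represents {V : Type*} {κ κ' : V → RightCosets H} {r : V}
    (hr : κ r = coset H 1) (hr' : κ' r = coset H 1) (hκ : Function.Injective κ)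
    (hv : Set.range κ = (stallingsGraph H).verts)
    (h : ∀ x ℓ y, inducedStep κ x ℓ y → inducedStep κ' x ℓ y) : κ = κ' := by
  funext x
  obtain ⟨w, hw, hwH, u, hu, hx⟩ : κ x ∈ (stallingsGraph H).verts := hv ▸ Set.mem_range_self x
  obtain ⟨y, hy⟩ := exists_read_of_isNormal hr hv.ge hw hwH hu
  have hyx : y = x := hκ (by rw [act_of_read hy, hx, hr, act_coset, one_mul])
  subst hyx
  rw [act_of_read (hy.mono h), hx, hr', act_coset, one_mul]

theorem represents_of_verts {V : Type*} {κ : V → RightCosets H} {r : V}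
    (hκ : Function.Injective κ) (hr : κ r = coset H 1)
    (hv : Set.range κ = (stallingsGraph H).verts) :
    (LabelledGraph.ofInduced r κ).Represents r κ := by
  have key := fun (x : V) (hx : x ≠ r) => neighbours_mem_verts (hv ▸ Set.mem_range_self x)
    (fun h => hx (hκ (h.trans hr.symm)))
  refine LabelledGraph.represents_ofInduced hκ (fun x hx => ?_) (fun x hx => ?_)
  · have := (key x hx).1
    rwa [← hv] at this
  · have := (key x hx).2
    rwa [← hv] at this

end Stallings

/-! ### Parabolic elements and almost malnormality -/

theorem matU_pow (m : ℕ) : ((matU ^ m : Matrix.SpecialLinearGroup (Fin 2) ℤ) :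
    Matrix (Fin 2) (Fin 2) ℤ) = !![1, (m : ℤ); 0, 1] := by
  induction m with
  | zero => ext i j; fin_cases i <;> fin_cases j <;> simp
  | succ m ih =>
    rw [pow_succ, Matrix.SpecialLinearGroup.coe_mul, ih, coe_matU, Matrix.mul_fin_two]
    simp [add_comm]

theorem genA_mul_genB_pow_injective : Function.Injective fun m : ℕ => (genA * genB) ^ m := by
  intro m m' h
  simp only [genA_mul_genB, ← QuotientGroup.mk_pow] at h
  rw [mk_eq_mk_iff] at h
  rcases h with h | h
  · have := congrArg (fun M : Matrix.SpecialLinearGroup (Fin 2) ℤ =>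
      (M : Matrix (Fin 2) (Fin 2) ℤ) 0 1) h
    simp only [matU_pow] at this
    simpa using this
  · have := congrArg (fun M : Matrix.SpecialLinearGroup (Fin 2) ℤ =>
      (M : Matrix (Fin 2) (Fin 2) ℤ) 0 0) h
    simp only [Matrix.SpecialLinearGroup.coe_neg, Matrix.neg_apply, matU_pow] at this
    simp at this

/-- If `Hg` and `Hg'` were distinct, all powers of `g(ab)^m g⁻¹` would lie in `H` together with
their conjugates by `g'g⁻¹ ∉ H`. There are infinitely many of them, because `ab` has infinite order.
-/
theorem IsAlmostMalnormal.eq_of_act_eq {H : Subgroup PSL2Z} (hH : IsAlmostMalnormal H)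
    {q q' : RightCosets H} {m : ℕ} (hm : 0 < m) (h : act q ((genA * genB) ^ m) = q)
    (h' : act q' ((genA * genB) ^ m) = q') : q = q' := by
  obtain ⟨g, rfl⟩ := exists_coset q
  obtain ⟨g', rfl⟩ := exists_coset q'
  rw [act_coset, eq_comm, coset_eq_iff] at h h'
  by_contra hne
  rw [coset_eq_iff] at hne
  refine Set.infinite_of_injective_forall_mem (s := {h : PSL2Z | h ∈ H ∧
    g' * g⁻¹ * h * (g' * g⁻¹)⁻¹ ∈ H}) (f := fun j : ℕ => g * ((genA * genB) ^ m) ^ j * g⁻¹)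
    ?_ (fun j => ⟨?_, ?_⟩) (hH _ hne)
  · intro i j hij
    have : ((genA * genB) ^ m) ^ i = ((genA * genB) ^ m) ^ j :=
      mul_left_cancel (mul_right_cancel hij)
    rw [← pow_mul, ← pow_mul] at this
    exact Nat.eq_of_mul_eq_mul_left hm (genA_mul_genB_pow_injective this)
  · rw [← conj_pow]
    exact H.pow_mem h j
  · have : g' * g⁻¹ * (g * ((genA * genB) ^ m) ^ j * g⁻¹) * (g' * g⁻¹)⁻¹ =
        (g' * (genA * genB) ^ m * g'⁻¹) ^ j := by
      rw [conj_pow]; group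
    rw [this]
    exact H.pow_mem h' j

/-- Along an orbit that avoids the root and the marked vertices, `mapAB` is multiplication by `ab`. -/
theorem LabelledGraph.Represents.act_pow {V : Type*} {P : LabelledGraph V} {r : V}
    {H : Subgroup PSL2Z} {κ : V → RightCosets H} (h : P.Represents r κ)
    (hb : P.flagB = true → (P.mapB r).1 = r) {x : V}
    (hx : ∀ j, P.mapAB^[j] x ≠ r ∧ (P.mapB (P.mapAB^[j] x)).2 = false) (j : ℕ) :
    κ (P.mapAB^[j] x) = act (κ x) ((genA * genB) ^ j) := by
  induction j with
  | zero => simp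
  | succ j ih =>
    have h1 := hx (j + 1)
    rw [Function.iterate_succ_apply'] at h1 ⊢
    have := act_of_read ((step_mapAB hb (hx j).1 h1.1 h1.2).mono fun x ℓ y => (h x ℓ y).1)
    rw [this, ih, ← act_mul, pow_succ, evalWord_cons, evalWord_singleton]
    rfl

/-! ### The subgroup of a labelled graph -/

theorem IsTernary.injective {V : Type*} {f : V → V × Bool} (h : ∀ x, IsTernary f x) :
    Function.Injective fun x => (f x).1 := by
  intro x y hxy
  have hxy : (f x).1 = (f y).1 := hxy
  rcases h x with ⟨-, hx⟩ | ⟨hx, -⟩ <;> rcases h y with ⟨-, hy⟩ | ⟨hy, -⟩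
  · rw [← hx, hxy, hy]
  · rw [hxy, hy] at hx
    rw [hx] at hxy hy
    exact hxy.symm.trans hy
  · rw [← hxy, hx] at hy
    rw [hy] at hxy hx
    exact hx.symm.trans hxy.symm
  · rw [← hx, hxy, hy]

theorem IsInvolutive.injective {V : Type*} {f : V → V × Bool} (h : ∀ x, IsInvolutive f x) :
    Function.Injective fun x => (f x).1 := by
  intro x y hxy
  have hxy : (f x).1 = (f y).1 := hxy
  rw [← (h x).2, hxy, (h y).2]

/-- Iterating a permutation of a finite set undoes one step of it. -/
theorem reflTransGen_of_injective {α : Type*} [Finite α] {T : α → α → Prop} {f : α → α}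
    (hf : Function.Injective f) (hT : ∀ s, T s (f s)) (s : α) : Relation.ReflTransGen T (f s) s := by
  obtain ⟨m, hm, h⟩ := hf.mem_periodicPts s
  have key : ∀ j t, Relation.ReflTransGen T t (f^[j] t) := by
    intro j t
    induction j with
    | zero => exact .refl
    | succ j ih =>
      rw [Function.iterate_succ_apply']
      exact ih.tail (hT _)
  obtain ⟨m, rfl⟩ := Nat.exists_eq_succ_of_ne_zero hm.ne'
  have := key m (f s)
  rwa [← Function.iterate_succ_apply, h.eq] at this

namespace IsReduced

variable {V : Type*} {st : V → Letter → V → Prop} (hst : IsReduced st)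
include hst

/-- The subgroup of the elements denoted by the loops at `r`. -/
def loops (r : V) : Subgroup PSL2Z where
  carrier := {g | ∃ w, evalWord w = g ∧ Read st r w r}
  mul_mem' := by
    rintro _ _ ⟨u, rfl, hu⟩ ⟨v, rfl, hv⟩
    exact ⟨u ++ v, evalWord_append u v, read_append.2 ⟨r, hu, hv⟩⟩
  one_mem' := ⟨[], rfl, rfl⟩
  inv_mem' := by
    rintro _ ⟨u, rfl, hu⟩
    exact ⟨invWord u, evalWord_invWord u, hst.read_invWord hu⟩

theorem read_det_left {x y z : V} {w : List Letter} (h : Read st x w z) (h' : Read st y w z) :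
    x = y := hst.read_det (hst.read_invWord h) (hst.read_invWord h')

/-- This is why no edge between the given vertices is missing from `st`. The normal form of `mv`
prolongs `v`, drops its first letter or inverts it, and in each case uniqueness of normal forms
places an `m`-edge between the starting points of the two paths. -/
theorem step_of_read {x y r : V} {v v' : List Letter} {m : Letter} (hv : IsNormal v)
    (hv' : IsNormal v') (hx : Read st x v r) (hy : Read st y v' r)
    (he : evalWord v' = m.eval * evalWord v) : st y m x := by
  by_cases hn : IsNormal (m :: v)
  · obtain rfl := hv'.eq_of_evalWord_eq hn (by rw [he, evalWord_cons])
    obtain ⟨z, h1, h2⟩ := hy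
    rwa [← hst.read_det_left h2 hx]
  · cases v with
    | nil => exact absurd (List.isChain_singleton _) hn
    | cons ℓ t =>
      have hA : ℓ.isA = m.isA := by
        by_contra hA
        refine hn (List.isChain_cons_cons.2 ⟨?_, hv⟩)
        rw [Letter.isA_iff, Letter.isA_iff]
        revert hA; cases ℓ.isA <;> cases m.isA <;> simp
      obtain ⟨z, h1, h2⟩ := hx
      by_cases hm : m = ℓ.inv
      · obtain rfl := hv'.eq_of_evalWord_eq hv.tail (by
          rw [he, evalWord_cons, hm, Letter.eval_inv, inv_mul_cancel_left])
        rw [hst.read_det_left hy h2, hm]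
        exact hst.step_inv h1
      · have hl : m = ℓ ∧ m ≠ .a := by
          revert hA hm
          cases ℓ <;> cases m <;> simp [Letter.isA, Letter.inv]
        obtain ⟨rfl, hl⟩ := hl
        obtain rfl := hv'.eq_of_evalWord_eq (isNormal_cons_of_isA_eq hv m.isA_inv) (by
          rw [he, evalWord_cons, evalWord_cons, ← mul_assoc]
          congr 1
          cases m
          · exact absurd rfl hl
          · exact genB_mul_genB
          · change genB⁻¹ * genB⁻¹ = genB
            rw [← mul_inv_rev, genB_mul_genB, inv_inv])
        obtain ⟨z', h3, h4⟩ := hy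
        obtain rfl := hst.read_det_left h2 h4
        have h5 := hst.step_inv h3
        have : m.inv.inv = m := by cases m <;> rfl
        rw [this] at h5
        have := hst.step_inv (hst.step_square hl h1 h5)
        rwa [‹m.inv.inv = m›] at this

variable {r : V} {u : V → List Letter} (hu : ∀ x, Read st r (u x) x)
include hu

omit hst hu in
/-- The coset of the elements denoted by the paths from the root to `x`. -/
def vertexCoset (hst : IsReduced st) (r : V) (u : V → List Letter) (x : V) :
    RightCosets (hst.loops r) := coset (hst.loops r) (evalWord (u x))

theorem vertexCoset_eq {x : V} {w : List Letter} (hw : Read st r w x) :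
    vertexCoset hst r u x = coset (hst.loops r) (evalWord w) := by
  rw [vertexCoset, coset_eq_iff]
  refine ⟨w ++ invWord (u x), ?_, read_append.2 ⟨x, hw, hst.read_invWord (hu x)⟩⟩
  rw [evalWord_append, evalWord_invWord]

theorem exists_read_of_coset_eq {x : V} {g : PSL2Z}
    (h : vertexCoset hst r u x = coset (hst.loops r) g) :
    ∃ w, IsNormal w ∧ evalWord w = g ∧ Read st r w x := by
  rw [vertexCoset, coset_eq_iff] at h
  obtain ⟨l, hl, hr⟩ := h
  obtain ⟨w, hw, he, hrw⟩ := hst.exists_normal (read_append.2 ⟨r, hr, hu x⟩)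
  refine ⟨w, hw, ?_, hrw⟩
  rw [he, evalWord_append, hl, inv_mul_cancel_right]

theorem vertexCoset_injective : Function.Injective (vertexCoset hst r u) := by
  intro x y h
  obtain ⟨w, -, he, hr⟩ := hst.exists_read_of_coset_eq hu h
  exact hst.eq_of_read hr (hu y) he

theorem vertexCoset_root : vertexCoset hst r u r = coset _ 1 := hst.vertexCoset_eq hu (w := []) rfl

theorem step_iff_inducedStep (x : V) (ℓ : Letter) (y : V) :
    st x ℓ y ↔ inducedStep (vertexCoset hst r u) x ℓ y := by
  constructor
  · intro h
    rw [inducedStep, vertexCoset_eq hst hu (read_append.2 ⟨x, hu x, read_singleton.2 h⟩),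
      evalWord_append, evalWord_singleton]
    rfl
  · intro h
    obtain ⟨w, hw, he, hr⟩ := hst.exists_read_of_coset_eq hu (x := y) h
    obtain ⟨v, hv, hev, hrv⟩ := hst.exists_normal (hu x)
    have inv_normal : ∀ {w}, IsNormal w → IsNormal (invWord w) := fun h => by
      obtain ⟨_, _, h⟩ := isNormal_iff.1 h
      exact h.invWord.isNormal
    have := hst.step_of_read (inv_normal hv) (inv_normal hw) (hst.read_invWord hrv)
      (hst.read_invWord hr) (m := ℓ.inv) (by
        rw [evalWord_invWord, he, evalWord_invWord, hev, Letter.eval_inv, mul_inv_rev])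
    have := hst.step_inv this
    rwa [show ℓ.inv.inv = ℓ by cases ℓ <;> rfl] at this

theorem verts_subset_range :
    (stallingsGraph (hst.loops r)).verts ⊆ Set.range (vertexCoset hst r u) := by
  rintro _ ⟨w, hw, ⟨l, hl, hrl⟩, v, ⟨t, rfl⟩, rfl⟩
  obtain ⟨l', hl', hel', hrl'⟩ := hst.exists_normal hrl
  obtain rfl := hw.eq_of_evalWord_eq hl' (by rw [hel', hl])
  obtain ⟨x, hx, -⟩ := read_append.1 hrl'
  exact ⟨x, hst.vertexCoset_eq hu hx⟩

/-- Every vertex lies on a loop at the root that reads a normal word, if paths without backtracking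
can be reversed. -/
theorem range_subset_verts
    (hret : ∀ x y τ τ' w, Alt τ w τ' → Read st x w y → ∃ w', Alt τ' w' τ ∧ Read st y w' x) :
    Set.range (vertexCoset hst r u) ⊆ (stallingsGraph (hst.loops r)).verts := by
  rintro _ ⟨x, rfl⟩
  obtain ⟨v, hv, -, hrv⟩ := hst.exists_normal (hu x)
  obtain ⟨τ, τ', hv⟩ := isNormal_iff.1 hv
  obtain ⟨v', hv', hrv'⟩ := hret _ _ _ _ _ hv hrv
  exact ⟨v ++ v', (alt_append.2 ⟨_, hv, hv'⟩).isNormal, ⟨_, rfl, read_append.2 ⟨_, hrv, hrv'⟩⟩,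
    v, List.prefix_append _ _, hst.vertexCoset_eq hu hrv⟩

theorem loops_fg [Finite V] : (hst.loops r).FG := by
  have : Finite Letter := Finite.of_surjective (![.a, .b, .bInv] : Fin 3 → Letter) (by
    rintro (_ | _ | _)
    · exact ⟨0, rfl⟩
    · exact ⟨1, rfl⟩
    · exact ⟨2, rfl⟩)
  -- These are Schreier's generators. The path `u r` need not be empty, so its value is included in
  -- order to undo a conjugation by it at the end.
  set K := Subgroup.closure (insert (evalWord (u r)) (Set.range fun p : {p : V × Letter × V //
      st p.1 p.2.1 p.2.2} =>
    evalWord (u p.1.1) * p.1.2.1.eval * (evalWord (u p.1.2.2))⁻¹)) with hK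
  have key : ∀ w x y, Read st x w y → evalWord (u x) * evalWord w * (evalWord (u y))⁻¹ ∈ K := by
    intro w
    induction w with
    | nil =>
      intro x y h
      cases h
      simp [K.one_mem]
    | cons ℓ w ih =>
      rintro x y ⟨z, h1, h2⟩
      have := K.mul_mem (Subgroup.subset_closure (Set.mem_insert_of_mem _
        (Set.mem_range_self ⟨(x, ℓ, z), h1⟩))) (ih z y h2)
      rw [evalWord_cons]
      convert this using 1
      group
  have hur : evalWord (u r) ∈ K := Subgroup.subset_closure (Set.mem_insert _ _)
  refine (Subgroup.fg_iff _).2 ⟨_, le_antisymm (a := K) ?_ ?_, (Set.finite_range _).insert _⟩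
  · rw [hK, Subgroup.closure_le]
    rintro _ (rfl | ⟨⟨⟨x, ℓ, y⟩, h⟩, rfl⟩)
    · exact ⟨u r, rfl, hu r⟩
    · refine ⟨u x ++ ([ℓ] ++ invWord (u y)), ?_, read_append.2 ⟨x, hu x, read_append.2
        ⟨y, read_singleton.2 h, hst.read_invWord (hu y)⟩⟩⟩
      simp only [evalWord_append, evalWord_invWord, evalWord_singleton, mul_assoc]
  · rintro _ ⟨w, rfl, hw⟩
    have := K.mul_mem (K.mul_mem (K.inv_mem hur) (key w r r hw)) hur
    convert this using 1
    group

end IsReduced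

namespace LabelledGraph

variable {V : Type*} {f g : V → V × Bool} {r : V}

theorem isReduced_step (hf : ∀ x, IsInvolutive f x) (hg : ∀ x, IsTernary g x) :
    IsReduced ((⟨f, g, false, false⟩ : LabelledGraph V).step r) where
  symm {x y} h := by
    obtain ⟨rfl, -⟩ := h
    exact ⟨(hf x).2, by simp⟩
  inv := Iff.rfl
  det {x ℓ y z} h h' := by
    cases ℓ
    · exact h.1.symm.trans h'.1
    · exact h.1.symm.trans h'.1
    · exact IsTernary.injective hg (h.1.trans h'.1.symm)
  tri {x y z} h h' := by
    obtain ⟨rfl, h1, -⟩ := h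
    obtain ⟨rfl, h2, -⟩ := h'
    simp only at h1 h2
    rcases hg x with ⟨h3, h4⟩ | ⟨h3, -, h4⟩
    · exact ⟨h4, h3, by simp⟩
    · rw [h3] at h2
      rw [h2, h1] at h4
      simp at h4

/-- Exactly one point of each transposition is unmarked, which gives the edge one direction; the
points of other cycles are all unmarked. -/
theorem step_b_or_step_b (hg : ∀ x, IsTernary g x) (x : V) :
    (⟨f, g, false, false⟩ : LabelledGraph V).step r x .b (g x).1 ∨
      (⟨f, g, false, false⟩ : LabelledGraph V).step r (g x).1 .b x := by
  by_cases h : (g (g x).1).2 = false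
  · exact Or.inl ⟨rfl, h, by simp⟩
  · right
    rcases hg (g x).1 with ⟨h1, -⟩ | ⟨h1, -, h2⟩
    · exact absurd h1 h
    · have h3 : (g (g x).1).1 = x := IsTernary.injective hg h1
      refine ⟨h3, ?_, by simp⟩
      simp only
      rw [h3] at h2
      revert h h2
      cases (g (g x).1).2 <;> cases (g x).2 <;> simp

/-- Paths without backtracking can be reversed, in finite graphs without leaves. -/
theorem exists_alt_return [Finite V] (hf : ∀ x, IsInvolutive f x) (hg : ∀ x, IsTernary g x)
    (x y : V) (τ τ' : Bool) (w : List Letter) (hw : Alt τ w τ')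
    (hr : Read ((⟨f, g, false, false⟩ : LabelledGraph V).step r) x w y) :
    ∃ w', Alt τ' w' τ ∧ Read ((⟨f, g, false, false⟩ : LabelledGraph V).step r) y w' x := by
  set st := (⟨f, g, false, false⟩ : LabelledGraph V).step r with hst
  -- A state is a vertex together with the kind of the next letter. All transitions come from two
  -- permutations of the finite set of states, which follow `g` or its inverse when a `b`-letter is
  -- due, so every transition can be undone by further transitions.
  let T : V × Bool → V × Bool → Prop := fun s t =>
    t.2 = (!s.2) ∧ ∃ ℓ : Letter, ℓ.isA = s.2 ∧ st s.1 ℓ t.1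
  have h1 : ∀ s t, Relation.ReflTransGen T s t → ∃ w, Alt s.2 w t.2 ∧ Read st s.1 w t.1 := by
    intro s t h
    induction h with
    | refl => exact ⟨[], rfl, rfl⟩
    | tail _ h ih =>
      obtain ⟨w, hw, hr⟩ := ih
      obtain ⟨h1, ℓ, h2, h3⟩ := h
      exact ⟨w ++ [ℓ], alt_append.2 ⟨_, hw, h2, h1.symm⟩, read_append.2 ⟨_, hr, read_singleton.2 h3⟩⟩
  let G := Equiv.ofBijective _ (Finite.injective_iff_bijective.1 (IsTernary.injective hg))
  have hG : ∀ x, (g (G.symm x)).1 = x := fun x => G.apply_symm_apply x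
  have hred := isReduced_step (r := r) hf hg
  have hb : ∀ x, ∃ ℓ : Letter, ℓ.isA = false ∧ st x ℓ (g x).1 := fun x =>
    (step_b_or_step_b hg x).elim (fun h => ⟨.b, rfl, h⟩) fun h => ⟨.bInv, rfl, h⟩
  have hb' : ∀ x, ∃ ℓ : Letter, ℓ.isA = false ∧ st (g x).1 ℓ x := fun x =>
    (step_b_or_step_b hg x).elim (fun h => ⟨.bInv, rfl, h⟩) fun h => ⟨.b, rfl, h⟩
  let f1 : V × Bool → V × Bool := fun s => (bif s.2 then (f s.1).1 else (g s.1).1, !s.2)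
  let f2 : V × Bool → V × Bool := fun s => (bif s.2 then (f s.1).1 else G.symm s.1, !s.2)
  have hf1 : Function.Injective f1 := by
    rintro ⟨x, a⟩ ⟨y, b⟩ h
    have h2 : a = b := Bool.not_inj (congrArg Prod.snd h)
    subst h2
    have h1 := congrArg Prod.fst h
    cases a
    · exact Prod.ext (IsTernary.injective hg h1) rfl
    · exact Prod.ext (IsInvolutive.injective hf h1) rfl
  have hf2 : Function.Injective f2 := by
    rintro ⟨x, a⟩ ⟨y, b⟩ h
    have h2 : a = b := Bool.not_inj (congrArg Prod.snd h)
    subst h2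
    have h1 := congrArg Prod.fst h
    cases a
    · exact Prod.ext (G.symm.injective h1) rfl
    · exact Prod.ext (IsInvolutive.injective hf h1) rfl
  have hT1 : ∀ s, T s (f1 s) := by
    rintro ⟨x, a⟩
    refine ⟨rfl, ?_⟩
    cases a
    · exact hb x
    · exact ⟨.a, rfl, rfl, by simp⟩
  have hT2 : ∀ s, T s (f2 s) := by
    rintro ⟨x, a⟩
    refine ⟨rfl, ?_⟩
    cases a
    · have := hb' (G.symm x)
      rwa [hG] at this
    · exact ⟨.a, rfl, rfl, by simp⟩
  have hTf : ∀ s t, T s t → t = f1 s ∨ t = f2 s := by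
    rintro ⟨x, a⟩ ⟨y, b⟩ ⟨rfl : b = !a, ℓ, h2, h3⟩
    have h2 : ℓ.isA = a := h2
    subst h2
    cases ℓ
    · left; exact Prod.ext h3.1.symm rfl
    · left; exact Prod.ext h3.1.symm rfl
    · right
      refine Prod.ext ?_ rfl
      exact (G.symm_apply_eq.2 h3.1.symm).symm
  have hrev : ∀ s t, T s t → Relation.ReflTransGen T t s := by
    intro s t h
    rcases hTf s t h with rfl | rfl
    · exact reflTransGen_of_injective hf1 hT1 s
    · exact reflTransGen_of_injective hf2 hT2 s
  suffices h : ∀ w x y τ τ', Alt τ w τ' → Read st x w y →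
      Relation.ReflTransGen T (y, τ') (x, τ) from h1 _ _ (h w x y τ τ' hw hr)
  intro w
  induction w with
  | nil =>
    rintro x y τ τ' rfl rfl
    exact .refl
  | cons ℓ w ih =>
    rintro x y τ τ' ⟨h2, h3⟩ ⟨z, h4, h5⟩
    exact (ih z y _ τ' h3 h5).trans (hrev (x, τ) (z, !τ) ⟨rfl, ℓ, h2, h4⟩)

theorem exists_read_of_connected (hf : ∀ x, IsInvolutive f x) (hg : ∀ x, IsTernary g x)
    (hc : ∀ S : Set V, r ∈ S → (∀ x ∈ S, (f x).1 ∈ S ∧ (g x).1 ∈ S) → ∀ x, x ∈ S) (x : V) :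
    ∃ u, Read ((⟨f, g, false, false⟩ : LabelledGraph V).step r) r u x := by
  refine hc {x | ∃ u, Read ((⟨f, g, false, false⟩ : LabelledGraph V).step r) r u x}
    ⟨[], rfl⟩ ?_ x
  rintro y ⟨u, hu⟩
  have ha : (⟨f, g, false, false⟩ : LabelledGraph V).step r y .a (f y).1 := ⟨rfl, by simp⟩
  refine ⟨⟨u ++ [.a], read_append.2 ⟨y, hu, read_singleton.2 ha⟩⟩, ?_⟩
  rcases step_b_or_step_b (f := f) (r := r) hg y with h | h
  · exact ⟨u ++ [.b], read_append.2 ⟨y, hu, read_singleton.2 h⟩⟩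
  · exact ⟨u ++ [.bInv], read_append.2 ⟨y, hu,
      read_singleton.2 ((isReduced_step hf hg).inv.2 h)⟩⟩

/-- A connected labelled graph is the Stallings graph of a finitely generated subgroup. -/
theorem exists_subgroup [Finite V] (hf : ∀ x, IsInvolutive f x) (hg : ∀ x, IsTernary g x)
    (hc : ∀ S : Set V, r ∈ S → (∀ x ∈ S, (f x).1 ∈ S ∧ (g x).1 ∈ S) → ∀ x, x ∈ S) :
    ∃ (H : Subgroup PSL2Z) (κ : V → RightCosets H), H.FG ∧ Function.Injective κ ∧
      κ r = coset H 1 ∧ Set.range κ = (stallingsGraph H).verts ∧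
      (⟨f, g, false, false⟩ : LabelledGraph V).Represents r κ := by
  choose u hu using exists_read_of_connected hf hg hc
  have hst := isReduced_step (r := r) hf hg
  exact ⟨hst.loops r, hst.vertexCoset r u, hst.loops_fg hu, hst.vertexCoset_injective hu,
    hst.vertexCoset_root hu, (hst.range_subset_verts hu (exists_alt_return hf hg)).antisymm
      (hst.verts_subset_range hu), hst.step_iff_inducedStep hu⟩

/-- A point is unmarked exactly when a `b`-edge enters it, so the edges determine the marks. The
edges and the marks then determine the maps. -/
theorem eq_of_step_iff {f' g' : V → V × Bool} (hf : ∀ x, IsInvolutive f x)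
    (hg : ∀ x, IsTernary g x) (hf' : ∀ x, IsInvolutive f' x) (hg' : ∀ x, IsTernary g' x)
    (h : ∀ x ℓ y, (⟨f, g, false, false⟩ : LabelledGraph V).step r x ℓ y ↔
      (⟨f', g', false, false⟩ : LabelledGraph V).step r x ℓ y) : f = f' ∧ g = g' := by
  have hb : ∀ x y, ((g x).1 = y ∧ (g y).2 = false) ↔ ((g' x).1 = y ∧ (g' y).2 = false) := by
    intro x y
    simpa [step] using h x .b y
  have key : ∀ g g' : V → V × Bool, (∀ x, IsTernary g x) → (∀ x, IsTernary g' x) →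
      (∀ x y, ((g x).1 = y ∧ (g y).2 = false) ↔ ((g' x).1 = y ∧ (g' y).2 = false)) →
      ∀ y, (g y).2 = false → (g' y).2 = false := by
    intro g g' hg hg' hb y hy
    rcases hg y with ⟨h1, h2⟩ | ⟨h1, -, -⟩
    · exact ((hb _ y).1 ⟨h2, hy⟩).2
    · exact ((hb _ y).1 ⟨h1, hy⟩).2
  have hm : ∀ y, (g y).2 = (g' y).2 := by
    intro y
    have h1 := key g g' hg hg' hb y
    have h2 := key g' g hg' hg (fun x y => (hb x y).symm) y
    revert h1 h2
    cases (g y).2 <;> cases (g' y).2 <;> simp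
  refine ⟨funext fun x => Prod.ext ?_ ?_, funext fun x => Prod.ext ?_ (hm x)⟩
  · exact ((h x .a (f x).1).1 ⟨rfl, by simp⟩).1.symm
  · rw [(hf x).1, (hf' x).1]
  · by_cases h1 : (g (g x).1).2 = false
    · exact ((hb x _).1 ⟨rfl, h1⟩).1.symm
    · rcases hg (g x).1 with ⟨h2, -⟩ | ⟨h2, -, h3⟩
      · exact absurd h2 h1
      · have h4 : (g (g x).1).1 = x := IsTernary.injective hg h2
        have h5 : (g x).2 = false := by
          rw [h4] at h3
          revert h1 h3
          cases (g (g x).1).2 <;> cases (g x).2 <;> simp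
        have h6 := ((hb (g x).1 x).1 ⟨h4, h5⟩).1
        rcases hg' (g x).1 with ⟨h7, -⟩ | ⟨h7, -, h8⟩
        · exact absurd (h7 ▸ hm _) h1
        · rw [h6] at h7
          exact h7.symm

end LabelledGraph

end ModularSubgroup

namespace ModularSubgroup

/-! ### Counting marked permutations -/

section Counting

variable {V : Type*}

/-- A property of a marked map around a point that only depends on the orbit of the point, that holds at
unmarked fixed points, and that forces injectivity. -/
structure IsLocal (Q : (V → V × Bool) → V → Prop) : Prop where
  congr : ∀ {f g : V → V × Bool} {C : Set V}, (∀ x ∈ C, (f x).1 ∈ C) → (∀ x ∈ C, f x = g x) →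
    ∀ x ∈ C, Q f x → Q g x
  of_fixed : ∀ {f : V → V × Bool} {x : V}, f x = (x, false) → Q f x
  inj : ∀ {f : V → V × Bool}, (∀ x, Q f x) → Function.Injective fun x => (f x).1

theorem isLocal_isInvolutive : IsLocal (IsInvolutive (V := V)) where
  congr {f g C} hC hfg x hx h := by
    rw [IsInvolutive, ← hfg x hx, ← hfg _ (hC x hx)]
    exact h
  of_fixed {f x} h := by simp [IsInvolutive, h]
  inj := IsInvolutive.injective

theorem isLocal_isTernary : IsLocal (IsTernary (V := V)) where
  congr {f g C} hC hfg x hx h := by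
    rw [IsTernary, ← hfg x hx, ← hfg _ (hC x hx), ← hfg _ (hC _ (hC x hx))]
    exact h
  of_fixed {f x} h := by simp [IsTernary, h]
  inj := IsTernary.injective

/-- The point `x` recurs along its own orbit, so an orbit that enters `C` has started there. -/
theorem mapsTo_compl [Finite V] {f : V → V} (hf : Function.Injective f) {C : Set V}
    (hC : ∀ x ∈ C, f x ∈ C) : ∀ x ∈ Cᶜ, f x ∈ Cᶜ := by
  intro x hx hfx
  obtain ⟨m, hm, h⟩ := hf.mem_periodicPts x
  obtain ⟨m, rfl⟩ := Nat.exists_eq_succ_of_ne_zero hm.ne'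
  have key : ∀ j, f^[j] (f x) ∈ C := by
    intro j
    induction j with
    | zero => simpa using hfx
    | succ j ih =>
      rw [Function.iterate_succ_apply']
      exact hC _ ih
  have := key m
  rw [← Function.iterate_succ_apply, h.eq] at this
  exact hx this

variable [Fintype V] [DecidableEq V]

open Classical in
/-- The marked maps that satisfy `Q` everywhere and are trivial outside of `S`. -/
noncomputable def mapsOn (Q : (V → V × Bool) → V → Prop) (S : Finset V) : Finset (V → V × Bool) :=
  Finset.univ.filter fun f => (∀ x, Q f x) ∧ ∀ x, x ∉ S → f x = (x, false)

theorem mem_mapsOn {Q : (V → V × Bool) → V → Prop} {S : Finset V} {f : V → V × Bool} :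
    f ∈ mapsOn Q S ↔ (∀ x, Q f x) ∧ ∀ x, x ∉ S → f x = (x, false) := by
  simp [mapsOn]

theorem mem_mapsOn_univ {Q : (V → V × Bool) → V → Prop} {f : V → V × Bool} :
    f ∈ mapsOn Q Finset.univ ↔ ∀ x, Q f x := by
  simp [mapsOn]

theorem mapsOn_closed {Q : (V → V × Bool) → V → Prop} (hQ : IsLocal Q) {S : Finset V}
    {f : V → V × Bool} (hf : f ∈ mapsOn Q S) {x : V} (hx : x ∈ S) : (f x).1 ∈ S := by
  rw [mem_mapsOn] at hf
  by_contra h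
  have h1 := hf.2 _ h
  have : (f x).1 = x := hQ.inj hf.1 (by simp [h1])
  rw [this] at h
  exact h hx

/-- The map that agrees with `f` on `C` and with `g` elsewhere. -/
def glue (C : Finset V) (f g : V → V × Bool) (x : V) : V × Bool := if x ∈ C then f x else g x

omit [Fintype V] in
theorem glue_of_mem {C : Finset V} {f g : V → V × Bool} {x : V} (hx : x ∈ C) :
    glue C f g x = f x := if_pos hx

omit [Fintype V] in
theorem glue_of_notMem {C : Finset V} {f g : V → V × Bool} {x : V} (hx : x ∉ C) :
    glue C f g x = g x := if_neg hx

theorem glue_property {Q : (V → V × Bool) → V → Prop} (hQ : IsLocal Q) {C : Finset V}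
    {f g : V → V × Bool} (hf : ∀ x, Q f x) (hg : ∀ x, Q g x) (hfC : ∀ x ∈ C, (f x).1 ∈ C)
    (hgC : ∀ x ∈ C, (g x).1 ∈ C) (x : V) : Q (glue C f g) x := by
  by_cases hx : x ∈ C
  · exact hQ.congr (C := C) hfC (fun y hy => (glue_of_mem hy).symm) x hx (hf x)
  · exact hQ.congr (C := (C : Set V)ᶜ) (mapsTo_compl (hQ.inj hg) hgC)
      (fun y hy => (glue_of_notMem hy).symm) x hx (hg x)

theorem id_mem_mapsOn {Q : (V → V × Bool) → V → Prop} (hQ : IsLocal Q) (S : Finset V) :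
    (fun x => (x, false)) ∈ mapsOn Q S :=
  mem_mapsOn.2 ⟨fun _ => hQ.of_fixed rfl, fun _ _ => rfl⟩

open Classical in
/-- The maps with a given restriction to a closed set `C` correspond to the maps outside of `C`. -/
theorem sum_mapsOn_filter {M : Type*} [AddCommMonoid M] {Q : (V → V × Bool) → V → Prop}
    (hQ : IsLocal Q) {C S : Finset V} (hC : C ⊆ S) {f₀ : V → V × Bool} (hf₀ : f₀ ∈ mapsOn Q C)
    (φ : (V → V × Bool) → M) :
    ∑ f ∈ (mapsOn Q S).filter (fun f => ∀ x ∈ C, f x = f₀ x), φ f =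
      ∑ g ∈ mapsOn Q (S \ C), φ (glue C f₀ g) := by
  have h0 := fun x (hx : x ∈ C) => mapsOn_closed hQ hf₀ hx
  refine Finset.sum_bij' (fun f _ => glue C (fun x => (x, false)) f) (fun g _ => glue C f₀ g)
    ?_ ?_ ?_ ?_ ?_
  · intro f hf
    rw [Finset.mem_filter, mem_mapsOn] at hf
    refine mem_mapsOn.2 ⟨glue_property hQ (fun _ => hQ.of_fixed rfl) hf.1.1 (fun x hx => hx)
      (fun x hx => by rw [hf.2 x hx]; exact h0 x hx), fun x hx => ?_⟩
    by_cases hxC : x ∈ C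
    · rw [glue_of_mem hxC]
    · rw [glue_of_notMem hxC]
      exact hf.1.2 x fun h => hx (Finset.mem_sdiff.2 ⟨h, hxC⟩)
  · intro g hg
    rw [mem_mapsOn] at hg
    have hgC : ∀ x ∈ C, g x = (x, false) := fun x hx =>
      hg.2 x fun h => (Finset.mem_sdiff.1 h).2 hx
    refine Finset.mem_filter.2 ⟨mem_mapsOn.2 ⟨glue_property hQ (mem_mapsOn.1 hf₀).1 hg.1 h0
      (fun x hx => by rw [hgC x hx]; exact hx), fun x hx => ?_⟩, fun x hx => glue_of_mem hx⟩
    rw [glue_of_notMem fun h => hx (hC h)]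
    exact hg.2 x fun h => hx (Finset.mem_sdiff.1 h).1
  · intro f hf
    rw [Finset.mem_filter] at hf
    funext x
    by_cases hx : x ∈ C
    · rw [glue_of_mem hx, hf.2 x hx]
    · rw [glue_of_notMem hx, glue_of_notMem hx]
  · intro g hg
    rw [mem_mapsOn] at hg
    funext x
    by_cases hx : x ∈ C
    · rw [glue_of_mem hx, hg.2 x fun h => (Finset.mem_sdiff.1 h).2 hx]
    · rw [glue_of_notMem hx, glue_of_notMem hx]
  · intro f hf
    rw [Finset.mem_filter] at hf
    congr 1
    funext x
    by_cases hx : x ∈ C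
    · rw [glue_of_mem hx, hf.2 x hx]
    · rw [glue_of_notMem hx, glue_of_notMem hx]

open Classical in
theorem card_mapsOn_filter {Q : (V → V × Bool) → V → Prop} (hQ : IsLocal Q) {C S : Finset V}
    (hC : C ⊆ S) {f₀ : V → V × Bool} (hf₀ : f₀ ∈ mapsOn Q C) :
    ((mapsOn Q S).filter (fun f => ∀ x ∈ C, f x = f₀ x)).card = (mapsOn Q (S \ C)).card := by
  rw [Finset.card_eq_sum_ones, Finset.card_eq_sum_ones, sum_mapsOn_filter hQ hC hf₀]

open Classical in
-- A map that preserves `C` splits into its restriction to `C` and a map outside of `C`.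
theorem card_mapsOn_closed_le {Q : (V → V × Bool) → V → Prop} (hQ : IsLocal Q) {C S : Finset V}
    (hC : C ⊆ S) :
    ((mapsOn Q S).filter (fun f => ∀ x ∈ C, (f x).1 ∈ C)).card ≤
      (mapsOn Q C).card * (mapsOn Q (S \ C)).card := by
  calc _ ≤ ((mapsOn Q C).biUnion fun f₀ =>
        (mapsOn Q S).filter (fun f => ∀ x ∈ C, f x = f₀ x)).card := by
        refine Finset.card_le_card fun f hf => ?_
        rw [Finset.mem_filter] at hf
        refine Finset.mem_biUnion.2 ⟨glue C f fun x => (x, false), mem_mapsOn.2 ⟨glue_property hQ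
          (mem_mapsOn.1 hf.1).1 (fun _ => hQ.of_fixed rfl) hf.2 (fun _ h => h),
          fun x hx => glue_of_notMem hx⟩, Finset.mem_filter.2 ⟨hf.1,
          fun x hx => (glue_of_mem hx).symm⟩⟩
    _ ≤ ∑ f₀ ∈ mapsOn Q C, ((mapsOn Q S).filter (fun f => ∀ x ∈ C, f x = f₀ x)).card :=
        Finset.card_biUnion_le
    _ = ∑ f₀ ∈ mapsOn Q C, (mapsOn Q (S \ C)).card :=
        Finset.sum_congr rfl fun f₀ hf₀ => card_mapsOn_filter hQ hC hf₀
    _ = _ := by rw [Finset.sum_const, smul_eq_mul]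

theorem card_mapsOn_empty {Q : (V → V × Bool) → V → Prop} (hQ : IsLocal Q) :
    (mapsOn Q (∅ : Finset V)).card = 1 := by
  refine Finset.card_eq_one.2 ⟨fun x => (x, false), ?_⟩
  ext f
  rw [Finset.mem_singleton]
  constructor
  · intro h
    funext x
    exact (mem_mapsOn.1 h).2 x (by simp)
  · rintro rfl
    exact id_mem_mapsOn hQ _

/-! #### Involutions -/

/-- The number of involutions of a set with `n` elements. -/
def invol : ℕ → ℕ
  | 0 => 1
  | 1 => 1
  | n + 2 => invol (n + 1) + (n + 1) * invol n

theorem invol_rec {n : ℕ} (hn : 1 ≤ n) : invol n = invol (n - 1) + (n - 1) * invol (n - 2) := by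
  match n with
  | 1 => simp [invol]
  | n + 2 => simp [invol]

/-- The transposition of `v` and `w`, without marks. -/
def swapMap (v w : V) (x : V) : V × Bool := (Equiv.swap v w x, false)

theorem swapMap_mem (v w : V) : swapMap v w ∈ mapsOn IsInvolutive {v, w} := by
  refine mem_mapsOn.2 ⟨fun x => ⟨rfl, by simp [swapMap]⟩, fun x hx => ?_⟩
  simp only [Finset.mem_insert, Finset.mem_singleton, not_or] at hx
  rw [swapMap, Equiv.swap_apply_of_ne_of_ne hx.1 hx.2]

/-- The sum is split according to the image `w` of `v`, and `w = v` accounts for a fixed point. The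
summand is arbitrary so that the same splitting serves both to count involutions and to weigh them
by cycles. -/
theorem sum_involutions {M : Type*} [AddCommMonoid M] {S : Finset V} {v : V} (hv : v ∈ S)
    (φ : (V → V × Bool) → M) :
    ∑ f ∈ mapsOn IsInvolutive S, φ f =
      ∑ w ∈ S, ∑ g ∈ mapsOn IsInvolutive (S \ {v, w}), φ (glue {v, w} (swapMap v w) g) := by
  classical
  rw [← Finset.sum_fiberwise_of_maps_to (t := S) (g := fun f => (f v).1)
    (fun f hf => mapsOn_closed isLocal_isInvolutive hf hv)]
  refine Finset.sum_congr rfl fun w hw => ?_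
  rw [← sum_mapsOn_filter isLocal_isInvolutive (by
    simp [Finset.insert_subset_iff, hv, hw]) (swapMap_mem v w)]
  refine Finset.sum_congr (Finset.filter_congr fun f hf => ?_) fun _ _ => rfl
  have h := (mem_mapsOn.1 hf).1
  simp only [Finset.mem_insert, Finset.mem_singleton, forall_eq_or_imp, forall_eq, swapMap,
    Equiv.swap_apply_left, Equiv.swap_apply_right]
  constructor
  · rintro rfl
    exact ⟨Prod.ext rfl (h v).1, Prod.ext (h v).2 (h _).1⟩
  · intro h'
    rw [h'.1]

omit [Fintype V] in
theorem card_sdiff_pair {S : Finset V} {v w : V} (hv : v ∈ S) (hw : w ∈ S) (hvw : v ≠ w) :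
    (S \ {v, w}).card = S.card - 2 := by
  rw [Finset.card_sdiff_of_subset (by simp [Finset.insert_subset_iff, hv, hw]),
    Finset.card_pair hvw]

theorem card_involutions (S : Finset V) : (mapsOn IsInvolutive S).card = invol S.card := by
  induction hn : S.card using Nat.strong_induction_on generalizing S with
  | _ n ih =>
    rcases S.eq_empty_or_nonempty with rfl | ⟨v, hv⟩
    · rw [card_mapsOn_empty isLocal_isInvolutive, ← hn]; rfl
    · have hn1 : 1 ≤ n := hn ▸ Finset.card_pos.2 ⟨v, hv⟩
      rw [Finset.card_eq_sum_ones, sum_involutions hv, ← Finset.add_sum_erase _ _ hv,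
        invol_rec hn1]
      simp only [← Finset.card_eq_sum_ones]
      congr 1
      · rw [Finset.pair_eq_singleton, Finset.sdiff_singleton_eq_erase]
        exact ih _ (by omega) _ (by rw [Finset.card_erase_of_mem hv, hn])
      · rw [Finset.sum_congr rfl (g := fun _ => invol (n - 2)), Finset.sum_const,
          Finset.card_erase_of_mem hv, hn, smul_eq_mul]
        intro w hw
        rw [Finset.mem_erase] at hw
        exact ih _ (by omega) _ (by rw [card_sdiff_pair hv hw.2 hw.1.symm, hn])

/-! #### Permutations with cycles of length at most three -/

/-- The number of marked maps of a set with `n` elements that satisfy `IsTernary`. -/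
def tern : ℕ → ℕ
  | 0 => 1
  | 1 => 1
  | 2 => 3
  | n + 3 => tern (n + 2) + 2 * (n + 2) * tern (n + 1) + (n + 2) * (n + 1) * tern n

theorem tern_rec {n : ℕ} (hn : 1 ≤ n) : tern n = tern (n - 1) + 2 * (n - 1) * tern (n - 2) +
    (n - 1) * (n - 2) * tern (n - 3) := by
  match n with
  | 1 => simp [tern]
  | 2 => simp [tern]
  | n + 3 => simp [tern]

/-- The transposition of `v` and `w`, where exactly one of `v`, `w` is marked, namely `v` iff `b`. -/
def pairMap (v w : V) (b : Bool) (x : V) : V × Bool :=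
  (Equiv.swap v w x, if x = v then b else if x = w then !b else false)

theorem pairMap_mem {v w : V} (hvw : v ≠ w) (b : Bool) :
    pairMap v w b ∈ mapsOn IsTernary {v, w} := by
  have h0 : ∀ x, x ∉ ({v, w} : Finset V) → pairMap v w b x = (x, false) := by
    intro x hx
    simp only [Finset.mem_insert, Finset.mem_singleton, not_or] at hx
    rw [pairMap, Equiv.swap_apply_of_ne_of_ne hx.1 hx.2, if_neg hx.1, if_neg hx.2]
  refine mem_mapsOn.2 ⟨fun x => ?_, h0⟩
  by_cases hx : x ∈ ({v, w} : Finset V)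
  · right
    simp only [Finset.mem_insert, Finset.mem_singleton] at hx
    rcases hx with rfl | rfl
    · simp [pairMap, hvw.symm]
    · simp [pairMap, hvw, hvw.symm]
  · exact isLocal_isTernary.of_fixed (h0 x hx)

/-- The `3`-cycle `v ↦ w ↦ z ↦ v`, without marks. -/
def tripleMap (v w z : V) (x : V) : V × Bool :=
  (if x = v then w else if x = w then z else if x = z then v else x, false)

theorem tripleMap_mem {v w z : V} (hvw : v ≠ w) (hvz : v ≠ z) (hwz : w ≠ z) :
    tripleMap v w z ∈ mapsOn IsTernary {v, w, z} := by
  have h0 : ∀ x, x ∉ ({v, w, z} : Finset V) → tripleMap v w z x = (x, false) := by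
    intro x hx
    simp only [Finset.mem_insert, Finset.mem_singleton, not_or] at hx
    simp [tripleMap, hx.1, hx.2.1, hx.2.2]
  refine mem_mapsOn.2 ⟨fun x => ?_, h0⟩
  by_cases hx : x ∈ ({v, w, z} : Finset V)
  · left
    simp only [Finset.mem_insert, Finset.mem_singleton] at hx
    rcases hx with rfl | rfl | rfl <;>
      simp [tripleMap, hvw.symm, hvz.symm, hwz.symm]
  · exact isLocal_isTernary.of_fixed (h0 x hx)

open Classical in
theorem filter_mark_eq {S : Finset V} {v w : V} (hvw : v ≠ w) (b : Bool) :
    (mapsOn IsTernary S).filter (fun f => (f v).1 = w ∧ (f w).1 = v ∧ (f v).2 = b) =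
      (mapsOn IsTernary S).filter (fun f => ∀ x ∈ ({v, w} : Finset V), f x = pairMap v w b x) := by
  refine Finset.filter_congr fun f hf => ?_
  have h := (mem_mapsOn.1 hf).1
  simp only [Finset.mem_insert, Finset.mem_singleton, forall_eq_or_imp, forall_eq, pairMap,
    Equiv.swap_apply_left, Equiv.swap_apply_right, if_true, if_neg hvw.symm]
  constructor
  · rintro ⟨h1, h2, h3⟩
    refine ⟨Prod.ext h1 h3, Prod.ext h2 ?_⟩
    rcases h v with ⟨-, h5⟩ | ⟨-, -, h6⟩
    · rw [h1, h2, h1] at h5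
      exact absurd h5.symm hvw
    · rw [h1, h3] at h6
      rw [h6, Bool.not_not]
  · intro h'
    simp [h'.1, h'.2]

open Classical in
theorem card_ternary_fiber {S : Finset V} {v w z : V} {b : Bool} (hv : v ∈ S) (hw : w ∈ S)
    (hz : z ∈ S) :
    ((mapsOn IsTernary S).filter (fun f => (f v).1 = w ∧ (f w).1 = z ∧ (f v).2 = b)).card =
      if w = v then (if z = v ∧ b = false then (mapsOn IsTernary (S \ {v})).card else 0)
      else if z = v then (mapsOn IsTernary (S \ {v, w})).card
      else if z ≠ w ∧ b = false then (mapsOn IsTernary (S \ {v, w, z})).card else 0 := by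
  by_cases hwv : w = v
  · subst hwv
    rw [if_pos rfl]
    by_cases hc : z = w ∧ b = false
    · obtain ⟨rfl, rfl⟩ := hc
      rw [if_pos ⟨rfl, rfl⟩, ← card_mapsOn_filter isLocal_isTernary (by simpa using hv)
        (id_mem_mapsOn isLocal_isTernary {z})]
      congr 1
      refine Finset.filter_congr fun f hf => ?_
      simp [Prod.ext_iff]
    · rw [if_neg hc, Finset.card_eq_zero, Finset.filter_eq_empty_iff]
      rintro f hf ⟨h1, h2, h3⟩
      refine hc ⟨h2.symm.trans h1, ?_⟩
      rcases (mem_mapsOn.1 hf).1 w with ⟨h4, -⟩ | ⟨-, h4, -⟩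
      · rw [← h3, h4]
      · exact absurd h1 h4
  · rw [if_neg hwv]
    by_cases hzv : z = v
    · subst hzv
      rw [if_pos rfl, filter_mark_eq (Ne.symm hwv), card_mapsOn_filter isLocal_isTernary
        (by simp [Finset.insert_subset_iff, hv, hw]) (pairMap_mem (Ne.symm hwv) b)]
    · rw [if_neg hzv]
      by_cases hc : z ≠ w ∧ b = false
      · obtain ⟨hzw, rfl⟩ := hc
        rw [if_pos ⟨hzw, rfl⟩, ← card_mapsOn_filter isLocal_isTernary
          (by simp [Finset.insert_subset_iff, hv, hw, hz])
          (tripleMap_mem (Ne.symm hwv) (Ne.symm hzv) (Ne.symm hzw))]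
        congr 1
        refine Finset.filter_congr fun f hf => ?_
        have h := (mem_mapsOn.1 hf).1
        simp only [Finset.mem_insert, Finset.mem_singleton, forall_eq_or_imp, forall_eq, tripleMap,
          if_true, if_neg hwv, if_neg hzv, if_neg hzw]
        constructor
        · rintro ⟨h1, h2, h3⟩
          have h4 : (f z).1 = v := by
            rcases h v with ⟨-, h5⟩ | ⟨h5, -, -⟩
            · rwa [h1, h2] at h5
            · rw [h1, h2] at h5
              exact absurd h5 hzv
          refine ⟨Prod.ext h1 h3, Prod.ext h2 ?_, Prod.ext h4 ?_⟩
          · rcases h w with ⟨h5, -⟩ | ⟨h5, -, -⟩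
            · exact h5
            · rw [h2, h4] at h5
              exact absurd h5.symm hwv
          · rcases h z with ⟨h5, -⟩ | ⟨h5, -, -⟩
            · exact h5
            · rw [h4, h1] at h5
              exact absurd h5.symm hzw
        · intro h'
          simp [h'.1, h'.2]
      · rw [if_neg hc, Finset.card_eq_zero, Finset.filter_eq_empty_iff]
        rintro f hf ⟨h1, h2, h3⟩
        have h := (mem_mapsOn.1 hf).1
        refine hc ⟨?_, ?_⟩
        · rintro rfl
          exact hwv (IsTernary.injective h (h2.trans h1.symm))
        · rcases h v with ⟨h4, -⟩ | ⟨h4, -, -⟩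
          · rw [← h3, h4]
          · rw [h1, h2] at h4
            exact absurd h4 hzv

/-- The cycle of a chosen point `v` is a fixed point, one of `n - 1` transpositions with two
possible markings, or one of `(n - 1)(n - 2)` oriented triangles. Removing it leaves a map of the
same type. -/
theorem card_ternary (S : Finset V) : (mapsOn IsTernary S).card = tern S.card := by
  classical
  induction hn : S.card using Nat.strong_induction_on generalizing S with
  | _ n ih =>
    rcases S.eq_empty_or_nonempty with rfl | ⟨v, hv⟩
    · rw [card_mapsOn_empty isLocal_isTernary, ← hn]; rfl
    · have hn1 : 1 ≤ n := hn ▸ Finset.card_pos.2 ⟨v, hv⟩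
      have e1 : (mapsOn IsTernary (S \ {v})).card = tern (n - 1) :=
        ih _ (by omega) _ (by
          rw [Finset.sdiff_singleton_eq_erase, Finset.card_erase_of_mem hv, hn])
      have e2 : ∀ w ∈ S, w ≠ v → (mapsOn IsTernary (S \ {v, w})).card = tern (n - 2) :=
        fun w hw hwv => ih _ (by omega) _ (by rw [card_sdiff_pair hv hw hwv.symm, hn])
      have e3 : ∀ w ∈ S, w ≠ v → ∀ z ∈ S, z ≠ v → z ≠ w →
          (mapsOn IsTernary (S \ {v, w, z})).card = tern (n - 3) := by
        intro w hw hwv z hz hzv hzw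
        refine ih _ (by omega) _ ?_
        rw [Finset.card_sdiff_of_subset (by simp [Finset.insert_subset_iff, hv, hw, hz]), hn,
          Finset.card_eq_three.2 ⟨v, w, z, hwv.symm, hzv.symm, hzw.symm, rfl⟩]
      have key : (mapsOn IsTernary S).card = ∑ w ∈ S, ∑ z ∈ S, ∑ b : Bool,
          ((mapsOn IsTernary S).filter
            (fun f => (f v).1 = w ∧ (f w).1 = z ∧ (f v).2 = b)).card := by
        rw [Finset.card_eq_sum_card_fiberwise (t := S ×ˢ S ×ˢ (Finset.univ : Finset Bool))
          (f := fun f => ((f v).1, (f (f v).1).1, (f v).2)), Finset.sum_product]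
        · refine Finset.sum_congr rfl fun w _ => ?_
          rw [Finset.sum_product]
          refine Finset.sum_congr rfl fun z _ => Finset.sum_congr rfl fun b _ => ?_
          congr 1
          refine Finset.filter_congr fun f _ => ?_
          simp only [Prod.mk.injEq]
          constructor
          · rintro ⟨rfl, h⟩; exact ⟨rfl, h⟩
          · rintro ⟨rfl, h⟩; exact ⟨rfl, h⟩
        · intro f hf
          have h1 := mapsOn_closed isLocal_isTernary hf hv
          simp [h1, mapsOn_closed isLocal_isTernary hf h1]
      have inner : ∀ w ∈ S, (∑ z ∈ S, ∑ b : Bool, ((mapsOn IsTernary S).filter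
            (fun f => (f v).1 = w ∧ (f w).1 = z ∧ (f v).2 = b)).card) =
          if w = v then tern (n - 1) else 2 * tern (n - 2) + (n - 2) * tern (n - 3) := by
        intro w hw
        rw [← Finset.add_sum_erase _ _ hv]
        by_cases hwv : w = v
        · subst hwv
          rw [Finset.sum_eq_zero (s := S.erase w)]
          · rw [Fintype.sum_bool, card_ternary_fiber hv hw hw, card_ternary_fiber hv hw hw]
            simp [e1]
          · intro z hz
            rw [Finset.mem_erase] at hz
            rw [Fintype.sum_bool, card_ternary_fiber hv hw hz.2, card_ternary_fiber hv hw hz.2]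
            simp [hz.1]
        · rw [if_neg hwv]
          congr 1
          · rw [Fintype.sum_bool, card_ternary_fiber hv hw hv, card_ternary_fiber hv hw hv]
            simp [hwv, e2 w hw hwv, two_mul]
          · rw [← Finset.add_sum_erase _ _ (Finset.mem_erase.2 ⟨hwv, hw⟩),
              Finset.sum_congr (s₁ := (S.erase v).erase w) rfl (g := fun _ => tern (n - 3)),
              Finset.sum_const, Finset.card_erase_of_mem (Finset.mem_erase.2 ⟨hwv, hw⟩),
              Finset.card_erase_of_mem hv, hn]
            · rw [Fintype.sum_bool, card_ternary_fiber hv hw hw, card_ternary_fiber hv hw hw]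
              simp [hwv, Nat.sub_sub]
            · intro z hz
              simp only [Finset.mem_erase] at hz
              rw [Fintype.sum_bool, card_ternary_fiber hv hw hz.2.2,
                card_ternary_fiber hv hw hz.2.2]
              simp [hwv, hz.2.1, hz.1, e3 w hw hwv z hz.2.2 hz.2.1 hz.1]
      rw [key, Finset.sum_congr rfl inner, ← Finset.add_sum_erase _ _ hv, if_pos rfl,
        Finset.sum_congr rfl (g := fun _ => 2 * tern (n - 2) + (n - 2) * tern (n - 3)),
        Finset.sum_const, Finset.card_erase_of_mem hv, hn, tern_rec hn1, smul_eq_mul]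
      · ring
      · intro w hw
        rw [Finset.mem_erase] at hw
        rw [if_neg hw.1]

/-- The set of marked points. -/
def marks (f : V → V × Bool) : Finset V := Finset.univ.filter fun x => (f x).2 = true

/-- A marked point lies in a transposition whose marks are then determined. There are at most `n²`
choices of the point and its partner, and `tern (n - 2)` ways to complete the map. -/
theorem sum_card_marks_le :
    ∑ f ∈ mapsOn IsTernary (Finset.univ : Finset V), (marks f).card ≤
      Fintype.card V ^ 2 * tern (Fintype.card V - 2) := by
  classical
  simp only [marks, Finset.card_filter]
  rw [Finset.sum_comm]
  have key : ∀ x : V, ∑ f ∈ mapsOn IsTernary (Finset.univ : Finset V),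
      (if (f x).2 = true then 1 else 0) ≤ Fintype.card V * tern (Fintype.card V - 2) := by
    intro x
    rw [← Finset.card_filter]
    calc _ ≤ ((Finset.univ.erase x).biUnion fun w => (mapsOn IsTernary Finset.univ).filter
          (fun f => (f x).1 = w ∧ (f w).1 = x ∧ (f x).2 = true)).card := by
          refine Finset.card_le_card fun f hf => ?_
          rw [Finset.mem_filter] at hf
          rcases (mem_mapsOn.1 hf.1).1 x with ⟨h1, -⟩ | ⟨h1, h2, -⟩
          · rw [hf.2] at h1
            exact absurd h1 (by simp)
          · exact Finset.mem_biUnion.2 ⟨(f x).1, by simpa using h2,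
              Finset.mem_filter.2 ⟨hf.1, rfl, h1, hf.2⟩⟩
      _ ≤ ∑ w ∈ Finset.univ.erase x, ((mapsOn IsTernary Finset.univ).filter
          (fun f => (f x).1 = w ∧ (f w).1 = x ∧ (f x).2 = true)).card := Finset.card_biUnion_le
      _ ≤ ∑ w ∈ Finset.univ.erase x, tern (Fintype.card V - 2) := by
          refine Finset.sum_le_sum fun w hw => ?_
          have hw := Finset.ne_of_mem_erase hw
          rw [filter_mark_eq hw.symm, card_mapsOn_filter isLocal_isTernary (Finset.subset_univ _)
            (pairMap_mem hw.symm true), card_ternary, card_sdiff_pair (Finset.mem_univ _)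
            (Finset.mem_univ _) hw.symm, Finset.card_univ]
      _ ≤ _ := by
          rw [Finset.sum_const, smul_eq_mul]
          exact Nat.mul_le_mul_right _ (Finset.card_le_univ _)
  calc _ ≤ ∑ _x : V, Fintype.card V * tern (Fintype.card V - 2) :=
        Finset.sum_le_sum fun x _ => key x
    _ = _ := by rw [Finset.sum_const, Finset.card_univ, smul_eq_mul]; ring

/-! #### Connectedness -/

/-- No proper nonempty set is closed under both maps. -/
def IsConnectedPair (p : (V → V × Bool) × (V → V × Bool)) : Prop :=
  ∀ S : Finset V, S.Nonempty → (∀ x ∈ S, (p.1 x).1 ∈ S ∧ (p.2 x).1 ∈ S) → S = Finset.univ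

open Classical in
-- A closed set and its complement are both closed, and one of them has at most `n / 2` elements;
-- each of the two maps splits along it.
theorem card_not_connected_le :
    ((mapsOn IsInvolutive (Finset.univ : Finset V) ×ˢ
      mapsOn IsTernary (Finset.univ : Finset V)).filter (fun p => ¬ IsConnectedPair p)).card ≤
      ∑ k ∈ Finset.Icc 1 (Fintype.card V / 2), (Fintype.card V).choose k *
        ((invol k * invol (Fintype.card V - k)) * (tern k * tern (Fintype.card V - k))) := by
  set n := Fintype.card V with hn
  let D : Finset V → Finset ((V → V × Bool) × (V → V × Bool)) := fun S =>
    (mapsOn IsInvolutive Finset.univ).filter (fun f => ∀ x ∈ S, (f x).1 ∈ S) ×ˢ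
      (mapsOn IsTernary Finset.univ).filter (fun f => ∀ x ∈ S, (f x).1 ∈ S)
  have hD : ∀ S : Finset V, (D S).card ≤ (invol S.card * invol (n - S.card)) *
      (tern S.card * tern (n - S.card)) := by
    intro S
    rw [Finset.card_product]
    have h : (Finset.univ \ S).card = n - S.card := by
      rw [← Finset.compl_eq_univ_sdiff, Finset.card_compl]
    refine Nat.mul_le_mul ?_ ?_
    · rw [← h, ← card_involutions, ← card_involutions]
      exact card_mapsOn_closed_le isLocal_isInvolutive (Finset.subset_univ _)
    · rw [← h, ← card_ternary, ← card_ternary]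
      exact card_mapsOn_closed_le isLocal_isTernary (Finset.subset_univ _)
  calc _ ≤ ((Finset.Icc 1 (n / 2)).biUnion fun k =>
        (Finset.powersetCard k Finset.univ).biUnion D).card := by
        refine Finset.card_le_card fun p hp => ?_
        rw [Finset.mem_filter, Finset.mem_product] at hp
        obtain ⟨⟨h1, h2⟩, h3⟩ := hp
        rw [IsConnectedPair] at h3
        push Not at h3
        obtain ⟨S, hS, hcl, hne⟩ := h3
        have hSn : S.card < n := Finset.card_lt_univ_of_notMem
          (not_forall.1 (fun h => hne (Finset.eq_univ_iff_forall.2 h))).choose_spec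
        have hS0 : 0 < S.card := Finset.card_pos.2 hS
        have hmem : ∀ T : Finset V, (∀ x ∈ T, (p.1 x).1 ∈ T ∧ (p.2 x).1 ∈ T) → 1 ≤ T.card →
            T.card ≤ n / 2 → p ∈ (Finset.Icc 1 (n / 2)).biUnion fun k =>
              (Finset.powersetCard k Finset.univ).biUnion D := by
          intro T hT hT1 hT2
          refine Finset.mem_biUnion.2 ⟨T.card, Finset.mem_Icc.2 ⟨hT1, hT2⟩,
            Finset.mem_biUnion.2 ⟨T, Finset.mem_powersetCard.2 ⟨Finset.subset_univ _, rfl⟩,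
            Finset.mem_product.2 ⟨Finset.mem_filter.2 ⟨h1, fun x hx => (hT x hx).1⟩,
              Finset.mem_filter.2 ⟨h2, fun x hx => (hT x hx).2⟩⟩⟩⟩
        by_cases hc : S.card ≤ n / 2
        · exact hmem S hcl hS0 hc
        · refine hmem Sᶜ (fun x hx => ?_) ?_ ?_
          · have e1 := mapsTo_compl (isLocal_isInvolutive.inj (mem_mapsOn.1 h1).1) (C := S)
              (fun x hx => (hcl x hx).1) x (by simpa using hx)
            have e2 := mapsTo_compl (isLocal_isTernary.inj (mem_mapsOn.1 h2).1) (C := S)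
              (fun x hx => (hcl x hx).2) x (by simpa using hx)
            exact ⟨by simpa using e1, by simpa using e2⟩
          · rw [Finset.card_compl]; omega
          · rw [Finset.card_compl]; omega
    _ ≤ ∑ k ∈ Finset.Icc 1 (n / 2), ((Finset.powersetCard k Finset.univ).biUnion D).card :=
        Finset.card_biUnion_le
    _ ≤ ∑ k ∈ Finset.Icc 1 (n / 2), ∑ S ∈ Finset.powersetCard k Finset.univ, (D S).card :=
        Finset.sum_le_sum fun k _ => Finset.card_biUnion_le
    _ ≤ ∑ k ∈ Finset.Icc 1 (n / 2), ∑ S ∈ Finset.powersetCard k (Finset.univ : Finset V),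
          (invol k * invol (n - k)) * (tern k * tern (n - k)) := by
        refine Finset.sum_le_sum fun k _ => Finset.sum_le_sum fun S hS => ?_
        rw [← (Finset.mem_powersetCard.1 hS).2]
        exact hD S
    _ = _ := by
        refine Finset.sum_congr rfl fun k _ => ?_
        rw [Finset.sum_const, Finset.card_powersetCard, Finset.card_univ, smul_eq_mul]

end Counting

end ModularSubgroup

namespace ModularSubgroup

/-! ### Cycles of a random product -/

section Cycles

variable {V : Type*}

/-- `O` is a minimal nonempty set that is closed under `p`. -/
def IsCycleOf (p : V → V) (O : Finset V) : Prop :=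
  O.Nonempty ∧ (∀ x ∈ O, p x ∈ O) ∧
    ∀ O' ⊆ O, O'.Nonempty → (∀ x ∈ O', p x ∈ O') → O' = O

theorem IsCycleOf.congr {p p' : V → V} {O : Finset V} (h : IsCycleOf p O)
    (hp : ∀ x ∈ O, p x = p' x) : IsCycleOf p' O :=
  ⟨h.1, fun x hx => hp x hx ▸ h.2.1 x hx, fun O' hO hne hcl =>
    h.2.2 O' hO hne fun x hx => (hp x (hO hx)).symm ▸ hcl x hx⟩

theorem IsCycleOf.eq_of_mem [DecidableEq V] {p : V → V} {O O' : Finset V} (h : IsCycleOf p O)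
    (h' : IsCycleOf p O') {x : V} (hx : x ∈ O) (hx' : x ∈ O') : O = O' := by
  have hcl : ∀ y ∈ O ∩ O', p y ∈ O ∩ O' := fun y hy => by
    rw [Finset.mem_inter] at hy ⊢
    exact ⟨h.2.1 y hy.1, h'.2.1 y hy.2⟩
  have hne : (O ∩ O').Nonempty := ⟨x, Finset.mem_inter.2 ⟨hx, hx'⟩⟩
  rw [← h.2.2 _ Finset.inter_subset_left hne hcl, ← h'.2.2 _ Finset.inter_subset_right hne hcl]
  simp

variable [Fintype V]

theorem exists_isCycleOf {p : V → V} (hp : Function.Injective p) (x : V) :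
    ∃ O : Finset V, IsCycleOf p O ∧ x ∈ O ∧
      ∀ M : Set V, x ∈ M → (∀ y ∈ M, p y ∈ M) → ∀ y ∈ O, y ∈ M := by
  classical
  obtain ⟨m, hm, h⟩ := hp.mem_periodicPts x
  refine ⟨Finset.univ.filter fun y => ∃ i, p^[i] x = y, ⟨⟨x, ?_⟩, ?_, ?_⟩, ?_, ?_⟩
  · simpa using ⟨0, rfl⟩
  · intro y hy
    simp only [Finset.mem_filter, Finset.mem_univ, true_and] at hy ⊢
    obtain ⟨i, rfl⟩ := hy
    exact ⟨i + 1, Function.iterate_succ_apply' p i x⟩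
  · intro O' hO' hne hcl
    have hit : ∀ y ∈ O', ∀ i, p^[i] y ∈ O' := by
      intro y hy i
      induction i with
      | zero => simpa using hy
      | succ i ih =>
        rw [Function.iterate_succ_apply']
        exact hcl _ ih
    refine hO'.antisymm fun y hy => ?_
    simp only [Finset.mem_filter, Finset.mem_univ, true_and] at hy
    obtain ⟨k, rfl⟩ := hy
    obtain ⟨z, hz⟩ := hne
    have := hO' hz
    simp only [Finset.mem_filter, Finset.mem_univ, true_and] at this
    obtain ⟨i, rfl⟩ := this
    have hx : x ∈ O' := by
      have := hit _ hz (m * i - i)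
      rwa [← Function.iterate_add_apply, Nat.sub_add_cancel (Nat.le_mul_of_pos_left i hm),
        (h.mul_const i).eq] at this
    exact hit x hx k
  · simpa using ⟨0, rfl⟩
  · intro M hx hcl y hy
    simp only [Finset.mem_filter, Finset.mem_univ, true_and] at hy
    obtain ⟨i, rfl⟩ := hy
    induction i with
    | zero => simpa using hx
    | succ i ih =>
      rw [Function.iterate_succ_apply']
      exact hcl _ ih

variable [DecidableEq V]

open Classical in
/-- The cycles of `p` that avoid `E`. -/
noncomputable def cyclesAvoiding (p : V → V) (E : Finset V) : Finset (Finset V) :=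
  Finset.univ.filter fun O => IsCycleOf p O ∧ Disjoint O E

theorem mem_cyclesAvoiding {p : V → V} {E O : Finset V} :
    O ∈ cyclesAvoiding p E ↔ IsCycleOf p O ∧ Disjoint O E := by
  simp [cyclesAvoiding]

/-- Cycles disjoint from `F` are not affected by changes of the map on `F`; completed cycles
therefore persist while the involution is being revealed. -/
theorem cyclesAvoiding_subset {p p' : V → V} {E F E' : Finset V} (hE : E' ⊆ E ∪ F)
    (hp : ∀ x, x ∉ F → p x = p' x) : cyclesAvoiding p (E ∪ F) ⊆ cyclesAvoiding p' E' := by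
  intro O hO
  rw [mem_cyclesAvoiding] at hO ⊢
  refine ⟨hO.1.congr fun x hx => hp x fun h => ?_, hO.2.mono_right hE⟩
  exact Finset.disjoint_left.1 hO.2 hx (Finset.mem_union_right _ h)

/-- The segment of `β` from `v` (excluded) to the first return `β ^ j v` to `S` avoids `E`. -/
def GoodReturn (β : Equiv.Perm V) (E S : Finset V) (v : V) (j : ℕ) : Prop :=
  1 ≤ j ∧ (β ^ j) v ∈ S ∧ (∀ i, 1 ≤ i → i < j → (β ^ i) v ∉ S) ∧
    ∀ i, 1 ≤ i → i ≤ j → (β ^ i) v ∉ E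

open Classical in
-- A bad `v` has its segment hit `E` no later than the first return to `S`. Walking back from that
-- hit, `v` is the first element of `S` encountered, so distinct bad points have distinct hits.
theorem card_bad_le (β : Equiv.Perm V) (E S : Finset V) :
    (S.filter fun v => ¬ ∃ j, GoodReturn β E S v j).card ≤ E.card := by
  have key : ∀ v ∈ S.filter (fun v => ¬ ∃ j, GoodReturn β E S v j), ∃ i, 1 ≤ i ∧ (β ^ i) v ∈ E ∧
      ∀ i', 1 ≤ i' → i' < i → (β ^ i') v ∉ S := by
    intro v hv
    rw [Finset.mem_filter] at hv
    have hex : ∃ j, 1 ≤ j ∧ (β ^ j) v ∈ S :=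
      ⟨orderOf β, orderOf_pos β, by rw [pow_orderOf_eq_one]; exact hv.1⟩
    obtain ⟨h1, h2⟩ := Nat.find_spec hex
    by_contra hc
    push Not at hc
    refine hv.2 ⟨Nat.find hex, h1, h2, fun i hi hij hS => Nat.find_min hex hij ⟨hi, hS⟩,
      fun i hi hij hE => ?_⟩
    obtain ⟨i', h3, h4, h5⟩ := hc i hi hE
    exact Nat.find_min hex (h4.trans_le hij) ⟨h3, h5⟩
  choose! i hi1 hi2 hi3 using key
  have aux : ∀ v ∈ S.filter (fun v => ¬ ∃ j, GoodReturn β E S v j),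
      ∀ w ∈ S.filter (fun v => ¬ ∃ j, GoodReturn β E S v j), i v ≤ i w →
      (β ^ i v) v = (β ^ i w) w → v = w := by
    intro v hv w hw hle h
    have e : (β ^ (i w - i v)) w = v := by
      apply (β ^ i v).injective
      rw [← Equiv.Perm.mul_apply, ← pow_add, Nat.add_sub_cancel' hle, h]
    rcases hle.eq_or_lt with h0 | h0
    · rw [h0, Nat.sub_self] at e
      exact e.symm
    · exact absurd (e ▸ (Finset.mem_filter.1 hv).1)
        (hi3 w hw _ (by omega) (by have := hi1 v hv; omega))
  refine Finset.card_le_card_of_injOn (fun v => (β ^ i v) v) (fun v hv => hi2 v hv) ?_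
  intro v hv w hw h
  rcases le_total (i v) (i w) with hle | hle
  · exact aux v hv w hw hle h
  · exact (aux w hw v hv hle h.symm).symm

/-- The cycle through `w` lies in `M` and becomes admissible once `v` and `w` leave `S`. It was not
counted before because it meets `S`, and the earlier cycles survive. -/
theorem card_lt_of_closed {β : Equiv.Perm V} {E S : Finset V} {v w : V} (hv : v ∈ S) (hw : w ∈ S)
    {M : Set V} (hwM : w ∈ M) (hM : ∀ x ∈ M, (β * Equiv.swap v w) x ∈ M)
    (hE : ∀ x ∈ M, x ∉ E) (hS : ∀ x ∈ M, x ∈ S → x = v ∨ x = w) :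
    (cyclesAvoiding β (E ∪ S)).card + 1 ≤
      (cyclesAvoiding (β * Equiv.swap v w) (E ∪ S \ {v, w})).card := by
  obtain ⟨O, hO, hwO, hOM⟩ := exists_isCycleOf (β * Equiv.swap v w).injective w
  have hOM := hOM M hwM hM
  have hn : O ∉ cyclesAvoiding β (E ∪ S) := fun h =>
    Finset.disjoint_left.1 (mem_cyclesAvoiding.1 h).2 hwO (Finset.mem_union_right _ hw)
  rw [← Finset.card_insert_of_notMem hn]
  refine Finset.card_le_card (Finset.insert_subset ?_ (cyclesAvoiding_subset ?_ ?_))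
  · refine mem_cyclesAvoiding.2 ⟨hO, Finset.disjoint_left.2 fun x hx h => ?_⟩
    rcases Finset.mem_union.1 h with h | h
    · exact hE x (hOM x hx) h
    · rw [Finset.mem_sdiff, Finset.mem_insert, Finset.mem_singleton] at h
      exact h.2 (hS x (hOM x hx) h.1)
  · exact Finset.union_subset_union_right Finset.sdiff_subset
  · intro x hx
    rw [Equiv.Perm.mul_apply, Equiv.swap_apply_of_ne_of_ne]
    · rintro rfl; exact hx hv
    · rintro rfl; exact hx hw

/-- Among the ways of joining elements of `S`, one closes a cycle that avoids `E`. -/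
theorem exists_closing_pair (β : Equiv.Perm V) {E S : Finset V} (h : E.card + 2 ≤ S.card) :
    ∃ v ∈ S, ∃ w ∈ S, v ≠ w ∧ (cyclesAvoiding β (E ∪ S)).card + 1 ≤
      (cyclesAvoiding (β * Equiv.swap v w) (E ∪ S \ {v, w})).card := by
  classical
  have one : ∀ v ∈ S, ∀ j, GoodReturn β E S v j → (β ^ j) v ≠ v →
      ∃ v ∈ S, ∃ w ∈ S, v ≠ w ∧ (cyclesAvoiding β (E ∪ S)).card + 1 ≤
        (cyclesAvoiding (β * Equiv.swap v w) (E ∪ S \ {v, w})).card := by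
    rintro v hv j ⟨h1, h2, h3, h4⟩ hne
    refine ⟨v, hv, (β ^ j) v, h2, hne.symm, card_lt_of_closed hv h2
      (M := {x | ∃ i, 1 ≤ i ∧ i ≤ j ∧ (β ^ i) v = x}) ⟨j, h1, le_rfl, rfl⟩ ?_ ?_ ?_⟩
    · rintro _ ⟨i, hi1, hi2, rfl⟩
      rcases hi2.eq_or_lt with rfl | hi2
      · exact ⟨1, le_rfl, h1, by rw [Equiv.Perm.mul_apply, Equiv.swap_apply_right, pow_one]⟩
      · refine ⟨i + 1, by omega, hi2, ?_⟩
        rw [Equiv.Perm.mul_apply, Equiv.swap_apply_of_ne_of_ne, pow_succ', Equiv.Perm.mul_apply]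
        · exact fun h => h3 i hi1 hi2 (by rw [h]; exact hv)
        · exact fun h => h3 i hi1 hi2 (by rw [h]; exact h2)
    · rintro _ ⟨i, hi1, hi2, rfl⟩
      exact h4 i hi1 hi2
    · rintro _ ⟨i, hi1, hi2, rfl⟩ hS
      rcases hi2.eq_or_lt with rfl | hi2
      · exact Or.inr rfl
      · exact absurd hS (h3 i hi1 hi2)
  -- If a good segment ends at a point other than its start, joining its two ends closes a cycle. A
  -- good segment may also return to its start; two such segments are joined into one cycle, which
  -- is why two good points are needed.
  have hcard : 2 ≤ (S.filter fun v => ∃ j, GoodReturn β E S v j).card := by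
    have h1 := card_bad_le β E S
    have h2 := Finset.card_filter_add_card_filter_not (s := S)
      (fun v => ∃ j, GoodReturn β E S v j)
    omega
  obtain ⟨v, hv, w, hw, hvw⟩ := Finset.one_lt_card.1 hcard
  rw [Finset.mem_filter] at hv hw
  obtain ⟨hv, j, hj⟩ := hv
  obtain ⟨hw, k, hk⟩ := hw
  by_cases hjv : (β ^ j) v = v
  swap
  · exact one v hv j hj hjv
  by_cases hkw : (β ^ k) w = w
  swap
  · exact one w hw k hk hkw
  obtain ⟨h1, h2, h3, h4⟩ := hj
  obtain ⟨h1', h2', h3', h4'⟩ := hk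
  refine ⟨v, hv, w, hw, hvw, card_lt_of_closed hv hw
    (M := {x | (∃ i, 1 ≤ i ∧ i ≤ j ∧ (β ^ i) v = x) ∨ ∃ i, 1 ≤ i ∧ i ≤ k ∧ (β ^ i) w = x})
    (Or.inr ⟨k, h1', le_rfl, hkw⟩) ?_ ?_ ?_⟩
  · rintro _ (⟨i, hi1, hi2, rfl⟩ | ⟨i, hi1, hi2, rfl⟩)
    · rcases hi2.eq_or_lt with rfl | hi2
      · exact Or.inr ⟨1, le_rfl, h1', by
          rw [Equiv.Perm.mul_apply, hjv, Equiv.swap_apply_left, pow_one]⟩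
      · refine Or.inl ⟨i + 1, by omega, hi2, ?_⟩
        rw [Equiv.Perm.mul_apply, Equiv.swap_apply_of_ne_of_ne, pow_succ', Equiv.Perm.mul_apply]
        · exact fun h => h3 i hi1 hi2 (by rw [h]; exact hv)
        · exact fun h => h3 i hi1 hi2 (by rw [h]; exact hw)
    · rcases hi2.eq_or_lt with rfl | hi2
      · exact Or.inl ⟨1, le_rfl, h1, by
          rw [Equiv.Perm.mul_apply, hkw, Equiv.swap_apply_right, pow_one]⟩
      · refine Or.inr ⟨i + 1, by omega, hi2, ?_⟩
        rw [Equiv.Perm.mul_apply, Equiv.swap_apply_of_ne_of_ne, pow_succ', Equiv.Perm.mul_apply]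
        · exact fun h => h3' i hi1 hi2 (by rw [h]; exact hv)
        · exact fun h => h3' i hi1 hi2 (by rw [h]; exact hw)
  · rintro _ (⟨i, hi1, hi2, rfl⟩ | ⟨i, hi1, hi2, rfl⟩)
    · exact h4 i hi1 hi2
    · exact h4' i hi1 hi2
  · rintro _ (⟨i, hi1, hi2, rfl⟩ | ⟨i, hi1, hi2, rfl⟩) hS
    · rcases hi2.eq_or_lt with rfl | hi2
      · exact Or.inl hjv
      · exact absurd hS (h3 i hi1 hi2)
    · rcases hi2.eq_or_lt with rfl | hi2
      · exact Or.inr hkw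
      · exact absurd hS (h3' i hi1 hi2)

/-- The number of cycles of `β ∘ f` that avoid `E`, for a random involution `f` of `S`, is rarely
small. -/
theorem sum_pow_card_cycles_le {E : Finset V} {s : ℝ} (hs0 : 0 < s) (hs1 : s ≤ 1) {K : ℕ}
    (hK : E.card + 1 ≤ K) {c : ℕ → ℝ} (hc0 : ∀ u, 0 ≤ c u)
    (hc1 : ∀ u, u ≤ K → (invol u : ℝ) ≤ c u)
    (hc2 : ∀ u, K < u → c (u - 1) + (u - 2 + s) * c (u - 2) ≤ c u) (β : Equiv.Perm V)
    (S : Finset V) :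
    ∑ f ∈ mapsOn IsInvolutive S, s ^ (cyclesAvoiding (fun x => β (f x).1) E).card ≤
      c S.card * s ^ (cyclesAvoiding β (E ∪ S)).card := by
  induction hn : S.card using Nat.strong_induction_on generalizing S β with
  | _ n ih =>
    by_cases hnK : n ≤ K
    · calc _ ≤ ∑ f ∈ mapsOn IsInvolutive S, s ^ (cyclesAvoiding β (E ∪ S)).card := by
            refine Finset.sum_le_sum fun f hf => pow_le_pow_of_le_one hs0.le hs1 ?_
            refine Finset.card_le_card (cyclesAvoiding_subset Finset.subset_union_left fun x hx => ?_)
            rw [(mem_mapsOn.1 hf).2 x hx]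
        _ = invol n * s ^ (cyclesAvoiding β (E ∪ S)).card := by
            rw [Finset.sum_const, card_involutions, hn, nsmul_eq_mul]
        _ ≤ _ := mul_le_mul_of_nonneg_right (hc1 n hnK) (by positivity)
    · push Not at hnK
      -- Once `n` exceeds `K`, it is at least `|E| + 2`, so a closing pair exists.
      obtain ⟨v, hv, w, hw, hvw, hlt⟩ := exists_closing_pair β (E := E) (S := S) (by omega)
      set N := (cyclesAvoiding β (E ∪ S)).card with hN
      -- The revealed transposition is absorbed into `β`, which puts the remaining sum in the form
      -- of the induction hypothesis.
      have step : ∀ z ∈ S, (∑ g ∈ mapsOn IsInvolutive (S \ {v, z}),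
          s ^ (cyclesAvoiding (fun x => β (glue {v, z} (swapMap v z) g x).1) E).card) ≤
          c (S \ {v, z}).card *
            s ^ (cyclesAvoiding (β * Equiv.swap v z) (E ∪ S \ {v, z})).card := by
        intro z hz
        have hlt' : (S \ {v, z}).card < n := by
          rw [← hn]
          refine Finset.card_lt_card ⟨Finset.sdiff_subset, fun h => ?_⟩
          have := h hv
          simp at this
        refine le_trans (le_of_eq ?_) (ih _ hlt' (β * Equiv.swap v z) _ rfl)
        refine Finset.sum_congr rfl fun g hg => ?_
        congr 3
        funext x
        rw [Equiv.Perm.mul_apply]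
        by_cases hx : x ∈ ({v, z} : Finset V)
        · rw [glue_of_mem hx, (mem_mapsOn.1 hg).2 x fun h => (Finset.mem_sdiff.1 h).2 hx]
          rfl
        · rw [glue_of_notMem hx, Equiv.swap_apply_of_ne_of_ne]
          · intro h
            have := mapsTo_compl (isLocal_isInvolutive.inj (mem_mapsOn.1 hg).1)
              (C := (({v, z} : Finset V) : Set V)) (fun y hy => by
                rw [(mem_mapsOn.1 hg).2 y fun h => (Finset.mem_sdiff.1 h).2 hy]; exact hy) x hx
            exact this (by simp [h])
          · intro h
            have := mapsTo_compl (isLocal_isInvolutive.inj (mem_mapsOn.1 hg).1)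
              (C := (({v, z} : Finset V) : Set V)) (fun y hy => by
                rw [(mem_mapsOn.1 hg).2 y fun h => (Finset.mem_sdiff.1 h).2 hy]; exact hy) x hx
            exact this (by simp [h])
      have mono : ∀ z ∈ S, N ≤ (cyclesAvoiding (β * Equiv.swap v z) (E ∪ S \ {v, z})).card := by
        intro z hz
        refine Finset.card_le_card (cyclesAvoiding_subset
          (Finset.union_subset_union_right Finset.sdiff_subset) fun x hx => ?_)
        rw [Equiv.Perm.mul_apply, Equiv.swap_apply_of_ne_of_ne]
        · rintro rfl; exact hx hv
        · rintro rfl; exact hx hz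
      have bound : ∀ z ∈ S, ∀ j, j ≤ (cyclesAvoiding (β * Equiv.swap v z)
          (E ∪ S \ {v, z})).card → (∑ g ∈ mapsOn IsInvolutive (S \ {v, z}),
          s ^ (cyclesAvoiding (fun x => β (glue {v, z} (swapMap v z) g x).1) E).card) ≤
          c (S \ {v, z}).card * s ^ j := fun z hz j hj =>
        (step z hz).trans (mul_le_mul_of_nonneg_left (pow_le_pow_of_le_one hs0.le hs1 hj) (hc0 _))
      have hwS : w ∈ S.erase v := Finset.mem_erase.2 ⟨hvw.symm, hw⟩
      -- Three contributions arise: `v` is fixed, `v` is paired with `w` and gains a factor `s`, or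
      -- `v` is paired with one of the other `n - 2` points. They match the three terms in `hc2`.
      rw [sum_involutions hv, ← Finset.add_sum_erase _ _ hv, ← Finset.add_sum_erase _ _ hwS]
      have b1 := bound v hv N (mono v hv)
      rw [Finset.pair_eq_singleton, Finset.sdiff_singleton_eq_erase, Finset.card_erase_of_mem hv,
        hn] at b1
      have b2 := bound w hw (N + 1) hlt
      rw [card_sdiff_pair hv hw hvw, hn] at b2
      have b3 : (∑ z ∈ (S.erase v).erase w, ∑ g ∈ mapsOn IsInvolutive (S \ {v, z}),
          s ^ (cyclesAvoiding (fun x => β (glue {v, z} (swapMap v z) g x).1) E).card) ≤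
          ((n : ℝ) - 2) * (c (n - 2) * s ^ N) := by
        calc _ ≤ ∑ z ∈ (S.erase v).erase w, c (n - 2) * s ^ N := by
              refine Finset.sum_le_sum fun z hz => ?_
              simp only [Finset.mem_erase] at hz
              have := bound z hz.2.2 N (mono z hz.2.2)
              rwa [card_sdiff_pair hv hz.2.2 hz.2.1.symm, hn] at this
          _ = _ := by
              rw [Finset.sum_const, Finset.card_erase_of_mem hwS, Finset.card_erase_of_mem hv, hn,
                nsmul_eq_mul, Nat.sub_sub, Nat.cast_sub (by omega)]
              norm_num
      calc _ ≤ c (n - 1) * s ^ N + (c (n - 2) * s ^ (N + 1) +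
            ((n : ℝ) - 2) * (c (n - 2) * s ^ N)) := by
            refine add_le_add ?_ (add_le_add b2 b3)
            rw [Finset.pair_eq_singleton, Finset.sdiff_singleton_eq_erase]
            exact b1
        _ = (c (n - 1) + (n - 2 + s) * c (n - 2)) * s ^ N := by ring
        _ ≤ _ := mul_le_mul_of_nonneg_right (hc2 n hnK) (by positivity)

end Cycles

end ModularSubgroup

namespace ModularSubgroup

/-! ### Asymptotic estimates -/

open Filter Topology

/-! ### Growth of the number of involutions -/

theorem invol_pos (n : ℕ) : 0 < invol n := by
  induction n using Nat.strong_induction_on with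
  | _ n ih =>
    match n with
    | 0 => simp [invol]
    | 1 => simp [invol]
    | n + 2 => exact Nat.add_pos_left (ih (n + 1) (by omega)) _

theorem tern_pos (n : ℕ) : 0 < tern n := by
  induction n using Nat.strong_induction_on with
  | _ n ih =>
    match n with
    | 0 => simp [tern]
    | 1 => simp [tern]
    | 2 => simp [tern]
    | n + 3 => exact Nat.add_pos_left (Nat.add_pos_left (ih (n + 2) (by omega)) _) _

/-- The next ratio is `1 + (m + 1)/ρ`, where `ρ` is the current one. Hence the upper bound at one
step gives the lower bound at the next, and conversely. -/
theorem invol_ratio (m : ℕ) : √(m + 1 : ℝ) * invol m ≤ invol (m + 1) ∧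
    (invol (m + 1) : ℝ) ≤ (√(m + 1 : ℝ) + 1) * invol m := by
  induction m with
  | zero => norm_num [invol]
  | succ m ih =>
    obtain ⟨h1, h2⟩ := ih
    have e : (invol (m + 2) : ℝ) = invol (m + 1) + (m + 1) * invol m := by
      rw [invol]; push_cast; ring
    push_cast
    rw [e]
    have hr : √(m + 1 : ℝ) ^ 2 = m + 1 := Real.sq_sqrt (by positivity)
    have hr' : √(m + 1 + 1 : ℝ) ^ 2 = m + 1 + 1 := Real.sq_sqrt (by positivity)
    have hle : √(m + 1 : ℝ) ≤ √(m + 1 + 1 : ℝ) := Real.sqrt_le_sqrt (by linarith)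
    have h0 : 0 ≤ √(m + 1 : ℝ) := Real.sqrt_nonneg _
    have hr1 : 1 ≤ √(m + 1 + 1 : ℝ) := Real.one_le_sqrt.2 (by
      have : (0 : ℝ) ≤ m := Nat.cast_nonneg m
      linarith)
    set r := √(m + 1 : ℝ)
    set r' := √(m + 1 + 1 : ℝ)
    have hy : (0 : ℝ) < invol m := Nat.cast_pos.2 (invol_pos m)
    have hx : (0 : ℝ) < invol (m + 1) := Nat.cast_pos.2 (invol_pos _)
    set x : ℝ := (invol (m + 1) : ℝ)
    set y : ℝ := (invol m : ℝ)
    constructor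
    · have : (r' - 1) * x ≤ (r' - 1) * ((r + 1) * y) :=
        mul_le_mul_of_nonneg_left h2 (by linarith)
      have h3 : (r' - 1) * (r + 1) ≤ (r' - 1) * (r' + 1) :=
        mul_le_mul_of_nonneg_left (by linarith) (by linarith)
      have h4 : (r' - 1) * (r + 1) * y ≤ (r' - 1) * (r' + 1) * y :=
        mul_le_mul_of_nonneg_right h3 hy.le
      have h5 : (r' - 1) * (r' + 1) * y = (m + 1) * y := by
        rw [show (r' - 1) * (r' + 1) = r' ^ 2 - 1 by ring, hr']; ring
      linarith
    · have h3 : r * (r * y) ≤ r * x := mul_le_mul_of_nonneg_left h1 h0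
      have h4 : r * x ≤ r' * x := mul_le_mul_of_nonneg_right hle hx.le
      have h5 : r * (r * y) = (m + 1) * y := by rw [← mul_assoc, ← sq, hr]
      linarith

/-- The recursive inequality that controls the number of cycles. -/
theorem exists_invol_rpow_le {γ s : ℝ} (hγ0 : 0 < γ) (hγ1 : γ ≤ 1) (hs0 : 0 ≤ s)
    (hs : 2 * γ < 1 - s) : ∃ u₀ : ℕ, ∀ u, u₀ < u → ∀ A : ℝ, 0 ≤ A →
      invol (u - 1) * (A / ((u - 1 : ℕ) + 1)) ^ γ +
        (u - 2 + s) * (invol (u - 2) * (A / ((u - 2 : ℕ) + 1)) ^ γ) ≤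
          invol u * (A / (u + 1)) ^ γ := by
  -- By Bernoulli's inequality the coefficient of `invol m` leaves a slack of at least `1 - s - 2γ`.
  -- It has to absorb `γ · invol (m + 1) / (m + 2)`, which is about `invol m / √m`; this works once
  -- `(1 - s - 2γ) √(m + 1) ≥ 2`.
  obtain ⟨m₀, hm₀⟩ := exists_nat_gt (4 / (1 - s - 2 * γ) ^ 2)
  refine ⟨m₀ + 2, fun u hu A hA => ?_⟩
  obtain ⟨m, rfl⟩ : ∃ m, u = m + 2 := ⟨u - 2, by omega⟩
  have hm : m₀ < m := by omega
  rw [show m + 2 - 1 = m + 1 by omega, show m + 2 - 2 = m by omega]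
  obtain ⟨h1, h2⟩ := invol_ratio m
  have e : (invol (m + 2) : ℝ) = invol (m + 1) + (m + 1) * invol m := by
    rw [invol]; push_cast; ring
  rw [e]
  push_cast
  have hmr : (m₀ : ℝ) < m := Nat.cast_lt.2 hm
  have hm0 : (0 : ℝ) ≤ m := Nat.cast_nonneg m
  have hy : (0 : ℝ) < invol m := Nat.cast_pos.2 (invol_pos m)
  have hx : (0 : ℝ) < invol (m + 1) := Nat.cast_pos.2 (invol_pos _)
  have hb : ∀ a d : ℝ, 0 < a → 0 ≤ d →
      (A / a) ^ γ ≤ (1 + γ * (d / a)) * (A / (a + d)) ^ γ := by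
    intro a d ha hd
    have : A / a = (1 + d / a) * (A / (a + d)) := by
      field_simp
    rw [this, Real.mul_rpow (by positivity) (by positivity)]
    refine mul_le_mul_of_nonneg_right ?_ (by positivity)
    exact rpow_one_add_le_one_add_mul_self (by
      have : 0 ≤ d / a := by positivity
      linarith) hγ0.le hγ1
  have b1 := hb (m + 2) 1 (by positivity) zero_le_one
  have b2 := hb (m + 1) 2 (by positivity) zero_le_two
  rw [show (m : ℝ) + 2 + 1 = m + 3 by ring] at b1
  rw [show (m : ℝ) + 1 + 2 = m + 3 by ring] at b2
  rw [show (m : ℝ) + 1 + 1 = m + 2 by ring, show (m : ℝ) + 2 + 1 = m + 3 by ring,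
    show (m : ℝ) + 2 - 2 = m by ring]
  have hP : 0 ≤ (A / ((m : ℝ) + 3)) ^ γ := by positivity
  set P := (A / ((m : ℝ) + 3)) ^ γ
  set x : ℝ := (invol (m + 1) : ℝ)
  set y : ℝ := (invol m : ℝ)
  have key : x * (1 + γ * (1 / (m + 2))) + (m + s) * (y * (1 + γ * (2 / (m + 1)))) ≤
      x + (m + 1) * y := by
    have hs1 : s < 1 := by linarith
    have h3 : (m + s) * (2 / (m + 1)) ≤ 2 := by
      rw [mul_div_assoc', div_le_iff₀ (by positivity)]; linarith
    have hr : √(m + 1 : ℝ) ^ 2 = m + 1 := Real.sq_sqrt (by positivity)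
    have hr1 : 1 ≤ √(m + 1 : ℝ) := Real.one_le_sqrt.2 (by linarith)
    have hε : 2 ≤ (1 - s - 2 * γ) * √(m + 1 : ℝ) := by
      have hε0 : 0 < 1 - s - 2 * γ := by linarith
      have : 4 < (m + 1) * (1 - s - 2 * γ) ^ 2 := by
        rw [div_lt_iff₀ (by positivity)] at hm₀
        nlinarith [sq_nonneg (1 - s - 2 * γ)]
      nlinarith [mul_pos hε0 (zero_lt_one.trans_le hr1)]
    set r := √(m + 1 : ℝ)
    have h4 : x * (1 / (m + 2)) ≤ (1 - s - 2 * γ) * y := by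
      rw [mul_one_div, div_le_iff₀ (by positivity)]
      have : (r + 1) * y ≤ (2 * r) * y := mul_le_mul_of_nonneg_right (by linarith) hy.le
      have h5 : 2 * r * y ≤ ((1 - s - 2 * γ) * r) * r * y := by
        refine mul_le_mul_of_nonneg_right (mul_le_mul_of_nonneg_right hε (by linarith)) hy.le
      have h6 : ((1 - s - 2 * γ) * r) * r * y = (1 - s - 2 * γ) * y * (m + 1) := by
        rw [← hr]; ring
      have h7 : 0 ≤ (1 - s - 2 * γ) * y := by
        refine mul_nonneg (by linarith) hy.le
      linarith
    have h5 : γ * (x * (1 / (m + 2))) ≤ (1 - s - 2 * γ) * y := by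
      have : 0 ≤ x * (1 / (m + 2)) := by positivity
      nlinarith
    have h6 : γ * y * ((m + s) * (2 / (m + 1))) ≤ γ * y * 2 :=
      mul_le_mul_of_nonneg_left h3 (by positivity)
    linarith
  calc _ ≤ x * ((1 + γ * (1 / (m + 2))) * P) + (m + s) * (y * ((1 + γ * (2 / (m + 1))) * P)) := by
        gcongr
    _ = (x * (1 + γ * (1 / (m + 2))) + (m + s) * (y * (1 + γ * (2 / (m + 1))))) * P := by ring
    _ ≤ _ := mul_le_mul_of_nonneg_right key hP

/-! #### The growth of `tern` -/

theorem descFactorial_add_one (x n : ℕ) : (x + 1).descFactorial (n + 1) =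
    x.descFactorial (n + 1) + (n + 1) * x.descFactorial n := by
  rw [Nat.succ_descFactorial_succ, Nat.descFactorial_succ]
  rcases le_or_gt n x with h | h
  · rw [← add_mul]; congr 1; omega
  · rw [Nat.descFactorial_eq_zero_iff_lt.2 h]; simp

theorem descFactorial_add_two (x n : ℕ) : (x + 2).descFactorial n =
    x.descFactorial n + 2 * n * x.descFactorial (n - 1) +
      n * (n - 1) * x.descFactorial (n - 2) := by
  match n with
  | 0 => simp
  | 1 => simp
  | n + 2 =>
    rw [show x + 2 = x + 1 + 1 by ring, descFactorial_add_one, descFactorial_add_one,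
      descFactorial_add_one]
    simp only [Nat.add_sub_cancel, show n + 2 - 1 = n + 1 by omega]
    ring

/-- A formula of Dobiński type. -/
theorem hasSum_tern (n : ℕ) :
    HasSum (fun m : ℕ => ((3 * m).descFactorial n : ℝ) * ((1 / 3) ^ m / m.factorial))
      (tern n * Real.exp (1 / 3)) := by
  induction n using Nat.strong_induction_on with
  | _ n ih =>
    match n with
    | 0 =>
      have := NormedSpace.expSeries_div_hasSum_exp (𝔸 := ℝ) (1 / 3)
      rw [← Real.exp_eq_exp_ℝ] at this
      simpa [tern] using this
    | n + 1 =>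
      have h0 := ih n (by omega)
      have h1 := ih (n - 1) (by omega)
      have h2 := ih (n - 2) (by omega)
      -- The term `m = 0` of the series for `n + 1` vanishes. After a shift, the factor `3(m + 1)`
      -- of the falling factorial of `3(m + 1)` cancels against the weights and leaves that of `3m +
      -- 2`, which expands into the three series combined here.
      have h := (h0.add (h1.mul_left (2 * n : ℝ))).add (h2.mul_left ((n * (n - 1 : ℕ) : ℕ) : ℝ))
      have e : (tern n * Real.exp (1 / 3) + 2 * n * (tern (n - 1) * Real.exp (1 / 3)) +
          ((n * (n - 1 : ℕ) : ℕ) : ℝ) * (tern (n - 2) * Real.exp (1 / 3))) =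
          tern (n + 1) * Real.exp (1 / 3) := by
        rw [tern_rec (n := n + 1) (by omega)]
        simp only [Nat.add_sub_cancel, show n + 1 - 2 = n - 1 by omega,
          show n + 1 - 3 = n - 2 by omega]
        push_cast
        ring
      rw [e] at h
      rw [← hasSum_nat_add_iff' 1]
      simp only [Finset.sum_range_one, mul_zero, Nat.zero_descFactorial_succ, Nat.cast_zero,
        zero_mul, sub_zero]
      convert! h using 1
      funext m
      rw [show 3 * (m + 1) = 3 * m + 2 + 1 by ring, Nat.succ_descFactorial_succ,
        descFactorial_add_two, Nat.factorial_succ, pow_succ]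
      push_cast
      field_simp
      ring

/-- With `X = 3m` and falling factorials `(X)_n`, this is the non-negativity of the variance of `X -
n` under the weights of `hasSum_tern` times `(X)_n`. The mean is `c`, and the second moment is
computed from `(X)_{n+2} + (X)_{n+1} = (X - n)² (X)_n`. -/
theorem tern_sq_le (n : ℕ) :
    (tern (n + 1) : ℝ) ^ 2 ≤ tern n * (tern (n + 2) + tern (n + 1)) := by
  have hpos : (0 : ℝ) < tern n := Nat.cast_pos.2 (tern_pos n)
  set c : ℝ := tern (n + 1) / tern n with hc
  have h := (((hasSum_tern (n + 2)).add (hasSum_tern (n + 1))).sub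
    ((hasSum_tern (n + 1)).mul_left (2 * c))).add ((hasSum_tern n).mul_left (c ^ 2))
  have h0 := h.nonneg (fun m => by
    have hw : (0 : ℝ) ≤ (1 / 3) ^ m / m.factorial := by positivity
    set w : ℝ := (1 / 3) ^ m / m.factorial
    rw [← add_mul, ← mul_assoc, ← sub_mul, ← mul_assoc, ← add_mul]
    refine mul_nonneg ?_ hw
    rcases le_or_gt n (3 * m) with hn | hn
    · have e1 : ((3 * m).descFactorial (n + 1) : ℝ) =
          ((3 * m : ℕ) - n : ℝ) * (3 * m).descFactorial n := by
        rw [Nat.descFactorial_succ, Nat.cast_mul, Nat.cast_sub hn]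
      have e2 : ((3 * m).descFactorial (n + 2) : ℝ) =
          ((3 * m : ℕ) - n - 1 : ℝ) * (((3 * m : ℕ) - n : ℝ) * (3 * m).descFactorial n) := by
        rw [← e1, Nat.descFactorial_succ, Nat.cast_mul]
        rcases hn.eq_or_lt with hn | hn
        · rw [Nat.descFactorial_eq_zero_iff_lt.2 (show 3 * m < n + 1 by omega)]; simp
        · rw [Nat.cast_sub (show n + 1 ≤ 3 * m by omega)]; push_cast; ring
      rw [e1, e2]
      have : (0 : ℝ) ≤ (3 * m).descFactorial n := Nat.cast_nonneg _
      nlinarith [mul_nonneg this (sq_nonneg (((3 * m : ℕ) : ℝ) - n - c))]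
    · rw [Nat.descFactorial_eq_zero_iff_lt.2 hn,
        Nat.descFactorial_eq_zero_iff_lt.2 (show 3 * m < n + 1 by omega),
        Nat.descFactorial_eq_zero_iff_lt.2 (show 3 * m < n + 2 by omega)]
      simp)
  have hZ := Real.exp_pos (1 / 3 : ℝ)
  have h1 : 0 ≤ (tern (n + 2) + tern (n + 1) - 2 * c * tern (n + 1) + c ^ 2 * tern n : ℝ) := by
    refine nonneg_of_mul_nonneg_left (b := Real.exp (1 / 3)) ?_ hZ
    linarith
  have h2 : c * tern n = tern (n + 1) := by rw [hc]; field_simp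
  have h3 := mul_nonneg h1 hpos.le
  have h4 : (tern (n + 2) + tern (n + 1) - 2 * c * tern (n + 1) + c ^ 2 * tern n : ℝ) * tern n =
      tern n * (tern (n + 2) + tern (n + 1)) - 2 * (c * tern n) * tern (n + 1) +
        (c * tern n) ^ 2 := by ring
  rw [h4, h2] at h3
  linarith

/-- The quotients of consecutive values of `tern`. -/
noncomputable def ternRatio (n : ℕ) : ℝ := tern (n + 1) / tern n

theorem ternRatio_mul (n : ℕ) : ternRatio n * tern n = tern (n + 1) := by
  have hpos : (0 : ℝ) < tern n := Nat.cast_pos.2 (tern_pos n)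
  rw [ternRatio]; field_simp

theorem one_le_ternRatio (n : ℕ) : 1 ≤ ternRatio n := by
  rw [ternRatio, one_le_div (Nat.cast_pos.2 (tern_pos n)), tern_rec (n := n + 1) (by omega),
    Nat.add_sub_cancel, add_assoc]
  exact Nat.cast_le.2 (Nat.le_add_right _ _)

theorem ternRatio_le_succ (n : ℕ) : ternRatio n ≤ ternRatio (n + 1) + 1 := by
  have h0 : (0 : ℝ) < tern n := Nat.cast_pos.2 (tern_pos n)
  have h1 : (0 : ℝ) < tern (n + 1) := Nat.cast_pos.2 (tern_pos _)
  have := tern_sq_le n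
  rw [ternRatio, ternRatio, div_add_one h1.ne', div_le_div_iff₀ h0 h1]
  linarith

theorem ternRatio_rec (n : ℕ) : ternRatio (n + 2) * ternRatio (n + 1) * ternRatio n =
    ternRatio (n + 1) * ternRatio n + 2 * (n + 2) * ternRatio n + (n + 2) * (n + 1) := by
  have h0 : (0 : ℝ) < tern n := Nat.cast_pos.2 (tern_pos n)
  have e : (tern (n + 3) : ℝ) = tern (n + 2) + 2 * (n + 2) * tern (n + 1) +
      (n + 2) * (n + 1) * tern n := by
    rw [tern]; push_cast; ring
  refine mul_right_cancel₀ h0.ne' ?_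
  have e1 := ternRatio_mul n
  have e2 := ternRatio_mul (n + 1)
  have e3 := ternRatio_mul (n + 2)
  calc _ = ternRatio (n + 2) * (ternRatio (n + 1) * (ternRatio n * tern n)) := by ring
    _ = tern (n + 3) := by rw [e1, e2, e3]
    _ = ternRatio (n + 1) * (ternRatio n * tern n) + 2 * (n + 2) * (ternRatio n * tern n) +
        (n + 2) * (n + 1) * tern n := by rw [e1, e2, e]
    _ = _ := by ring

/-- By near-monotonicity the two preceding ratios exceed the last ratio `y` by at most `1` and `2`.
The product of the three is thus at most `y(y + 1)(y + 2)`, while the recursion bounds it below by a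
quadratic in `n`. -/
theorem sq_le_ternRatio (n : ℕ) : (n : ℝ) ^ 2 ≤ (ternRatio n + 1) ^ 3 := by
  match n with
  | 0 =>
    have := one_le_ternRatio 0
    have h : (0 : ℝ) ≤ (ternRatio 0 + 1) ^ 3 := pow_nonneg (by linarith) 3
    simpa using h
  | 1 =>
    have := one_le_ternRatio 1
    have h : (1 : ℝ) ≤ (ternRatio 1 + 1) ^ 3 := one_le_pow₀ (by linarith)
    simpa using h
  | n + 2 =>
    have h0 := one_le_ternRatio n
    have h1 := one_le_ternRatio (n + 1)
    have h2 := one_le_ternRatio (n + 2)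
    have h3 := ternRatio_le_succ n
    have h4 := ternRatio_le_succ (n + 1)
    have h5 := ternRatio_rec n
    rw [show n + 1 + 1 = n + 2 from rfl] at h4
    push_cast
    set y := ternRatio (n + 2)
    have h6 : y * ternRatio (n + 1) * ternRatio n ≤ y * (y + 1) * (y + 2) := by
      gcongr
      linarith
    have hn : (0 : ℝ) ≤ n := Nat.cast_nonneg n
    have h7 : 1 ≤ ternRatio (n + 1) * ternRatio n := one_le_mul_of_one_le_of_one_le h1 h0
    have h8 : 2 * ((n : ℝ) + 2) * 1 ≤ 2 * (n + 2) * ternRatio n := by gcongr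
    nlinarith

theorem ternRatio_lower {n : ℕ} {t : ℝ} (ht : 1 ≤ t) (h : t ^ 3 = n + 1) :
    t ^ 3 ≤ (t + 4) * ternRatio n := by
  have h1 := one_le_ternRatio n
  have h2 : t ^ 2 - 2 ≤ ternRatio n := by
    by_contra hc
    push Not at hc
    have h3 : (ternRatio n + 1) ^ 3 < (t ^ 2 - 1) ^ 3 :=
      pow_lt_pow_left₀ (by linarith) (by linarith) (by norm_num)
    have h4 := sq_le_ternRatio n
    have h5 : (n : ℝ) = t ^ 3 - 1 := by linarith
    rw [h5] at h4
    nlinarith [mul_nonneg (sub_nonneg.2 ht) (sub_nonneg.2 ht),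
      mul_nonneg (mul_nonneg (sub_nonneg.2 ht) (sub_nonneg.2 ht)) (sq_nonneg t)]
  -- For small `t` the trivial bound `1 ≤ ternRatio n` is enough, as `t³ ≤ t + 4`; beyond `7/4` one
  -- has `(t + 4)(t² - 2) ≥ t³`.
  rcases le_or_gt t (7 / 4) with h3 | h3
  · have : t ^ 3 ≤ t + 4 := by nlinarith [mul_nonneg (sub_nonneg.2 ht) (sub_nonneg.2 h3)]
    nlinarith
  · have : (t + 4) * (t ^ 2 - 2) ≤ (t + 4) * ternRatio n :=
      mul_le_mul_of_nonneg_left h2 (by linarith)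
    nlinarith

/-- If the ratio `y` were larger, the next two ratios would be at least `y - 1` and `y - 2`, and
their product with `y` would be too large for the recursion. -/
theorem ternRatio_upper {n : ℕ} {t : ℝ} (ht : 1 ≤ t) (h : t ^ 3 = n + 1) :
    ternRatio n ≤ t ^ 2 + 6 * t := by
  by_contra hc
  push Not at hc
  have h3 := ternRatio_le_succ n
  have h4 := ternRatio_le_succ (n + 1)
  have h5 := ternRatio_rec n
  rw [show n + 1 + 1 = n + 2 from rfl] at h4
  set y := ternRatio n
  have hy : 7 < y := by nlinarith
  have h6 : (y - 3) * (y - 1) * y ≤ (ternRatio (n + 2) - 1) * ternRatio (n + 1) * y := by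
    refine mul_le_mul_of_nonneg_right (mul_le_mul ?_ ?_ ?_ ?_) ?_ <;> linarith
  have h7 : (y - 3) * (y - 1) * y ≤ (t ^ 3 + 1) * (2 * y + t ^ 3) := by
    have : (n : ℝ) = t ^ 3 - 1 := by linarith
    rw [this] at h5
    nlinarith
  have h8 : t ^ 4 + 8 * t ^ 3 + 12 * t ^ 2 ≤ y * (y - 4) := by
    have : (t ^ 2 + 6 * t) * (t ^ 2 + 2 * t) ≤ y * (y - 4) :=
      mul_le_mul hc.le (by nlinarith) (by positivity) (by linarith)
    linarith
  have h9 : t ^ 4 + 6 * t ^ 3 ≤ y * (y - 4) - 2 * t ^ 3 - 2 := by nlinarith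
  have h10 : (t ^ 2 + 6 * t) * (t ^ 4 + 6 * t ^ 3) ≤ y * (y * (y - 4) - 2 * t ^ 3 - 2) :=
    mul_le_mul hc.le h9 (by positivity) (by linarith)
  have h11 : t ^ 3 ≤ t ^ 5 := pow_le_pow_right₀ ht (by norm_num)
  have h12 : 0 < t ^ 4 := by positivity
  nlinarith

end ModularSubgroup

namespace ModularSubgroup

open Filter Topology

/-! #### Products of the two counting sequences -/

/-- The number of pairs of an involution and a map counted by `tern`. -/
noncomputable def pairCount (n : ℕ) : ℝ := invol n * tern n

theorem pairCount_pos (n : ℕ) : 0 < pairCount n :=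
  mul_pos (Nat.cast_pos.2 (invol_pos n)) (Nat.cast_pos.2 (tern_pos n))

/-- The relative error in the estimate of the quotients of consecutive values of `pairCount`. -/
noncomputable def ratioError (n : ℕ) : ℝ := (1 + 6 / (n : ℝ) ^ (1 / 3 : ℝ)) ^ 2

theorem ratioError_pos (n : ℕ) : 0 < ratioError n := by
  have : 0 ≤ (n : ℝ) ^ (1 / 3 : ℝ) := by positivity
  rw [ratioError]; positivity

theorem ratioError_anti {m n : ℕ} (hm : 1 ≤ m) (h : m ≤ n) : ratioError n ≤ ratioError m := by
  have h1 : (0 : ℝ) < m := Nat.cast_pos.2 hm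
  have h2 : (m : ℝ) ≤ n := Nat.cast_le.2 h
  rw [ratioError, ratioError]
  gcongr

theorem tendsto_ratioError : Tendsto ratioError atTop (𝓝 1) := by
  have h : Tendsto (fun n : ℕ => (n : ℝ) ^ (1 / 3 : ℝ)) atTop atTop :=
    (tendsto_rpow_atTop (by norm_num)).comp tendsto_natCast_atTop_atTop
  have := ((tendsto_const_nhds (x := (6 : ℝ))).div_atTop h).const_add 1
  have h2 := this.pow 2
  rw [add_zero, one_pow] at h2
  exact h2

/-- The exponent is `7/6 = 1/2 + 2/3`, from involutions and from `tern`. With `t = (n + 1)^(1/3)`,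
each factor has relative error at most `1 + 6/t` from above; for the involutions this uses `t ≤ √(n
+ 1)`. -/
theorem pairCount_ratio (n : ℕ) :
    ((n + 1 : ℕ) : ℝ) ^ (7 / 6 : ℝ) * pairCount n ≤ ratioError (n + 1) * pairCount (n + 1) ∧
      pairCount (n + 1) ≤ ((n + 1 : ℕ) : ℝ) ^ (7 / 6 : ℝ) * ratioError (n + 1) * pairCount n := by
  have hn : (0 : ℝ) < ((n + 1 : ℕ) : ℝ) := by positivity
  have hn1 : (1 : ℝ) ≤ ((n + 1 : ℕ) : ℝ) := by
    rw [Nat.one_le_cast]; omega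
  set t : ℝ := ((n + 1 : ℕ) : ℝ) ^ (1 / 3 : ℝ) with ht
  have ht1 : 1 ≤ t := Real.one_le_rpow hn1 (by norm_num)
  have ht3 : t ^ 3 = ((n + 1 : ℕ) : ℝ) := by
    rw [ht, ← Real.rpow_natCast, ← Real.rpow_mul hn.le]; norm_num
  have hpow : ((n + 1 : ℕ) : ℝ) ^ (7 / 6 : ℝ) = √((n + 1 : ℕ) : ℝ) * t ^ 2 := by
    rw [ht, Real.sqrt_eq_rpow, ← Real.rpow_natCast, ← Real.rpow_mul hn.le, ← Real.rpow_add hn]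
    norm_num
  obtain ⟨i1, i2⟩ := invol_ratio n
  have hY1 := ternRatio_lower (n := n) ht1 (by rw [ht3]; push_cast; ring)
  have hY2 := ternRatio_upper (n := n) ht1 (by rw [ht3]; push_cast; ring)
  have hr : t ≤ √((n + 1 : ℕ) : ℝ) := by
    rw [← ht3]
    exact Real.le_sqrt_of_sq_le (pow_le_pow_right₀ ht1 (by norm_num))
  have hE : ratioError (n + 1) = (1 + 6 / t) ^ 2 := rfl
  have ht0 : 0 < t := zero_lt_one.trans_le ht1
  rw [show (n : ℝ) + 1 = ((n + 1 : ℕ) : ℝ) by push_cast; ring] at i1 i2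
  rw [hpow, hE, pairCount, pairCount, ← ternRatio_mul n]
  set r := √((n + 1 : ℕ) : ℝ)
  have hI : (0 : ℝ) < invol n := Nat.cast_pos.2 (invol_pos n)
  have hJ : (0 : ℝ) < tern n := Nat.cast_pos.2 (tern_pos n)
  have hY := one_le_ternRatio n
  set Y := ternRatio n
  set x : ℝ := (invol n : ℝ)
  set x' : ℝ := (invol (n + 1) : ℝ)
  set z : ℝ := (tern n : ℝ)
  have hrt : 0 < r := ht0.trans_le hr
  constructor
  · have h1 : t ^ 2 ≤ (1 + 6 / t) ^ 2 * Y := by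
      have h2 : t ^ 2 ≤ (1 + 4 / t) * Y := by
        rw [show (1 + 4 / t) * Y = ((t + 4) * Y) / t by field_simp, le_div_iff₀ ht0]
        linarith
      have h3 : 1 + 4 / t ≤ (1 + 6 / t) ^ 2 := by
        have : 0 < 1 / t := by positivity
        have e1 : 4 / t = 4 * (1 / t) := by ring
        have e2 : 6 / t = 6 * (1 / t) := by ring
        rw [e1, e2]
        nlinarith
      exact h2.trans (mul_le_mul_of_nonneg_right h3 (by linarith))
    calc r * t ^ 2 * (x * z) = t ^ 2 * ((r * x) * z) := by ring
      _ ≤ ((1 + 6 / t) ^ 2 * Y) * (x' * z) := by gcongr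
      _ = _ := by ring
  · have h1 : r + 1 ≤ r * (1 + 6 / t) := by
      have : 1 ≤ r / t := (one_le_div ht0).2 hr
      have e : r * (1 + 6 / t) = r + 6 * (r / t) := by ring
      linarith
    have h2 : Y ≤ t ^ 2 * (1 + 6 / t) := by
      have e : t ^ 2 * (1 + 6 / t) = t ^ 2 + 6 * t := by field_simp
      linarith
    calc x' * (Y * z) ≤ ((r + 1) * x) * ((t ^ 2 * (1 + 6 / t)) * z) := by gcongr
      _ ≤ ((r * (1 + 6 / t)) * x) * ((t ^ 2 * (1 + 6 / t)) * z) := by gcongr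
      _ = _ := by ring

/-- The accumulated relative error. -/
noncomputable def totalError (k : ℕ) : ℝ := ∏ j ∈ Finset.range k, ratioError (j + 1) ^ 2

theorem totalError_pos (k : ℕ) : 0 < totalError k :=
  Finset.prod_pos fun _ _ => pow_pos (ratioError_pos _) 2

/-- Raising `k` by one compares the growth at `k` with that at `m + k`, and the quotients `((m + k +
1)/(k + 1))^(7/6)` multiply up to a power of the binomial coefficient. Both errors of a step are
bounded by the one at `k + 1`, so the total error does not depend on `m`. -/
theorem pairCount_mul_le (m k : ℕ) : pairCount k * pairCount m *
    ((m + k).choose k : ℝ) ^ (7 / 6 : ℝ) ≤ totalError k * pairCount (m + k) := by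
  induction k with
  | zero => simp [totalError, pairCount, invol, tern]
  | succ k ih =>
    have h1 := (pairCount_ratio k).2
    have h2 := (pairCount_ratio (m + k)).1
    have hE := ratioError_anti (m := k + 1) (n := m + k + 1) (by omega) (by omega)
    have hc : ((m + (k + 1)).choose (k + 1) : ℝ) ^ (7 / 6 : ℝ) * ((k + 1 : ℕ) : ℝ) ^ (7 / 6 : ℝ) =
        ((m + k + 1 : ℕ) : ℝ) ^ (7 / 6 : ℝ) * ((m + k).choose k : ℝ) ^ (7 / 6 : ℝ) := by
      rw [← Real.mul_rpow (by positivity) (by positivity),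
        ← Real.mul_rpow (by positivity) (by positivity), ← Nat.cast_mul, ← Nat.cast_mul]
      congr 2
      exact (Nat.add_one_mul_choose_eq (m + k) k).symm
    have p1 := pairCount_pos m
    have p2 := pairCount_pos k
    have p3 := pairCount_pos (m + k)
    have p4 := pairCount_pos (m + k + 1)
    have p5 := ratioError_pos (k + 1)
    have p6 := totalError_pos k
    have p7 : (0 : ℝ) ≤ ((m + (k + 1)).choose (k + 1) : ℝ) ^ (7 / 6 : ℝ) := by positivity
    calc pairCount (k + 1) * pairCount m * ((m + (k + 1)).choose (k + 1) : ℝ) ^ (7 / 6 : ℝ)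
        ≤ (((k + 1 : ℕ) : ℝ) ^ (7 / 6 : ℝ) * ratioError (k + 1) * pairCount k) * pairCount m *
          ((m + (k + 1)).choose (k + 1) : ℝ) ^ (7 / 6 : ℝ) := by gcongr
      _ = ratioError (k + 1) * pairCount k * pairCount m *
          (((m + (k + 1)).choose (k + 1) : ℝ) ^ (7 / 6 : ℝ) * ((k + 1 : ℕ) : ℝ) ^ (7 / 6 : ℝ)) := by
          ring
      _ = ratioError (k + 1) * ((m + k + 1 : ℕ) : ℝ) ^ (7 / 6 : ℝ) *
          (pairCount k * pairCount m * ((m + k).choose k : ℝ) ^ (7 / 6 : ℝ)) := by rw [hc]; ring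
      _ ≤ ratioError (k + 1) * ((m + k + 1 : ℕ) : ℝ) ^ (7 / 6 : ℝ) *
          (totalError k * pairCount (m + k)) := by gcongr
      _ = ratioError (k + 1) * totalError k *
          (((m + k + 1 : ℕ) : ℝ) ^ (7 / 6 : ℝ) * pairCount (m + k)) := by ring
      _ ≤ ratioError (k + 1) * totalError k *
          (ratioError (m + k + 1) * pairCount (m + k + 1)) := by gcongr
      _ ≤ ratioError (k + 1) * totalError k *
          (ratioError (k + 1) * pairCount (m + k + 1)) := by gcongr
      _ = totalError (k + 1) * pairCount (m + (k + 1)) := by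
          rw [totalError, totalError, Finset.prod_range_succ, ← add_assoc]; ring

/-! ### Disconnected pairs are a minority -/

theorem choose_mul_pairCount_le {n k : ℕ} (hk : k ≤ n) :
    (n.choose k : ℝ) * (pairCount k * pairCount (n - k)) ≤
      (n.choose k : ℝ) ^ (-(1 / 6) : ℝ) * totalError k * pairCount n := by
  have h := pairCount_mul_le (n - k) k
  rw [Nat.sub_add_cancel hk] at h
  have hc : (0 : ℝ) < n.choose k := Nat.cast_pos.2 (Nat.choose_pos hk)
  have e : (n.choose k : ℝ) = (n.choose k : ℝ) ^ (-(1 / 6) : ℝ) * (n.choose k : ℝ) ^ (7 / 6 : ℝ) := by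
    rw [← Real.rpow_add hc]; norm_num
  calc (n.choose k : ℝ) * (pairCount k * pairCount (n - k))
      = (n.choose k : ℝ) ^ (-(1 / 6) : ℝ) *
        (pairCount k * pairCount (n - k) * (n.choose k : ℝ) ^ (7 / 6 : ℝ)) := by
        conv_lhs => rw [e]
        ring
    _ ≤ (n.choose k : ℝ) ^ (-(1 / 6) : ℝ) * (totalError k * pairCount n) := by gcongr
    _ = _ := by ring

theorem two_pow_le_choose {n k : ℕ} (h : k ≤ n / 2) : 2 ^ k ≤ n.choose k := by
  have h1 : 2 ^ k ≤ (2 * k).choose k := by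
    rw [← Nat.centralBinom_eq_two_mul_choose]
    clear h
    induction k with
    | zero => simp
    | succ k ih =>
      have := Nat.succ_mul_centralBinom_succ k
      have h2 : (k + 1) * 2 ^ (k + 1) ≤ (k + 1) * (k + 1).centralBinom := by
        rw [this, pow_succ]
        have : (2 * k + 1) * 2 ^ k ≤ (2 * k + 1) * k.centralBinom := Nat.mul_le_mul_left _ ih
        nlinarith [Nat.two_pow_pos k]
      exact Nat.le_of_mul_le_mul_left h2 (by omega)
  exact h1.trans (Nat.choose_le_choose k (by omega))

theorem le_choose {n k : ℕ} (hk : 1 ≤ k) (h : k ≤ n / 2) : n ≤ n.choose k := by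
  obtain ⟨k, rfl⟩ : ∃ j, k = j + 1 := ⟨k - 1, by omega⟩
  clear hk
  induction k with
  | zero => simp
  | succ k ih =>
    refine (ih (by omega)).trans ?_
    exact Nat.choose_le_succ_of_lt_half_left (by omega)

/-- Dominated convergence applies to the sum divided by `pairCount n`. Each term tends to zero
because the binomial coefficient is at least `n`. As it is also at least `2^k`, the terms are
dominated by `2^(-k/6) * totalError k`, which is summable by the ratio test since `ratioError` tends
to `1`. -/
theorem eventually_sum_pairCount_le : ∀ᶠ n : ℕ in atTop,
    ∑ k ∈ Finset.Icc 1 (n / 2), (n.choose k : ℝ) * (pairCount k * pairCount (n - k)) ≤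
      pairCount n / 2 := by
  let F : ℕ → ℕ → ℝ := fun n k =>
    if k ∈ Finset.Icc 1 (n / 2) then (n.choose k : ℝ) ^ (-(1 / 6) : ℝ) * totalError k else 0
  let b : ℕ → ℝ := fun k => ((2 : ℝ) ^ (-(1 / 6) : ℝ)) ^ k * totalError k
  have hb : Summable b := by
    have h2 : (0 : ℝ) < (2 : ℝ) ^ (-(1 / 6) : ℝ) := by positivity
    have hbp : ∀ k, 0 < b k := fun k => mul_pos (pow_pos h2 k) (totalError_pos k)
    refine summable_of_ratio_test_tendsto_lt_one (l := (2 : ℝ) ^ (-(1 / 6) : ℝ))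
      (Real.rpow_lt_one_of_one_lt_of_neg (by norm_num) (by norm_num))
      (Eventually.of_forall fun k => (hbp k).ne') ?_
    have e : ∀ k, ‖b (k + 1)‖ / ‖b k‖ = (2 : ℝ) ^ (-(1 / 6) : ℝ) * ratioError (k + 1) ^ 2 := by
      intro k
      rw [Real.norm_of_nonneg (hbp _).le, Real.norm_of_nonneg (hbp _).le,
        div_eq_iff (hbp k).ne']
      simp only [b, totalError, Finset.prod_range_succ, pow_succ]
      ring
    simp only [e]
    have := ((tendsto_ratioError.comp (tendsto_add_atTop_nat 1)).pow 2).const_mul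
      ((2 : ℝ) ^ (-(1 / 6) : ℝ))
    simpa using this
  have hlim : Tendsto (fun n => ∑' k, F n k) atTop (𝓝 (∑' _ : ℕ, (0 : ℝ))) := by
    refine tendsto_tsum_of_dominated_convergence hb (fun k => ?_) (Eventually.of_forall fun n k => ?_)
    · have h0 : Tendsto (fun n : ℕ => (n : ℝ) ^ (-(1 / 6) : ℝ) * totalError k) atTop (𝓝 0) := by
        have := ((tendsto_rpow_neg_atTop (show (0 : ℝ) < 1 / 6 by norm_num)).comp
          tendsto_natCast_atTop_atTop).mul_const (totalError k)
        simpa using this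
      refine squeeze_zero' (Eventually.of_forall fun n => ?_) ?_ h0
      · simp only [F]
        have := totalError_pos k
        split_ifs <;> positivity
      · filter_upwards [eventually_ge_atTop 1] with n hn
        simp only [F]
        have := totalError_pos k
        split_ifs with h
        · rw [Finset.mem_Icc] at h
          refine mul_le_mul_of_nonneg_right ?_ this.le
          exact Real.rpow_le_rpow_of_nonpos (Nat.cast_pos.2 hn)
            (Nat.cast_le.2 (le_choose h.1 h.2)) (by norm_num)
        · positivity
    · have := totalError_pos k
      simp only [F, b]
      split_ifs with h
      · rw [Finset.mem_Icc] at h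
        rw [Real.norm_of_nonneg (by positivity)]
        refine mul_le_mul_of_nonneg_right ?_ this.le
        rw [← Real.rpow_natCast, ← Real.rpow_mul (by norm_num), mul_comm, Real.rpow_mul (by norm_num),
          Real.rpow_natCast]
        exact Real.rpow_le_rpow_of_nonpos (by positivity)
          (by exact_mod_cast two_pow_le_choose h.2) (by norm_num)
      · rw [norm_zero]; positivity
  rw [tsum_zero] at hlim
  filter_upwards [hlim.eventually (gt_mem_nhds (show (0 : ℝ) < 1 / 2 by norm_num))] with n hn
  have hF : ∑' k, F n k = ∑ k ∈ Finset.Icc 1 (n / 2),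
      (n.choose k : ℝ) ^ (-(1 / 6) : ℝ) * totalError k := by
    rw [tsum_eq_sum (s := Finset.Icc 1 (n / 2)) (fun k hk => if_neg hk)]
    exact Finset.sum_congr rfl fun k hk => if_pos hk
  rw [hF] at hn
  calc _ ≤ ∑ k ∈ Finset.Icc 1 (n / 2),
        (n.choose k : ℝ) ^ (-(1 / 6) : ℝ) * totalError k * pairCount n := by
        refine Finset.sum_le_sum fun k hk => choose_mul_pairCount_le ?_
        rw [Finset.mem_Icc] at hk
        omega
    _ = (∑ k ∈ Finset.Icc 1 (n / 2),
        (n.choose k : ℝ) ^ (-(1 / 6) : ℝ) * totalError k) * pairCount n := by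
        rw [Finset.sum_mul]
    _ ≤ 1 / 2 * pairCount n := mul_le_mul_of_nonneg_right hn.le (pairCount_pos n).le
    _ = _ := by ring

/-- Two ratios of order `n^(2/3)` separate `tern (n - 2)` from `tern n`. Together with
`sum_card_marks_le` this bounds the mean number of marks by `100 n^(2/3)`. -/
theorem sq_mul_tern_le {n : ℕ} (hn : 2 ≤ n) :
    (n : ℝ) ^ 2 * tern (n - 2) ≤ 100 * (n : ℝ) ^ (2 / 3 : ℝ) * tern n := by
  obtain ⟨n, rfl⟩ : ∃ m, n = m + 2 := ⟨n - 2, by omega⟩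
  rw [Nat.add_sub_cancel]
  have key : ∀ m : ℕ, ((m + 1 : ℕ) : ℝ) ^ (2 / 3 : ℝ) ≤ 5 * ternRatio m := by
    intro m
    have hm : (0 : ℝ) < ((m + 1 : ℕ) : ℝ) := by positivity
    have hm1 : (1 : ℝ) ≤ ((m + 1 : ℕ) : ℝ) := by
      rw [Nat.one_le_cast]; omega
    set t : ℝ := ((m + 1 : ℕ) : ℝ) ^ (1 / 3 : ℝ) with ht
    have ht1 : 1 ≤ t := Real.one_le_rpow hm1 (by norm_num)
    have ht3 : t ^ 3 = ((m + 1 : ℕ) : ℝ) := by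
      rw [ht, ← Real.rpow_natCast, ← Real.rpow_mul hm.le]; norm_num
    have ht2 : ((m + 1 : ℕ) : ℝ) ^ (2 / 3 : ℝ) = t ^ 2 := by
      rw [ht, ← Real.rpow_natCast, ← Real.rpow_mul hm.le]; norm_num
    have h1 := ternRatio_lower (n := m) ht1 (by rw [ht3]; push_cast; ring)
    have h2 := one_le_ternRatio m
    rw [ht2]
    have h3 : (t + 4) * ternRatio m ≤ (5 * t) * ternRatio m :=
      mul_le_mul_of_nonneg_right (by linarith) (by linarith)
    refine le_of_mul_le_mul_left (a := t) ?_ (by linarith)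
    linarith
  have h1 := key n
  have h2 := key (n + 1)
  have e : (tern (n + 2) : ℝ) = ternRatio (n + 1) * ternRatio n * tern n := by
    rw [mul_assoc, ternRatio_mul, ternRatio_mul]
  have hJ : (0 : ℝ) < tern n := Nat.cast_pos.2 (tern_pos n)
  have hY := one_le_ternRatio n
  have hY1 := one_le_ternRatio (n + 1)
  set N : ℝ := ((n + 1 + 1 : ℕ) : ℝ) with hN
  have hN0 : 0 < N := by positivity
  have h3 : N ^ (2 / 3 : ℝ) ≤ 2 * ((n + 1 : ℕ) : ℝ) ^ (2 / 3 : ℝ) := by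
    have h4 : N ≤ 2 * ((n + 1 : ℕ) : ℝ) := by
      rw [hN]; push_cast
      have : (0 : ℝ) ≤ n := Nat.cast_nonneg n
      linarith
    calc N ^ (2 / 3 : ℝ) ≤ (2 * ((n + 1 : ℕ) : ℝ)) ^ (2 / 3 : ℝ) :=
          Real.rpow_le_rpow hN0.le h4 (by norm_num)
      _ = 2 ^ (2 / 3 : ℝ) * ((n + 1 : ℕ) : ℝ) ^ (2 / 3 : ℝ) :=
          Real.mul_rpow (by norm_num) (by positivity)
      _ ≤ 2 ^ (1 : ℝ) * ((n + 1 : ℕ) : ℝ) ^ (2 / 3 : ℝ) := by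
          gcongr <;> norm_num
      _ = _ := by rw [Real.rpow_one]
  have h5 : N ^ 2 = N ^ (2 / 3 : ℝ) * (N ^ (2 / 3 : ℝ) * N ^ (2 / 3 : ℝ)) := by
    rw [← Real.rpow_add hN0, ← Real.rpow_add hN0, ← Real.rpow_natCast]; norm_num
  have h6 : N ^ (2 / 3 : ℝ) * N ^ (2 / 3 : ℝ) ≤ (5 * ternRatio (n + 1)) * (10 * ternRatio n) :=
    mul_le_mul h2 (by linarith) (by positivity) (by linarith)
  change N ^ 2 * tern n ≤ 100 * N ^ (2 / 3 : ℝ) * tern (n + 2)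
  rw [h5, e]
  have h7 : 0 ≤ N ^ (2 / 3 : ℝ) * tern n := by positivity
  have h8 : (N ^ (2 / 3 : ℝ) * tern n) * (N ^ (2 / 3 : ℝ) * N ^ (2 / 3 : ℝ)) ≤
      (N ^ (2 / 3 : ℝ) * tern n) * ((5 * ternRatio (n + 1)) * (10 * ternRatio n)) :=
    mul_le_mul_of_nonneg_left h6 h7
  have h9 : 0 ≤ (N ^ (2 / 3 : ℝ) * tern n) * (ternRatio (n + 1) * ternRatio n) :=
    mul_nonneg h7 (mul_nonneg (by linarith) (by linarith))
  nlinarith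

end ModularSubgroup

namespace ModularSubgroup

open Filter Topology

/-! ### Labellings of Stallings graphs -/

/-- A bijection from `V` to the vertices of the Stallings graph of `H` that maps `r` to the root. -/
structure IsLabelling {V : Type*} (r : V) {H : Subgroup PSL2Z} (κ : V → RightCosets H) : Prop where
  inj : Function.Injective κ
  root : κ r = coset H 1
  range : Set.range κ = (stallingsGraph H).verts

theorem exists_isLabelling {n : ℕ} (r : Fin n) {H : Subgroup PSL2Z} (hH : size H = n) :
    ∃ κ : Fin n → RightCosets H, IsLabelling r κ := by
  have hn : n ≠ 0 := fun h => (h ▸ r).elim0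
  have hfin : (stallingsGraph H).verts.Finite := Set.finite_of_ncard_ne_zero (hH.trans_ne hn)
  have := hfin.to_subtype
  let e : (stallingsGraph H).verts ≃ Fin n := Finite.equivFinOfCardEq hH
  let e' : Fin n ≃ (stallingsGraph H).verts := (Equiv.swap r (e ⟨_, root_mem_verts⟩)).trans e.symm
  refine ⟨fun x => e' x, Subtype.val_injective.comp e'.injective, ?_, ?_⟩
  · simp [e']
  · ext q
    constructor
    · rintro ⟨x, rfl⟩; exact (e' x).2
    · intro hq; exact ⟨e'.symm ⟨q, hq⟩, by simp⟩

theorem IsLabelling.exists_perm {V : Type*} {r : V} {H : Subgroup PSL2Z} {κ κ' : V → RightCosets H}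
    (h : IsLabelling r κ) (h' : IsLabelling r κ') :
    ∃ σ : Equiv.Perm V, σ r = r ∧ κ' = κ ∘ σ := by
  let σ : Equiv.Perm V := (Equiv.ofInjective κ' h'.inj).trans
    ((Equiv.setCongr (h'.range.trans h.range.symm)).trans (Equiv.ofInjective κ h.inj).symm)
  have hσ : ∀ x, κ (σ x) = κ' x := fun x => by
    simp only [σ, Equiv.trans_apply, Equiv.apply_ofInjective_symm]
    rfl
  exact ⟨σ, h.inj (by rw [hσ, h.root, h'.root]), funext fun x => (hσ x).symm⟩

theorem IsLabelling.comp {V : Type*} {r : V} {H : Subgroup PSL2Z} {κ : V → RightCosets H}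
    (h : IsLabelling r κ) {σ : Equiv.Perm V} (hσ : σ r = r) : IsLabelling r (κ ∘ σ) where
  inj := h.inj.comp σ.injective
  root := by simp [hσ, h.root]
  range := by rw [σ.surjective.range_comp, h.range]

theorem IsLabelling.represents {V : Type*} {r : V} {H : Subgroup PSL2Z} {κ : V → RightCosets H}
    (h : IsLabelling r κ) : (LabelledGraph.ofInduced r κ).Represents r κ :=
  represents_of_verts h.inj h.root h.range

theorem eq_of_ofInduced_eq {V : Type*} {r : V} {H H' : Subgroup PSL2Z} {κ : V → RightCosets H}
    {κ' : V → RightCosets H'} (h : IsLabelling r κ) (h' : IsLabelling r κ')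
    (he : LabelledGraph.ofInduced r κ = LabelledGraph.ofInduced r κ') : H = H' := by
  have key : ∀ x ℓ y, inducedStep κ x ℓ y ↔ inducedStep κ' x ℓ y := fun x ℓ y => by
    rw [← h.represents x ℓ y, he, h'.represents x ℓ y]
  exact le_antisymm (le_of_represents h.inj h.root h'.root h.range.ge fun x ℓ y => (key x ℓ y).1)
    (le_of_represents h'.inj h'.root h.root h'.range.ge fun x ℓ y => (key x ℓ y).2)

theorem eq_of_ofInduced_eq_of_eq {V : Type*} {r : V} {H : Subgroup PSL2Z}
    {κ κ' : V → RightCosets H} (h : IsLabelling r κ) (h' : IsLabelling r κ')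
    (he : LabelledGraph.ofInduced r κ = LabelledGraph.ofInduced r κ') : κ = κ' :=
  eq_of_represents h.root h'.root h.inj h.range fun x ℓ y hs =>
    (h'.represents x ℓ y).1 (he ▸ (h.represents x ℓ y).2 hs)

/-- The Stallings graph of an almost malnormal subgroup has few cycles that read a power of `ab`. -/
theorem IsAlmostMalnormal.card_cycles_le {V : Type*} [Fintype V] [DecidableEq V] {r : V}
    {H : Subgroup PSL2Z} (hH : IsAlmostMalnormal H) {κ : V → RightCosets H}
    (h : IsLabelling r κ) :
    (cyclesAvoiding (LabelledGraph.ofInduced r κ).mapAB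
      (marks (LabelledGraph.ofInduced r κ).mapB)).card ≤ 2 := by
  classical
  set P := LabelledGraph.ofInduced r κ with hP
  set C := cyclesAvoiding P.mapAB (marks P.mapB) with hC
  by_contra hlt
  push Not at hlt
  -- Distinct cycles are disjoint, so at most one contains the root, and three cycles leave two that
  -- avoid it.
  have h1 : (C.filter fun O => r ∈ O).card ≤ 1 := by
    refine Finset.card_le_one.2 fun O hO O' hO' => ?_
    rw [Finset.mem_filter, hC, mem_cyclesAvoiding] at hO hO'
    exact hO.1.1.eq_of_mem hO'.1.1 hO.2 hO'.2
  have h2 := Finset.card_filter_add_card_filter_not (s := C) (fun O => r ∈ O)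
  obtain ⟨O, hO, O', hO', hne⟩ := Finset.one_lt_card.1
    (show 1 < (C.filter fun O => ¬ r ∈ O).card by omega)
  rw [Finset.mem_filter, hC, mem_cyclesAvoiding] at hO hO'
  have hinj : Function.Injective P.mapAB :=
    (IsTernary.injective (LabelledGraph.isTernary_ofInduced h.inj)).comp
      (IsInvolutive.injective (LabelledGraph.isInvolutive_ofInduced h.inj))
  have key : ∀ O : Finset V, (IsCycleOf P.mapAB O ∧ Disjoint O (marks P.mapB)) ∧ r ∉ O →
      ∀ x ∈ O, ∀ m, Function.IsPeriodicPt P.mapAB m x →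
        act (κ x) ((genA * genB) ^ m) = κ x := by
    rintro O ⟨⟨h3, h4⟩, h5⟩ x hx m hm
    have hit : ∀ j, P.mapAB^[j] x ∈ O := by
      intro j
      induction j with
      | zero => simpa using hx
      | succ j ih =>
        rw [Function.iterate_succ_apply']
        exact h3.2.1 _ ih
    rw [← h.represents.act_pow LabelledGraph.mapB_root_ofInduced (fun j => ⟨?_, ?_⟩), hm.eq]
    · exact fun he => h5 (he ▸ hit j)
    · have := Finset.disjoint_left.1 h4 (hit j)
      simpa [marks] using this
  obtain ⟨x, hx⟩ := hO.1.1.1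
  obtain ⟨y, hy⟩ := hO'.1.1.1
  obtain ⟨m, hm, hmx⟩ := hinj.mem_periodicPts x
  obtain ⟨m', hm', hmy⟩ := hinj.mem_periodicPts y
  -- The product of the two periods is a common exponent for which the power of `ab` fixes both
  -- cosets.
  have hxy := h.inj (hH.eq_of_act_eq (Nat.mul_pos hm hm')
    (key O hO x hx _ (hmx.mul_const m')) (key O' hO' y hy _ (hmy.const_mul m)))
  subst hxy
  exact hne (hO.1.1.eq_of_mem hO'.1.1 hx hy)

/-! ### Counting subgroups of a given size -/

section Fixed

variable {n : ℕ} (r : Fin n)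

/-- A choice of labelling. -/
noncomputable def labelling {H : Subgroup PSL2Z} (hH : size H = n) : Fin n → RightCosets H :=
  (exists_isLabelling r hH).choose

theorem isLabelling_labelling {H : Subgroup PSL2Z} (hH : size H = n) :
    IsLabelling r (labelling r hH) := (exists_isLabelling r hH).choose_spec

/-- The components of a labelled graph. -/
def toTuple {V : Type*} (P : LabelledGraph V) :
    ((V → V × Bool) × (V → V × Bool)) × (Bool × Bool) := ((P.mapA, P.mapB), (P.flagA, P.flagB))

theorem toTuple_injective {V : Type*} : Function.Injective (toTuple (V := V)) := by
  rintro ⟨a, b, c, d⟩ ⟨a', b', c', d'⟩ h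
  simp only [toTuple, Prod.mk.injEq] at h
  obtain ⟨⟨rfl, rfl⟩, rfl, rfl⟩ := h
  rfl

/-- The encoding of the Stallings graph of `H` that is labelled by a permutation. -/
noncomputable def encode (p : fgSubgroupsOfSize n × {σ : Equiv.Perm (Fin n) // σ r = r}) :
    LabelledGraph (Fin n) := LabelledGraph.ofInduced r (labelling r p.1.2.2 ∘ p.2.1)

theorem encode_injective : Function.Injective (encode r) := by
  rintro ⟨⟨H, hH⟩, σ, hσ⟩ ⟨⟨H', hH'⟩, σ', hσ'⟩ h
  have l1 := isLabelling_labelling r hH.2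
  have l2 := isLabelling_labelling r hH'.2
  obtain rfl := eq_of_ofInduced_eq (l1.comp hσ) (l2.comp hσ') h
  have h1 := eq_of_ofInduced_eq_of_eq (l1.comp hσ) (l2.comp hσ') h
  have : σ = σ' := Equiv.ext fun x => l1.inj (congrFun h1 x)
  subst this
  rfl

include r in
theorem finite_fgSubgroupsOfSize : (fgSubgroupsOfSize n).Finite := by
  have h : Function.Injective fun H : fgSubgroupsOfSize n =>
      toTuple (encode r (H, ⟨1, rfl⟩)) := fun H H' h => by
    have := encode_injective r (toTuple_injective h)
    simpa using this
  exact Set.finite_coe_iff.1 (Finite.of_injective _ h)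

open Classical in
-- A subgroup with a permutation fixing `r` is sent injectively to a pair of maps with few cycles
-- and two flags; the flags account for the factor `4`.
theorem card_almostMalnormal_le :
    {H | H ∈ fgSubgroupsOfSize n ∧ IsAlmostMalnormal H}.ncard *
        Nat.card {σ : Equiv.Perm (Fin n) // σ r = r} ≤
      4 * ((mapsOn IsInvolutive (Finset.univ : Finset (Fin n)) ×ˢ
        mapsOn IsTernary (Finset.univ : Finset (Fin n))).filter fun p =>
          (cyclesAvoiding (fun x => (p.2 (p.1 x).1).1) (marks p.2)).card ≤ 2).card := by
  set B := (mapsOn IsInvolutive (Finset.univ : Finset (Fin n)) ×ˢ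
    mapsOn IsTernary (Finset.univ : Finset (Fin n))).filter fun p =>
      (cyclesAvoiding (fun x => (p.2 (p.1 x).1).1) (marks p.2)).card ≤ 2 with hB
  let F : {H | H ∈ fgSubgroupsOfSize n ∧ IsAlmostMalnormal H} ×
      {σ : Equiv.Perm (Fin n) // σ r = r} → B × (Bool × Bool) := fun p =>
    (⟨(toTuple (encode r (⟨p.1.1, p.1.2.1⟩, p.2))).1, by
      have l := (isLabelling_labelling r p.1.2.1.2).comp p.2.2
      rw [hB, Finset.mem_filter, Finset.mem_product, mem_mapsOn_univ, mem_mapsOn_univ]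
      exact ⟨⟨LabelledGraph.isInvolutive_ofInduced (r := r) l.inj,
        LabelledGraph.isTernary_ofInduced (r := r) l.inj⟩,
        p.1.2.2.card_cycles_le l⟩⟩, (toTuple (encode r (⟨p.1.1, p.1.2.1⟩, p.2))).2)
  have hF : Function.Injective F := by
    intro p q h
    have h1 := congrArg (fun z => ((z.1 : (Fin n → Fin n × Bool) × (Fin n → Fin n × Bool)), z.2)) h
    have h2 := encode_injective r (toTuple_injective h1)
    simp only [Prod.mk.injEq, Subtype.mk.injEq] at h2
    exact Prod.ext (Subtype.ext h2.1) h2.2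
  have := Nat.card_le_card_of_injective F hF
  rw [Nat.card_prod, Nat.card_prod, Nat.card_coe_set_eq] at this
  simpa [mul_comm] using this

open Classical in
-- A connected pair with both flags off is the graph of some subgroup, up to a permutation that
-- compares it with the chosen labelling. The pair is recovered from the edges by `eq_of_step_iff`.
theorem card_connected_le :
    ((mapsOn IsInvolutive (Finset.univ : Finset (Fin n)) ×ˢ
      mapsOn IsTernary (Finset.univ : Finset (Fin n))).filter IsConnectedPair).card ≤
    (fgSubgroupsOfSize n).ncard * Nat.card {σ : Equiv.Perm (Fin n) // σ r = r} := by
  set C := (mapsOn IsInvolutive (Finset.univ : Finset (Fin n)) ×ˢ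
    mapsOn IsTernary (Finset.univ : Finset (Fin n))).filter IsConnectedPair with hC
  have key : ∀ p : C, ∃ (q : fgSubgroupsOfSize n × {σ : Equiv.Perm (Fin n) // σ r = r}),
      (⟨p.1.1, p.1.2, false, false⟩ : LabelledGraph (Fin n)).Represents r
        (labelling r q.1.2.2 ∘ q.2.1) := by
    rintro ⟨⟨f, g⟩, hp⟩
    rw [hC, Finset.mem_filter, Finset.mem_product, mem_mapsOn_univ, mem_mapsOn_univ] at hp
    obtain ⟨H, κ, hfg, hκ, hr, hv, hrep⟩ := LabelledGraph.exists_subgroup (r := r) hp.1.1 hp.1.2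
      (fun S hS hcl x => by
        have := hp.2 S.toFinset ⟨r, by simpa using hS⟩ (fun y hy => by
          simpa using hcl y (by simpa using hy))
        have hx := Finset.mem_univ x
        rw [← this] at hx
        simpa using hx)
    have hsize : size H = n := by
      rw [size, ← hv, ← Set.image_univ, Set.ncard_image_of_injective _ hκ, Set.ncard_univ,
        Nat.card_eq_fintype_card, Fintype.card_fin]
    obtain ⟨σ, hσ, he⟩ := (isLabelling_labelling r hsize).exists_perm ⟨hκ, hr, hv⟩
    refine ⟨(⟨H, hfg, hsize⟩, ⟨σ, hσ⟩), ?_⟩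
    rw [he] at hrep
    exact hrep
  choose G hG using key
  have hinj : Function.Injective G := by
    rintro ⟨⟨f, g⟩, hp⟩ ⟨⟨f', g'⟩, hp'⟩ h
    have h1 := hG ⟨⟨f, g⟩, hp⟩
    have h2 := hG ⟨⟨f', g'⟩, hp'⟩
    rw [h] at h1
    rw [hC, Finset.mem_filter, Finset.mem_product, mem_mapsOn_univ, mem_mapsOn_univ] at hp hp'
    obtain ⟨rfl, rfl⟩ := LabelledGraph.eq_of_step_iff hp.1.1 hp.1.2 hp'.1.1 hp'.1.2
      (fun x ℓ y => (h1 x ℓ y).trans (h2 x ℓ y).symm)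
    rfl
  have := (finite_fgSubgroupsOfSize r).to_subtype
  have := Nat.card_le_card_of_injective G hinj
  rw [Nat.card_prod, Nat.card_coe_set_eq] at this
  simpa using this

/-! #### Existence -/

/-- The `a`-edges of a path. -/
def pathA (n : ℕ) (x : Fin n) : Fin n × Bool :=
  (if h : x.1 % 2 = 0 ∧ x.1 + 1 < n then ⟨x.1 + 1, h.2⟩
    else if x.1 % 2 = 0 then x else ⟨x.1 - 1, by omega⟩, false)

/-- The `b`-edges of a path. -/
def pathB (n : ℕ) (x : Fin n) : Fin n × Bool :=
  if h : x.1 % 2 = 1 ∧ x.1 + 1 < n then (⟨x.1 + 1, h.2⟩, true)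
    else if x.1 % 2 = 1 ∨ x.1 = 0 then (x, false) else (⟨x.1 - 1, by omega⟩, false)

theorem isInvolutive_pathA (x : Fin n) : IsInvolutive (pathA n) x := by
  refine ⟨rfl, Fin.ext ?_⟩
  by_cases h1 : x.1 % 2 = 0 ∧ x.1 + 1 < n
  · have : ¬ ((x.1 + 1) % 2 = 0) := by omega
    simp [pathA, h1, this]
  · by_cases h2 : x.1 % 2 = 0
    · have h3 : ¬ (x.1 + 1 < n) := fun h => h1 ⟨h2, h⟩
      simp [pathA, h2, h3]
    · have h3 : (x.1 - 1) % 2 = 0 := by omega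
      have h4 : x.1 - 1 + 1 < n := by omega
      have h5 : x.1 - 1 + 1 = x.1 := by omega
      simp [pathA, h2, h3, h5]

theorem isTernary_pathB (x : Fin n) : IsTernary (pathB n) x := by
  by_cases h1 : x.1 % 2 = 1 ∧ x.1 + 1 < n
  · have h2 : ¬ ((x.1 + 1) % 2 = 1) := by omega
    right
    have e1 : pathB n x = (⟨x.1 + 1, h1.2⟩, true) := by simp [pathB, h1]
    have e2 : pathB n ⟨x.1 + 1, h1.2⟩ = (x, false) := by simp [pathB, h2]
    rw [e1, e2]
    exact ⟨rfl, fun h => by simpa using congrArg Fin.val h, rfl⟩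
  · by_cases h2 : x.1 % 2 = 1 ∨ x.1 = 0
    · left
      have e1 : pathB n x = (x, false) := by rw [pathB, dif_neg h1, if_pos h2]
      simp [e1]
    · have h3 : (x.1 - 1) % 2 = 1 ∧ x.1 - 1 + 1 < n := by omega
      right
      have e1 : pathB n x = (⟨x.1 - 1, by omega⟩, false) := by rw [pathB, dif_neg h1, if_neg h2]
      have e2 : pathB n ⟨x.1 - 1, by omega⟩ = (x, true) := by
        rw [pathB, dif_pos h3]
        exact Prod.ext (Fin.ext (show x.1 - 1 + 1 = x.1 by omega)) rfl
      rw [e1, e2]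
      refine ⟨rfl, fun h => ?_, rfl⟩
      have := congrArg Fin.val h
      simp only at this
      omega

theorem isConnectedPair_path : IsConnectedPair (pathA n, pathB n) := by
  intro S hS hcl
  have up : ∀ x ∈ S, ∀ h : x.1 + 1 < n, (⟨x.1 + 1, h⟩ : Fin n) ∈ S := by
    intro x hx h
    by_cases h1 : x.1 % 2 = 0
    · have := (hcl x hx).1
      rwa [show (pathA n x).1 = ⟨x.1 + 1, h⟩ by simp [pathA, h1, h]] at this
    · have := (hcl x hx).2
      rwa [show (pathB n x).1 = ⟨x.1 + 1, h⟩ by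
        rw [pathB, dif_pos ⟨by omega, h⟩]] at this
  have down : ∀ x ∈ S, x.1 ≠ 0 → (⟨x.1 - 1, by omega⟩ : Fin n) ∈ S := by
    intro x hx h
    by_cases h1 : x.1 % 2 = 0
    · have := (hcl x hx).2
      rwa [show (pathB n x).1 = ⟨x.1 - 1, by omega⟩ by
        rw [pathB, dif_neg (by omega), if_neg (by omega)]] at this
    · have := (hcl x hx).1
      rwa [show (pathA n x).1 = ⟨x.1 - 1, by omega⟩ by simp [pathA, h1]] at this
  obtain ⟨x, hx⟩ := hS
  have zero : ∀ k (hk : k < n), (⟨k, hk⟩ : Fin n) ∈ S → (⟨0, by omega⟩ : Fin n) ∈ S := by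
    intro k
    induction k with
    | zero => exact fun _ h => h
    | succ k ih => exact fun hk h => ih (by omega) (down _ h (by simp))
  have h0 := zero x.1 x.2 hx
  have all : ∀ k (hk : k < n), (⟨k, hk⟩ : Fin n) ∈ S := by
    intro k
    induction k with
    | zero => exact fun _ => h0
    | succ k ih => exact fun hk => up _ (ih (by omega)) hk
  exact Finset.eq_univ_iff_forall.2 fun y => all y.1 y.2

include r in
theorem nonempty_fgSubgroupsOfSize : (fgSubgroupsOfSize n).Nonempty := by
  classical
  have h := card_connected_le r
  have hpos : 0 < ((mapsOn IsInvolutive (Finset.univ : Finset (Fin n)) ×ˢ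
      mapsOn IsTernary (Finset.univ : Finset (Fin n))).filter IsConnectedPair).card :=
    -- A path with alternating `a`- and `b`-edges is a connected pair for every `n`, which yields a
    -- subgroup without any asymptotic estimate.
    Finset.card_pos.2 ⟨(pathA n, pathB n), Finset.mem_filter.2 ⟨Finset.mem_product.2
      ⟨mem_mapsOn_univ.2 isInvolutive_pathA, mem_mapsOn_univ.2 isTernary_pathB⟩,
      isConnectedPair_path⟩⟩
  exact Set.nonempty_of_ncard_ne_zero (Nat.pos_of_mul_pos_right (hpos.trans_le h)).ne'

end Fixed

/-! ### The probability of almost malnormality -/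

open Classical in
theorem eventually_half_le_connected : ∀ᶠ n : ℕ in atTop, pairCount n / 2 ≤
    (((mapsOn IsInvolutive (Finset.univ : Finset (Fin n)) ×ˢ
      mapsOn IsTernary (Finset.univ : Finset (Fin n))).filter IsConnectedPair).card : ℝ) := by
  filter_upwards [eventually_sum_pairCount_le] with n hn
  have h1 := card_not_connected_le (V := Fin n)
  have h2 := Finset.card_filter_add_card_filter_not (s := mapsOn IsInvolutive
    (Finset.univ : Finset (Fin n)) ×ˢ mapsOn IsTernary (Finset.univ : Finset (Fin n)))
    IsConnectedPair
  rw [Finset.card_product, card_involutions, card_ternary, Finset.card_univ] at h2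
  simp only [Fintype.card_fin] at h1 h2
  have h3 : (_ : ℝ) ≤ _ := Nat.cast_le.2 h1
  have h4 : ((_ : ℕ) : ℝ) = _ := congrArg Nat.cast h2
  push_cast at h3 h4
  have h5 : ∑ k ∈ Finset.Icc 1 (n / 2), (n.choose k : ℝ) *
      ((invol k * invol (n - k)) * (tern k * tern (n - k))) =
      ∑ k ∈ Finset.Icc 1 (n / 2), (n.choose k : ℝ) * (pairCount k * pairCount (n - k)) :=
    Finset.sum_congr rfl fun k _ => by rw [pairCount, pairCount]; ring
  rw [h5] at h3
  have h6 : pairCount n = invol n * tern n := rfl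
  linarith

open Classical in
theorem exists_card_few_cycles_le {α : ℝ} (hα0 : 0 < α) (hα1 : α < 1 / 6) :
    ∃ D : ℝ, 0 ≤ D ∧ ∀ n : ℕ, 2 ≤ n → (((mapsOn IsInvolutive (Finset.univ : Finset (Fin n)) ×ˢ
      mapsOn IsTernary (Finset.univ : Finset (Fin n))).filter fun p =>
        (cyclesAvoiding (fun x => (p.2 (p.1 x).1).1) (marks p.2)).card ≤ 2).card : ℝ) ≤
      D * (n : ℝ) ^ (-α) * pairCount n := by
  -- With exponent `3α`, the recursion requires `6α < 1 - s`. Half of the available gap `1 - 6α` is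
  -- positive and satisfies this.
  set s : ℝ := (1 - 6 * α) / 2 with hs
  have hs0 : 0 < s := by rw [hs]; linarith
  have hs1 : s ≤ 1 := by rw [hs]; linarith
  obtain ⟨u₀, hu₀⟩ := exists_invol_rpow_le (γ := 3 * α) (s := s) (by linarith) (by linarith)
    hs0.le (by rw [hs]; linarith)
  -- The number `103 + u₀` is `1 + (u₀ + 2) + 100`, where `100` comes from the mean number of marks.
  -- Division by `s ^ 2` is Markov's inequality for at most two cycles.
  refine ⟨(103 + u₀) / s ^ 2, by positivity, fun n hn => ?_⟩
  have hn0 : (0 : ℝ) < n := Nat.cast_pos.2 (by omega)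
  have hn1 : (1 : ℝ) ≤ n := Nat.one_le_cast.2 (by omega)
  set t : ℝ := (n : ℝ) ^ (2 / 3 : ℝ) with ht
  have ht1 : 1 ≤ t := Real.one_le_rpow hn1 (by norm_num)
  have ht0 : 0 < t := zero_lt_one.trans_le ht1
  have hI : (0 : ℝ) < invol n := Nat.cast_pos.2 (invol_pos n)
  have hJ : (0 : ℝ) < tern n := Nat.cast_pos.2 (tern_pos n)
  have inner : ∀ g ∈ mapsOn IsTernary (Finset.univ : Finset (Fin n)),
      ∑ f ∈ mapsOn IsInvolutive (Finset.univ : Finset (Fin n)),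
        s ^ (cyclesAvoiding (fun x => (g (f x).1).1) (marks g)).card ≤
      invol n * ((n : ℝ) ^ (-α) * (1 + ((marks g).card + (u₀ + 2)) / t)) := by
    intro g hg
    let β : Equiv.Perm (Fin n) := Equiv.ofBijective _
      (Finite.injective_iff_bijective.1 (IsTernary.injective (mem_mapsOn_univ.1 hg)))
    -- Above this threshold closing pairs exist and the inequality of `exists_invol_rpow_le` holds;
    -- below it the ratio `(K + 1)/(u + 1)` is at least `1`, which makes the bound trivial.
    set K : ℕ := (marks g).card + 1 + u₀ with hK
    have hA : (0 : ℝ) ≤ (K : ℝ) + 1 := by positivity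
    have h := sum_pow_card_cycles_le (E := marks g) hs0 hs1 (K := K) (by omega)
      (c := fun u => invol u * (((K : ℝ) + 1) / (u + 1)) ^ (3 * α)) (fun u => by positivity)
      (fun u hu => by
        have h1 : (1 : ℝ) ≤ ((K : ℝ) + 1) / (u + 1) := by
          rw [one_le_div (by positivity)]
          have : (u : ℝ) ≤ K := Nat.cast_le.2 hu
          linarith
        exact le_mul_of_one_le_right (Nat.cast_nonneg _)
          (Real.one_le_rpow h1 (by linarith)))
      (fun u hu => hu₀ u (by omega) _ hA) β Finset.univ
    refine (show _ ≤ _ from h).trans ?_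
    rw [Finset.card_univ, Fintype.card_fin]
    have hbase : (((K : ℝ) + 1) / (n + 1)) ^ (3 * α) ≤
        (n : ℝ) ^ (-α) * (1 + ((marks g).card + (u₀ + 2)) / t) := by
      have hKe : (K : ℝ) + 1 = (marks g).card + (u₀ + 2) := by rw [hK]; push_cast; ring
      rw [← hKe]
      calc (((K : ℝ) + 1) / (n + 1)) ^ (3 * α) ≤ (((K : ℝ) + 1) / n) ^ (3 * α) := by
            refine Real.rpow_le_rpow (by positivity) ?_ (by linarith)
            exact div_le_div_of_nonneg_left hA hn0 (by linarith)
        _ = ((n : ℝ) ^ (-(1 / 3) : ℝ) * (((K : ℝ) + 1) / t)) ^ (3 * α) := by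
            congr 1
            have : (n : ℝ) ^ (-(1 / 3) : ℝ) = t / n := by
              rw [ht, eq_div_iff hn0.ne']
              nth_rewrite 2 [← Real.rpow_one (n : ℝ)]
              rw [← Real.rpow_add hn0]; norm_num
            rw [this]; field_simp
        _ = (n : ℝ) ^ (-α) * (((K : ℝ) + 1) / t) ^ (3 * α) := by
            rw [Real.mul_rpow (by positivity) (by positivity), ← Real.rpow_mul hn0.le]
            congr 2; ring
        -- As `3α ≤ 1`, the power is bounded by a linear function, so that averaging over `g` only
        -- involves the mean number of marks.
        _ ≤ (n : ℝ) ^ (-α) * (1 + ((K : ℝ) + 1) / t) := by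
            refine mul_le_mul_of_nonneg_left ?_ (by positivity)
            have hx : 0 ≤ ((K : ℝ) + 1) / t := by positivity
            have := rpow_one_add_le_one_add_mul_self (s := ((K : ℝ) + 1) / t - 1) (by linarith)
              (p := 3 * α) (by linarith) (by linarith)
            rw [add_sub_cancel] at this
            nlinarith
    calc _ ≤ (invol n : ℝ) * (((K : ℝ) + 1) / (n + 1)) ^ (3 * α) * 1 :=
          mul_le_mul_of_nonneg_left (pow_le_one₀ hs0.le hs1) (by positivity)
      _ ≤ _ := by
          rw [mul_one]
          exact mul_le_mul_of_nonneg_left hbase hI.le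
  have total : ∑ g ∈ mapsOn IsTernary (Finset.univ : Finset (Fin n)),
      (1 + ((marks g).card + (u₀ + 2)) / t) ≤ (103 + u₀) * tern n := by
    have h1 : ((∑ g ∈ mapsOn IsTernary (Finset.univ : Finset (Fin n)), (marks g).card : ℕ) : ℝ) ≤
        100 * t * tern n := by
      have := sum_card_marks_le (V := Fin n)
      rw [Fintype.card_fin] at this
      refine le_trans (Nat.cast_le.2 this) ?_
      push_cast
      exact sq_mul_tern_le hn
    have h2 : ∑ g ∈ mapsOn IsTernary (Finset.univ : Finset (Fin n)),
        (1 + ((marks g).card + (u₀ + 2)) / t) = tern n * (1 + (u₀ + 2) / t) +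
        ((∑ g ∈ mapsOn IsTernary (Finset.univ : Finset (Fin n)), (marks g).card : ℕ) : ℝ) / t := by
      have : ∀ g : Fin n → Fin n × Bool, (1 + ((marks g).card + (u₀ + 2)) / t : ℝ) =
          (1 + (u₀ + 2) / t) + (marks g).card / t := fun g => by ring
      simp only [this]
      rw [Finset.sum_add_distrib, Finset.sum_const, card_ternary, Finset.card_univ,
        Fintype.card_fin, nsmul_eq_mul, Nat.cast_sum, Finset.sum_div]
    rw [h2]
    have h3 : ((∑ g ∈ mapsOn IsTernary (Finset.univ : Finset (Fin n)), (marks g).card : ℕ) : ℝ) / t ≤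
        100 * tern n := by
      rw [div_le_iff₀ ht0]; linarith
    have h4 : (u₀ + 2 : ℝ) / t ≤ u₀ + 2 := div_le_self (by positivity) ht1
    nlinarith
  have hB : (((mapsOn IsInvolutive (Finset.univ : Finset (Fin n)) ×ˢ
      mapsOn IsTernary (Finset.univ : Finset (Fin n))).filter fun p =>
        (cyclesAvoiding (fun x => (p.2 (p.1 x).1).1) (marks p.2)).card ≤ 2).card : ℝ) * s ^ 2 ≤
      ∑ g ∈ mapsOn IsTernary (Finset.univ : Finset (Fin n)),
        ∑ f ∈ mapsOn IsInvolutive (Finset.univ : Finset (Fin n)),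
          s ^ (cyclesAvoiding (fun x => (g (f x).1).1) (marks g)).card := by
    rw [← nsmul_eq_mul, ← Finset.sum_const, Finset.sum_comm, ← Finset.sum_product']
    refine le_trans (Finset.sum_le_sum fun p hp => ?_)
      (Finset.sum_le_sum_of_subset_of_nonneg (Finset.filter_subset _ _) fun p _ _ => by positivity)
    exact pow_le_pow_of_le_one hs0.le hs1 (Finset.mem_filter.1 hp).2
  rw [div_mul_eq_mul_div, div_mul_eq_mul_div, le_div_iff₀ (by positivity)]
  calc _ ≤ _ := hB
    _ ≤ ∑ g ∈ mapsOn IsTernary (Finset.univ : Finset (Fin n)),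
        invol n * ((n : ℝ) ^ (-α) * (1 + ((marks g).card + (u₀ + 2)) / t)) :=
        Finset.sum_le_sum inner
    _ = invol n * (n : ℝ) ^ (-α) * ∑ g ∈ mapsOn IsTernary (Finset.univ : Finset (Fin n)),
        (1 + ((marks g).card + (u₀ + 2)) / t) := by
        rw [Finset.mul_sum]
        exact Finset.sum_congr rfl fun g _ => by ring
    _ ≤ invol n * (n : ℝ) ^ (-α) * ((103 + u₀) * tern n) :=
        mul_le_mul_of_nonneg_left total (by positivity)
    _ = _ := by rw [pairCount]; ring

end ModularSubgroup

theorem mainTheorem1 (α : ℝ) (hα_pos : 0 < α) (hα_lt : α < 1 / 6) :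
    (∀ n : ℕ, 1 ≤ n → (ModularSubgroup.fgSubgroupsOfSize n).Finite ∧
      (ModularSubgroup.fgSubgroupsOfSize n).Nonempty) ∧
    (fun n : ℕ => ModularSubgroup.probOfSize n ModularSubgroup.IsAlmostMalnormal)
      =O[Filter.atTop] (fun n : ℕ => (n : ℝ) ^ (-α)) := by
  classical
  refine ⟨fun n hn => ⟨ModularSubgroup.finite_fgSubgroupsOfSize ⟨0, hn⟩,
    ModularSubgroup.nonempty_fgSubgroupsOfSize ⟨0, hn⟩⟩, ?_⟩
  obtain ⟨D, hD0, hD⟩ := ModularSubgroup.exists_card_few_cycles_le hα_pos hα_lt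
  -- The factor `8` combines the `4` choices of flags with the factor `2` lost because only half of
  -- the pairs are known to be connected.
  refine Asymptotics.IsBigO.of_bound (8 * D) ?_
  filter_upwards [ModularSubgroup.eventually_half_le_connected, Filter.eventually_ge_atTop 2]
    with n hn hn2
  have hn0 : (0 : ℝ) < n := Nat.cast_pos.2 (by omega)
  let r : Fin n := ⟨0, by omega⟩
  have h1 := ModularSubgroup.card_almostMalnormal_le r
  have h2 := ModularSubgroup.card_connected_le r
  have h3 := hD n hn2
  have hN : 0 < Nat.card {σ : Equiv.Perm (Fin n) // σ r = r} :=
    Nat.card_pos_iff.2 ⟨⟨1, rfl⟩, inferInstance⟩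
  set N := Nat.card {σ : Equiv.Perm (Fin n) // σ r = r}
  have h1' : (_ : ℝ) ≤ _ := Nat.cast_le.2 h1
  have h2' : (_ : ℝ) ≤ _ := Nat.cast_le.2 h2
  push_cast at h1' h2'
  have hT := ModularSubgroup.pairCount_pos n
  have hN' : (0 : ℝ) < N := Nat.cast_pos.2 hN
  have hS : (0 : ℝ) < (ModularSubgroup.fgSubgroupsOfSize n).ncard := by
    by_contra hc
    push Not at hc
    nlinarith
  rw [ModularSubgroup.probOfSize, Real.norm_of_nonneg (by positivity),
    Real.norm_of_nonneg (by positivity), div_le_iff₀ hS]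
  have hp : (0 : ℝ) ≤ D * (n : ℝ) ^ (-α) := by positivity
  have h5 : 4 * (D * (n : ℝ) ^ (-α) * ModularSubgroup.pairCount n) ≤
      8 * (D * (n : ℝ) ^ (-α)) * ((ModularSubgroup.fgSubgroupsOfSize n).ncard * N) := by
    have := mul_le_mul_of_nonneg_left (hn.trans h2') hp
    linarith
  refine le_of_mul_le_mul_right ?_ hN'
  calc _ ≤ _ := h1'
    _ ≤ 4 * (D * (n : ℝ) ^ (-α) * ModularSubgroup.pairCount n) :=
        mul_le_mul_of_nonneg_left h3 (by norm_num)
    _ ≤ _ := h5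
    _ = _ := by ring
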